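/- Let $\Delta\subset\mathbb R^2$ be a Delzant polygon, i.e. a convex polygon whose sides have rational slopes and such that at every vertex the primitive integer vectors directed along the two adjacent sides form a basis of $\mathbb Z^2$. At time $0$ send from every vertex of $\Delta$ a particle of mass $1$ whose velocity is the sum of the two primitive vectors spanning the sides adjacent to this vertex. Particles move rectilinearly; when a group of particles collides, it is replaced by one particle with the same total momentum (mass times velocity), where the new velocity is a primitive integer vector and the new mass a positive integer, or by nothing if the total momentum is zero. Let $C_\Delta$ be the union of the trajectories of all particles, regarded as a planar graph whose vertices are the points near which $C_\Delta$ is not a straight line; the multiplicity of an edge is the mass of the particles tracing it, and an edge is multiple if its multiplicity is greater than $1$. The multiplicity of a vertex is twice the area of the dual lattice polygon (its sides are orthogonal to the edges coming out of the vertex, with lattice lengths equal to the multiplicities of these edges), and a vertex is smooth if its multiplicity is $1$. Then the process ends with no particles left after finitely many collisions, there is exactly one point $p_\Delta$ (the terminal point) at which a group of particles annihilates without emission of a new particle, and the following holds. 1. If $p_\Delta$ is a vertex of $C_\Delta$, then all edges of $C_\Delta$ have multiplicity $1$, i.e. $C_\Delta$ has no multiple edges. Moreover, every vertex of $C_\Delta$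 other than $p_\Delta$ and the vertices of $\Delta$ is $3$-valent and smooth. 2. If $p_\Delta$ is not a vertex of $C_\Delta$, then it is the midpoint of the last edge $last_\Delta$ of $C_\Delta$ (the edge traced by the particles after all other edges). This edge has multiplicity $2$ and all other edges have multiplicity $1$, so that $last_\Delta$ is the only multiple edge. Moreover, every vertex of $C_\Delta$ other than the ends of $last_\Delta$ and the vertices of $\Delta$ is $3$-valent and smooth. -/

import Mathlib

namespace Caustic

open Set Filter Topology

/-- The plane. -/
abbrev Plane := ℝ × ℝ

/-- The integer lattice of the plane. -/
abbrev Lattice := ℤ × ℤ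

/-- The inclusion of the lattice in the plane. -/
def toPlane (u : Lattice) : Plane := ((u.1 : ℝ), (u.2 : ℝ))

/-- The determinant of two vectors of the plane. -/
def det (x y : Plane) : ℝ := x.1 * y.2 - x.2 * y.1

/-- The determinant of two lattice vectors. -/
def latDet (u w : Lattice) : ℤ := u.1 * w.2 - u.2 * w.1

/-- Primitive lattice vectors. -/
def IsPrimitive (u : Lattice) : Prop := Int.gcd u.1 u.2 = 1

/-- `u` is the primitive lattice vector in the direction of `x`. -/
def IsPrimDir (u : Lattice) (x : Plane) : Prop :=
  IsPrimitive u ∧ ∃ c : ℝ, 0 < c ∧ x = c • toPlane u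

open Classical in
/-- The primitive lattice vector in the direction of `x`
(it is unique; the value is `0` if the direction of `x` is not rational). -/
noncomputable def primDir (x : Plane) : Lattice :=
  if h : ∃ u : Lattice, IsPrimDir u x then h.choose else 0

/-- A (strictly) convex polygon, given by its vertices in counterclockwise order: every vertex which
is not an end of the side from `vertex i` to `vertex (i + 1)` lies strictly to the left of it. -/
structure ConvexPolygon where
  n : ℕ
  three_le : 3 ≤ n
  vertex : ZMod n → Plane
  convex : ∀ i j : ZMod n, j ≠ i → j ≠ i + 1 →
    0 < det (vertex (i + 1) - vertex i) (vertex j - vertex i)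

instance (P : ConvexPolygon) : NeZero P.n := ⟨by have := P.three_le; omega⟩

/-- A polygon is Delzant if the sides have rational slopes and at every vertex the primitive
vectors in the directions of the two adjacent sides form a basis of the lattice. -/
def ConvexPolygon.IsDelzant (P : ConvexPolygon) : Prop :=
  ∀ i : ZMod P.n, ∃ u w : Lattice,
    IsPrimDir u (P.vertex (i + 1) - P.vertex i) ∧
    IsPrimDir w (P.vertex (i - 1) - P.vertex i) ∧
    IsUnit (latDet u w)

/-- Twice the area of a polygon, by the shoelace formula. -/
noncomputable def ConvexPolygon.twiceArea (P : ConvexPolygon) : ℝ :=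
  ∑ i : ZMod P.n, det (P.vertex i) (P.vertex (i + 1))

/-! ### The mechanical process -/

/-- A particle, emitted at the time `time` at the point `pos` with velocity `vel` and mass `mass`. -/
structure Particle where
  time : ℝ
  pos : Plane
  vel : Lattice
  mass : ℕ

/-- The position at time `t` of a particle which moves rectilinearly. -/
noncomputable def Particle.posAt (p : Particle) (t : ℝ) : Plane :=
  p.pos + (t - p.time) • toPlane p.vel

/-- The momentum of a particle. -/
def Particle.momentum (p : Particle) : Lattice := p.mass • p.vel

/-- The particle emitted at time `t` at `x` with a given nonzero momentum: the velocity is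
primitive and the mass is a positive integer. -/
def emit (t : ℝ) (x : Plane) (M : Lattice) : Particle where
  time := t
  pos := x
  vel := (M.1 / (Int.gcd M.1 M.2 : ℤ), M.2 / (Int.gcd M.1 M.2 : ℤ))
  mass := Int.gcd M.1 M.2

/-- A stage of the process: a time together with the particles which exist right after it. -/
structure Stage where
  time : ℝ
  alive : Finset Particle

/-- The future times at which some of the particles meet. -/
def Stage.meetingTimes (S : Stage) : Set ℝ :=
  {t | S.time < t ∧ ∃ p ∈ S.alive, ∃ q ∈ S.alive, p ≠ q ∧ p.posAt t = q.posAt t}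

/-- The time of the next collision. -/
noncomputable def Stage.nextTime (S : Stage) : ℝ := sInf S.meetingTimes

open Classical in
/-- The particles which are at `x` at the time of the next collision. -/
noncomputable def Stage.groupAt (S : Stage) (x : Plane) : Finset Particle :=
  S.alive.filter (fun p => p.posAt S.nextTime = x)

open Classical in
/-- The points at which at least two particles meet at the time of the next collision. -/
noncomputable def Stage.collisionPoints (S : Stage) : Finset Plane :=
  (S.alive.image (fun p => p.posAt S.nextTime)).filter (fun x => 1 < (S.groupAt x).card)

/-- The total momentum of the particles which meet at `x` at the next collision. -/
noncomputable def Stage.momentumAt (S : Stage) (x : Plane) : Lattice :=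
  ∑ p ∈ S.groupAt x, p.momentum

open Classical in
/-- The passage through the next collision. The particles which do not collide go on; every group
of colliding particles is replaced by one particle with the same momentum, or by nothing if the
momentum is zero. If no particles will meet any more then nothing changes. -/
noncomputable def Stage.next (S : Stage) : Stage :=
  if S.meetingTimes.Nonempty then
    { time := S.nextTime
      alive := S.alive.filter (fun p => p.posAt S.nextTime ∉ S.collisionPoints) ∪
        (S.collisionPoints.filter (fun x => S.momentumAt x ≠ 0)).image
          (fun x => emit S.nextTime x (S.momentumAt x)) }
  else S

namespace ConvexPolygon

variable (P : ConvexPolygon)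

/-- The particle sent from a vertex: its mass is one and its velocity is the sum of the primitive
vectors spanning the two adjacent sides. -/
noncomputable def initialParticle (i : ZMod P.n) : Particle where
  time := 0
  pos := P.vertex i
  vel := primDir (P.vertex (i + 1) - P.vertex i) + primDir (P.vertex (i - 1) - P.vertex i)
  mass := 1

open Classical in
/-- The process: its initial stage and the stages after each time of collision. -/
noncomputable def stage : ℕ → Stage
  | 0 => { time := 0, alive := Finset.univ.image P.initialParticle }
  | k + 1 => (stage k).next

/-- All particles which ever exist. -/
def particles : Set Particle := {p | ∃ k, p ∈ (P.stage k).alive}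

/-- The times between the emission of a particle and its collision. -/
def lifetime (p : Particle) : Set ℝ :=
  {t | p.time ≤ t ∧
    ∀ k, p ∈ (P.stage k).alive → p ∉ (P.stage (k + 1)).alive → t ≤ (P.stage (k + 1)).time}

/-- The trajectory of a particle. -/
def trajectory (p : Particle) : Set Plane := p.posAt '' P.lifetime p

/-- `x` is a terminal point: a group of particles meets at `x` and annihilates, without emission
of a new particle. -/
def IsTerminalPoint (x : Plane) : Prop :=
  ∃ k, (P.stage k).meetingTimes.Nonempty ∧ x ∈ (P.stage k).collisionPoints ∧
    (P.stage k).momentumAt x = 0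

/-- Some particle is at the point `x` at the time `t`. -/
def IsVisitedAt (x : Plane) (t : ℝ) : Prop :=
  ∃ p ∈ P.particles, t ∈ P.lifetime p ∧ p.posAt t = x

/-! ### The curve as a weighted planar graph -/

/-- The curve, as a set: the union of the trajectories of all particles. -/
def curve : Set Plane := ⋃ p ∈ P.particles, P.trajectory p

/-- The total mass of the particles whose trajectories pass through `x`. -/
noncomputable def weightAt (x : Plane) : ℕ :=
  ∑ᶠ p ∈ {p | p ∈ P.particles ∧ x ∈ P.trajectory p}, p.mass

/-- A vertex of the curve: a point near which the curve does not coincide with a line. -/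
def IsVertex (x : Plane) : Prop :=
  x ∈ P.curve ∧
    ¬ ∃ d : Plane, d ≠ 0 ∧ ∀ᶠ y in 𝓝 x, (y ∈ P.curve ↔ ∃ s : ℝ, y = x + s • d)

/-- The segment from `a` to `b` is an edge of the curve: it lies on the curve, and its ends are
vertices but no other of its points is. -/
def IsEdge (a b : Plane) : Prop :=
  a ≠ b ∧ P.IsVertex a ∧ P.IsVertex b ∧
    ∀ x ∈ openSegment ℝ a b, x ∈ P.curve ∧ ¬ P.IsVertex x

/-- The edge from `a` to `b` has multiplicity `m`: this is the mass of what passes through its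
points, with finitely many exceptions (such as a point where two particles tracing the edge from
its two ends annihilate). -/
def HasMultiplicity (a b : Plane) (m : ℕ) : Prop :=
  {x ∈ openSegment ℝ a b | P.weightAt x ≠ m}.Finite

/-- The edge from `a` to `b` is the last one to appear: the particles trace it after all
other edges. -/
def IsLastEdge (a b : Plane) : Prop :=
  P.IsEdge a b ∧ ∀ a' b', P.IsEdge a' b' → s(a', b') ≠ s(a, b) →
    ∀ x ∈ openSegment ℝ a b, ∀ y ∈ openSegment ℝ a' b', ∀ t t' : ℝ,
      P.IsVisitedAt x t → P.IsVisitedAt y t' → t' < t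

/-- The primitive directions of the edges of the curve which come out of `x`. -/
def directions (x : Plane) : Set Lattice :=
  {u | IsPrimitive u ∧ ∀ᶠ s in 𝓝[>] (0 : ℝ), x + s • toPlane u ∈ P.curve}

/-- The number of edges which come out of `x`. -/
noncomputable def valency (x : Plane) : ℕ := (P.directions x).ncard

/-- The edge which comes out of `x` in the direction `u` has weight `m`. -/
def HasWeight (x : Plane) (u : Lattice) (m : ℕ) : Prop :=
  ∀ᶠ s in 𝓝[>] (0 : ℝ), P.weightAt (x + s • toPlane u) = m

/-- `D` is a lattice polygon dual to the curve at `x`: its sides correspond to the edges coming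
out of `x`, a side is orthogonal to its edge, and its lattice length is the weight of the edge.
(Such a polygon is unique up to lattice translations and the numbering of the vertices.) -/
def IsDualPolygon (x : Plane) (D : ConvexPolygon) : Prop :=
  (∀ i, ∃ z : Lattice, D.vertex i = toPlane z) ∧
  ∃ (u : ZMod D.n → Lattice) (m : ZMod D.n → ℕ),
    Function.Injective u ∧ Set.range u = P.directions x ∧
    ∀ i, P.HasWeight x (u i) (m i) ∧
      D.vertex (i + 1) - D.vertex i = (m i : ℝ) • toPlane (-(u i).2, (u i).1)

/-- A vertex of the curve is smooth if its multiplicity, twice the area of the dual polygon,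
is one. -/
def IsSmoothVertex (x : Plane) : Prop :=
  P.IsVertex x ∧ ∃ D : ConvexPolygon, P.IsDualPolygon x D ∧ D.twiceArea = 1

end ConvexPolygon

end Caustic

namespace Caustic

open Set Filter Topology

/-! ### Lattice vectors -/

/-! Let every side of the polygon move inwards with unit lattice speed. The front at time `t` has
support numbers `c e + t`, and its corner between consecutive sides `e` and `σ e` moves with
velocity `σ e - e`, exactly the velocity prescribed for a particle. So the particles are the
vertices of a shrinking Delzant polygon, and a collision is a moment at which sides shrink to
points.

Unimodularity gives `π f + σ f = a • f` with `a = latDet (π f) (σ f)`, so the lattice length of the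
side `f` is affine in `t` with slope `a - 2`, and a side that vanishes has `a ≤ 1`. If all vanishing
sides have `a = 1` and no two are adjacent, each of them is blown down: `f = π f + σ f` is dropped,
the fan stays unimodular (`IsEvent.isFan_survivors`), and two particles of mass 1 with velocities of
determinant 1 merge into one of mass 1. The dual polygon is a unimodular triangle, so the vertex is
smooth. The number of sides drops each time, so this must stop.

When it stops, the front has collapsed to a point or to a segment (`IsEvent.trichotomy`). The
momenta `σ e - e` telescope. Around the whole fan they sum to zero, so at a point everything
annihilates. Over the half of the fan from `e` to `-e` they sum to `-2e`, so from the ends of a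
segment two particles of mass 2 start towards each other and annihilate at the midpoint.

To read the curve off the process one needs that trajectories do not cross at different times.
Before the collapse a particle at time `t` is at lattice distance `t` from the boundary of the
initial polygon (`HasDepth`), since discarded sides remain redundant
(`IsEvent.le_det_of_survivors`); the segment consists of points whose depth is the time of collapse.
Hence every point has at most one time of visit (`IsTame`), and near it the curve is the union of
the rays of the particles present at that time. -/

@[simp] theorem toPlane_fst (u : Lattice) : (toPlane u).1 = u.1 := rfl
@[simp] theorem toPlane_snd (u : Lattice) : (toPlane u).2 = u.2 := rfl

theorem toPlane_add (u w : Lattice) : toPlane (u + w) = toPlane u + toPlane w := by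
  ext <;> simp

theorem toPlane_neg (u : Lattice) : toPlane (-u) = -toPlane u := by
  ext <;> simp

@[simp] theorem toPlane_zero : toPlane 0 = 0 := by
  ext <;> simp

theorem toPlane_injective : Function.Injective toPlane := by
  intro u w h
  have h1 := congrArg Prod.fst h
  have h2 := congrArg Prod.snd h
  simp only [toPlane_fst, toPlane_snd] at h1 h2
  ext
  · exact_mod_cast h1
  · exact_mod_cast h2

theorem det_toPlane (u w : Lattice) : det (toPlane u) (toPlane w) = latDet u w := by
  simp [det, latDet]

theorem det_add_right (x y z : Plane) : det x (y + z) = det x y + det x z := by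
  simp [det]; ring

theorem det_sub_right (x y z : Plane) : det x (y - z) = det x y - det x z := by
  simp [det]; ring

theorem det_smul_right (x y : Plane) (s : ℝ) : det x (s • y) = s * det x y := by
  simp [det]; ring

theorem det_neg_left (x y : Plane) : det (-x) y = -det x y := by
  simp [det]; ring

theorem det_self (x : Plane) : det x x = 0 := by
  simp [det]; ring

theorem latDet_swap (u w : Lattice) : latDet u w = -latDet w u := by
  simp only [latDet]; ring

theorem latDet_self (u : Lattice) : latDet u u = 0 := by
  simp only [latDet]; ring

theorem latDet_neg_left (u w : Lattice) : latDet (-u) w = -latDet u w := by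
  simp only [latDet, Prod.fst_neg, Prod.snd_neg]; ring

theorem latDet_neg_right (u w : Lattice) : latDet u (-w) = -latDet u w := by
  simp only [latDet, Prod.fst_neg, Prod.snd_neg]; ring

theorem latDet_add_right (u w z : Lattice) : latDet u (w + z) = latDet u w + latDet u z := by
  simp only [latDet, Prod.fst_add, Prod.snd_add]; ring

theorem latDet_sub_right (u w z : Lattice) : latDet u (w - z) = latDet u w - latDet u z := by
  simp only [latDet, Prod.fst_sub, Prod.snd_sub]; ring

theorem IsPrimitive.of_latDet_eq_one {u w : Lattice} (h : latDet u w = 1) : IsPrimitive u := by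
  rw [IsPrimitive, ← Int.isCoprime_iff_gcd_eq_one]
  exact ⟨w.2, -w.1, by simp only [latDet] at h; linarith⟩

theorem IsPrimitive.neg {u : Lattice} (h : IsPrimitive u) : IsPrimitive (-u) := by
  simpa [IsPrimitive] using h

theorem IsPrimitive.exists_latDet_eq_one {u : Lattice} (h : IsPrimitive u) :
    ∃ w, latDet u w = 1 := by
  rw [IsPrimitive, ← Int.isCoprime_iff_gcd_eq_one] at h
  obtain ⟨a, b, hab⟩ := h
  exact ⟨(-b, a), by simp only [latDet]; linarith⟩

theorem IsPrimitive.ne_zero {u : Lattice} (h : IsPrimitive u) : u ≠ 0 := by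
  rintro rfl
  simp [IsPrimitive] at h

theorem IsPrimitive.toPlane_ne_zero {u : Lattice} (h : IsPrimitive u) : toPlane u ≠ 0 := by
  intro h0
  exact h.ne_zero (toPlane_injective (by simpa using h0))

/-- Completing `u` to a basis `(u, z)` makes `w` an integer multiple of `u`, and the gcd of `w`
forces the factor to be a unit. -/
theorem IsPrimitive.eq_or_eq_neg {u w : Lattice} (hu : IsPrimitive u) (hw : IsPrimitive w)
    (h : latDet u w = 0) : w = u ∨ w = -u := by
  obtain ⟨z, hz⟩ := hu.exists_latDet_eq_one
  have hwu : w = (latDet w z * u.1, latDet w z * u.2) := by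
    simp only [latDet] at h hz ⊢
    ext
    · simp only
      linear_combination z.1 * h - w.1 * hz
    · simp only
      linear_combination z.2 * h - w.2 * hz
  have hg : (latDet w z).natAbs = 1 := by
    rw [hwu, IsPrimitive, Int.gcd_mul_left] at hw
    rw [IsPrimitive] at hu
    simpa [hu] using hw
  rcases Int.natAbs_eq_iff.1 hg with h1 | h1 <;> rw [h1] at hwu
  · left; rw [hwu]; ext <;> simp
  · right; rw [hwu]; ext <;> simp

theorem IsPrimitive.eq_of_smul_eq {u w : Lattice} (hu : IsPrimitive u) (hw : IsPrimitive w)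
    {s s' : ℝ} (hs : 0 < s) (hs' : 0 ≤ s') (h : s • toPlane u = s' • toPlane w) : w = u := by
  have hdet : (latDet u w : ℝ) = 0 := by
    have h1 : s * det (toPlane u) (toPlane w) = 0 := by
      have h2 : det (s • toPlane u) (toPlane w) = s * det (toPlane u) (toPlane w) := by
        simp [det]; ring
      rw [← h2, h]; simp [det]; ring
    rw [← det_toPlane]
    exact (mul_eq_zero.1 h1).resolve_left hs.ne'
  rcases hu.eq_or_eq_neg hw (by exact_mod_cast hdet) with h1 | h1
  · exact h1
  · exfalso
    rw [h1, toPlane_neg] at h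
    have h2 : (s + s') • toPlane u = 0 := by rw [add_smul, h]; simp
    rcases smul_eq_zero.1 h2 with h3 | h3
    · linarith
    · exact hu.toPlane_ne_zero h3

/-! ### Fans of edge directions -/

/-- The directions of the sides of a Delzant polygon, in counterclockwise order: `σ` and `π` give
the next and the previous direction. -/
structure IsFan (E : Finset Lattice) (σ π : Lattice → Lattice) : Prop where
  nonempty : E.Nonempty
  succ_mem : ∀ e ∈ E, σ e ∈ E
  pred_mem : ∀ e ∈ E, π e ∈ E
  pred_succ : ∀ e ∈ E, π (σ e) = e
  succ_pred : ∀ e ∈ E, σ (π e) = e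
  det_succ : ∀ e ∈ E, latDet e (σ e) = 1
  not_between : ∀ e ∈ E, ∀ h ∈ E, 0 < latDet e h → latDet h (σ e) ≤ 0

/-- The vertex of the polygon with support numbers `c e + t` between the sides `e` and `σ e`. -/
noncomputable def corner (c : Lattice → ℝ) (σ : Lattice → Lattice) (e : Lattice) (t : ℝ) : Plane :=
  (c e + t) • toPlane (σ e) - (c (σ e) + t) • toPlane e

/-- The lattice length of the side `f` of the polygon with support numbers `c e + t`. -/
noncomputable def sideLength (c : Lattice → ℝ) (σ π : Lattice → Lattice) (f : Lattice) (t : ℝ) :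
    ℝ :=
  (latDet (π f) (σ f) : ℝ) * (c f + t) - c (π f) - c (σ f) - 2 * t

/-- The velocity `σ e - e` is the sum of the primitive vectors leaving the corner along its two
sides, which is why corners and particles move alike. -/
theorem corner_eq_add (c : Lattice → ℝ) (σ : Lattice → Lattice) (e : Lattice) (t t' : ℝ) :
    corner c σ e t' = corner c σ e t + (t' - t) • toPlane (σ e - e) := by
  ext <;> simp [corner] <;> ring

theorem continuous_sideLength (c : Lattice → ℝ) (σ π : Lattice → Lattice) (f : Lattice) :
    Continuous (sideLength c σ π f) := by
  unfold sideLength; fun_prop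

theorem continuous_corner (c : Lattice → ℝ) (σ : Lattice → Lattice) (e : Lattice) :
    Continuous (corner c σ e) := by
  unfold corner; fun_prop

theorem continuous_det (x : Plane) : Continuous (det x) := by
  unfold det; fun_prop

/-! ### Convexity of the polygon with a given fan -/

namespace IsFan

variable {E : Finset Lattice} {σ π : Lattice → Lattice} (h : IsFan E σ π) (c : Lattice → ℝ)
include h

theorem isPrimitive {e : Lattice} (he : e ∈ E) : IsPrimitive e :=
  .of_latDet_eq_one (h.det_succ e he)

theorem det_pred {e : Lattice} (he : e ∈ E) : latDet (π e) e = 1 := by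
  have := h.det_succ _ (h.pred_mem e he)
  rwa [h.succ_pred e he] at this

theorem isPrimitive_velocity {e : Lattice} (he : e ∈ E) : IsPrimitive (σ e - e) := by
  have h1 : latDet (σ e - e) (-e) = 1 := by
    have := h.det_succ e he
    simp only [latDet, Prod.fst_sub, Prod.snd_sub, Prod.fst_neg, Prod.snd_neg] at *
    linarith
  exact .of_latDet_eq_one h1

theorem det_corner {e : Lattice} (he : e ∈ E) (t : ℝ) :
    det (toPlane e) (corner c σ e t) = c e + t := by
  have : (latDet e (σ e) : ℝ) = 1 := by exact_mod_cast h.det_succ e he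
  rw [corner, det_sub_right, det_smul_right, det_smul_right, det_toPlane, det_toPlane, this,
    latDet_self]
  simp

theorem det_succ_corner {e : Lattice} (he : e ∈ E) (t : ℝ) :
    det (toPlane (σ e)) (corner c σ e t) = c (σ e) + t := by
  have : (latDet (σ e) e : ℝ) = -1 := by
    rw [latDet_swap]; exact_mod_cast congrArg Neg.neg (h.det_succ e he)
  rw [corner, det_sub_right, det_smul_right, det_smul_right, det_toPlane, det_toPlane, this,
    latDet_self]
  simp

/-- Both neighbours form a unimodular basis with `f`, so their sum is parallel to `f`. The
coefficient is minus the self-intersection of the toric divisor of `f`; the value 1 means that `f`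
can be blown down. -/
theorem pred_add_succ {f : Lattice} (hf : f ∈ E) : π f + σ f = latDet (π f) (σ f) • f := by
  have h1 := h.det_succ f hf
  have h2 := h.det_pred hf
  simp only [latDet] at *
  ext
  · simp only [Prod.fst_add, Prod.smul_fst, smul_eq_mul]
    linear_combination -(π f).1 * h1 - (σ f).1 * h2
  · simp only [Prod.snd_add, Prod.smul_snd, smul_eq_mul]
    linear_combination -(π f).2 * h1 - (σ f).2 * h2

/-- This justifies the formula for `sideLength`: it is the coefficient left after `π f + σ f` is
replaced by its multiple of `f`. -/
theorem corner_sub_corner_pred {f : Lattice} (hf : f ∈ E) (t : ℝ) :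
    corner c σ f t - corner c σ (π f) t = sideLength c σ π f t • toPlane f := by
  have h1 := h.pred_add_succ hf
  have hx : ((π f).1 : ℝ) + (σ f).1 = latDet (π f) (σ f) * f.1 := by
    exact_mod_cast congrArg Prod.fst h1
  have hy : ((π f).2 : ℝ) + (σ f).2 = latDet (π f) (σ f) * f.2 := by
    exact_mod_cast congrArg Prod.snd h1
  rw [corner, corner, h.succ_pred f hf, sideLength]
  ext
  · simp; linear_combination (c f + t) * hx
  · simp; linear_combination (c f + t) * hy

theorem corner_succ {f : Lattice} (hf : f ∈ E) (t : ℝ) :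
    corner c σ (σ f) t = corner c σ f t + sideLength c σ π (σ f) t • toPlane (σ f) := by
  rw [← h.corner_sub_corner_pred c (h.succ_mem f hf), h.pred_succ f hf]; abel

/-- A polygon with positive side lengths lies on the left of its sides, and meets the line which
contains a side only in that side. -/
theorem lt_det_corner {t : ℝ} (hpos : ∀ f ∈ E, 0 < sideLength c σ π f t) {e : Lattice}
    (he : e ∈ E) :
    (∀ f ∈ E, c e + t ≤ det (toPlane e) (corner c σ f t)) ∧
    ∀ f ∈ E, f ≠ e → σ f ≠ e → c e + t < det (toPlane e) (corner c σ f t) := by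
  -- Local minima suffice. If neither neighbouring corner is lower for `det e`, then `e` lies in the
  -- closed cone spanned by `f` and `σ f`; no direction lies strictly inside, so `e` is one of the
  -- two.
  have key : ∀ f ∈ E, (∀ g ∈ E, det (toPlane e) (corner c σ f t) ≤
      det (toPlane e) (corner c σ g t)) → f = e ∨ σ f = e := by
    intro f hf hmin
    have h1 : 0 ≤ latDet e (σ f) := by
      have := hmin _ (h.succ_mem f hf)
      rw [h.corner_succ c hf, det_add_right, det_smul_right, det_toPlane] at this
      have h2 := hpos _ (h.succ_mem f hf)
      have h3 : (0 : ℝ) ≤ latDet e (σ f) := by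
        by_contra hneg
        push Not at hneg
        nlinarith
      exact_mod_cast h3
    have h2 : latDet e f ≤ 0 := by
      have := hmin _ (h.pred_mem f hf)
      have h4 : corner c σ (π f) t = corner c σ f t - sideLength c σ π f t • toPlane f := by
        rw [← h.corner_sub_corner_pred c hf]; abel
      rw [h4, det_sub_right, det_smul_right, det_toPlane] at this
      have h2 := hpos _ hf
      have h3 : (latDet e f : ℝ) ≤ 0 := by
        by_contra hneg
        push Not at hneg
        nlinarith
      exact_mod_cast h3
    have h3 := h.det_succ f hf
    rcases h2.lt_or_eq with h4 | h4
    · rcases h1.lt_or_eq with h5 | h5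
      · have := h.not_between f hf e he (by rw [latDet_swap]; linarith)
        linarith
      · right
        rcases (h.isPrimitive he).eq_or_eq_neg (h.isPrimitive (h.succ_mem f hf)) h5.symm with
          h6 | h6
        · exact h6
        · rw [h6, latDet_neg_right, latDet_swap] at h3
          linarith
    · left
      rcases (h.isPrimitive he).eq_or_eq_neg (h.isPrimitive hf) h4 with h6 | h6
      · exact h6
      · rw [h6, latDet_neg_left, ← h6] at h3
        linarith
  -- A global minimum exists by finiteness, and by `key` it is an end of the side `e`, where the
  -- value is the support number.
  obtain ⟨f₀, hf₀, hmin⟩ :=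
    E.exists_min_image (fun f => det (toPlane e) (corner c σ f t)) h.nonempty
  have hval : det (toPlane e) (corner c σ f₀ t) = c e + t := by
    rcases key f₀ hf₀ hmin with rfl | h1
    · exact h.det_corner c hf₀ t
    · rw [← h1]; exact h.det_succ_corner c hf₀ t
  refine ⟨fun f hf => hval ▸ hmin f hf, fun f hf h1 h2 => lt_of_le_of_ne (hval ▸ hmin f hf) ?_⟩
  intro heq
  rcases key f hf (fun g hg => by rw [← heq, ← hval]; exact hmin g hg) with h3 | h3
  exacts [h1 h3, h2 h3]

/-- A corner on the line of `e` must be an end of the side `e`. Two distinct coinciding corners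
would thus be successors of each other, making `latDet e f` equal to both 1 and -1. -/
theorem corner_injOn {t : ℝ} (hpos : ∀ f ∈ E, 0 < sideLength c σ π f t) {e f : Lattice}
    (he : e ∈ E) (hf : f ∈ E) (hef : corner c σ e t = corner c σ f t) : e = f := by
  by_contra hne
  have h1 : σ f = e := by
    by_contra h1
    have := (h.lt_det_corner c hpos he).2 f hf (Ne.symm hne) h1
    rw [← hef, h.det_corner c he] at this
    exact lt_irrefl _ this
  have h2 : σ e = f := by
    by_contra h1
    have := (h.lt_det_corner c hpos hf).2 e he hne h1
    rw [hef, h.det_corner c hf] at this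
    exact lt_irrefl _ this
  have h3 := h.det_succ e he
  have h4 := h.det_succ f hf
  rw [h1, latDet_swap, ← h2] at h4
  linarith

theorem sum_comp_succ {M : Type*} [AddCommMonoid M] (g : Lattice → M) :
    ∑ f ∈ E, g (σ f) = ∑ f ∈ E, g f :=
  Finset.sum_bij' (fun f _ => σ f) (fun f _ => π f) h.succ_mem h.pred_mem h.pred_succ h.succ_pred
    (fun _ _ => rfl)

/-- The sides of a closed polygon sum to zero: consecutive corner differences telescope. -/
theorem sum_sideLength_smul (t : ℝ) : ∑ f ∈ E, sideLength c σ π f t • toPlane f = 0 := by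
  have h1 : ∑ f ∈ E, sideLength c σ π f t • toPlane f =
      ∑ f ∈ E, corner c σ f t - ∑ f ∈ E, corner c σ (π f) t := by
    rw [← Finset.sum_sub_distrib]
    exact Finset.sum_congr rfl fun f hf => (h.corner_sub_corner_pred c hf t).symm
  rw [h1, ← h.sum_comp_succ (fun f => corner c σ (π f) t), sub_eq_zero]
  exact Finset.sum_congr rfl fun f hf => by rw [h.pred_succ f hf]

/-- The front does not move inwards forever. -/
theorem exists_sideLength_nonpos {t₀ : ℝ} (hpos : ∀ f ∈ E, 0 < sideLength c σ π f t₀) :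
    ∃ t, t₀ ≤ t ∧ ∃ f ∈ E, sideLength c σ π f t ≤ 0 := by
  by_contra hcon
  push Not at hcon
  set A := ∑ f ∈ E, sideLength c σ π f t₀ with hA
  have hApos : 0 < A := Finset.sum_pos hpos h.nonempty
  set B := ∑ f ∈ E, sideLength c σ π f t₀ * c f with hB
  obtain ⟨e, he⟩ := h.nonempty
  -- Pair a corner at time `t` with the sides at time `t₀`, whose vectors sum to zero. The support
  -- inequalities, weighted by the old lengths, then add up to a bound with slope `A`, the positive
  -- perimeter, in `t`.
  have key : ∀ t, t₀ ≤ t → B + t * A ≤ 0 := by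
    intro t ht
    have h1 : ∀ f ∈ E, sideLength c σ π f t₀ * (c f + t) ≤
        sideLength c σ π f t₀ * det (toPlane f) (corner c σ e t) := fun f hf =>
      mul_le_mul_of_nonneg_left ((h.lt_det_corner c (fun g hg => hcon t ht g hg) hf).1 e he)
        (hpos f hf).le
    have h2 := Finset.sum_le_sum h1
    have h3 : ∑ f ∈ E, sideLength c σ π f t₀ * det (toPlane f) (corner c σ e t) = 0 := by
      have h4 := h.sum_sideLength_smul c t₀
      have hx := congrArg Prod.fst h4
      have hy := congrArg Prod.snd h4
      rw [Prod.fst_sum] at hx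
      rw [Prod.snd_sum] at hy
      have : ∑ f ∈ E, sideLength c σ π f t₀ * det (toPlane f) (corner c σ e t) =
          (∑ f ∈ E, (sideLength c σ π f t₀ • toPlane f).1) * (corner c σ e t).2 -
          (∑ f ∈ E, (sideLength c σ π f t₀ • toPlane f).2) * (corner c σ e t).1 := by
        rw [Finset.sum_mul, Finset.sum_mul, ← Finset.sum_sub_distrib]
        refine Finset.sum_congr rfl fun f _ => ?_
        simp [det]; ring
      rw [this, hx, hy]; simp
    rw [h3] at h2
    calc B + t * A = ∑ f ∈ E, sideLength c σ π f t₀ * (c f + t) := by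
          rw [hA, hB, Finset.mul_sum, ← Finset.sum_add_distrib]
          exact Finset.sum_congr rfl fun f _ => by ring
      _ ≤ 0 := h2
  have h1 := key (max t₀ ((1 - B) / A)) (le_max_left _ _)
  have h2 : (1 - B) / A ≤ max t₀ ((1 - B) / A) := le_max_right _ _
  rw [div_le_iff₀ hApos] at h2
  linarith

/-- The first time at which a side of the front shrinks to a point. -/
theorem exists_event {t₀ : ℝ} (hpos : ∀ f ∈ E, 0 < sideLength c σ π f t₀) :
    ∃ T, t₀ < T ∧ (∀ t, t₀ ≤ t → t < T → ∀ f ∈ E, 0 < sideLength c σ π f t) ∧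
      (∀ f ∈ E, 0 ≤ sideLength c σ π f T) ∧ ∃ f ∈ E, sideLength c σ π f T = 0 := by
  -- The times at which some length is nonpositive form a closed nonempty set bounded below; its
  -- least element is the event.
  set Z : Set ℝ := {t | t₀ ≤ t ∧ ∃ f ∈ E, sideLength c σ π f t ≤ 0} with hZ
  have hZc : IsClosed Z := by
    have : Z = Set.Ici t₀ ∩ ⋃ f ∈ E, {t | sideLength c σ π f t ≤ 0} := by
      ext t; simp [hZ]
    rw [this]
    refine isClosed_Ici.inter (isClosed_biUnion_finset fun f _ => ?_)
    exact isClosed_le (continuous_sideLength c σ π f) continuous_const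
  have hZb : BddBelow Z := ⟨t₀, fun t ht => ht.1⟩
  have hZn : Z.Nonempty := h.exists_sideLength_nonpos c hpos
  have hT := hZc.csInf_mem hZn hZb
  set T := sInf Z
  have hbefore : ∀ t, t₀ ≤ t → t < T → ∀ f ∈ E, 0 < sideLength c σ π f t := by
    intro t h1 h2 f hf
    by_contra h3
    exact absurd (csInf_le hZb ⟨h1, f, hf, not_lt.1 h3⟩) (not_le.2 h2)
  have hlt : t₀ < T := by
    refine lt_of_le_of_ne hT.1 fun heq => ?_
    obtain ⟨f, hf, hf0⟩ := hT.2
    rw [← heq] at hf0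
    exact absurd (hpos f hf) (not_lt.2 hf0)
  have hnonneg : ∀ f ∈ E, 0 ≤ sideLength c σ π f T := by
    intro f hf
    have h1 : Tendsto (sideLength c σ π f) (𝓝[<] T) (𝓝 (sideLength c σ π f T)) :=
      (continuous_sideLength c σ π f).continuousAt.mono_left nhdsWithin_le_nhds
    refine ge_of_tendsto h1 ?_
    filter_upwards [Ioo_mem_nhdsLT hlt] with t ht
    exact (hbefore t ht.1.le ht.2 f hf).le
  refine ⟨T, hlt, hbefore, hnonneg, ?_⟩
  obtain ⟨f, hf, hf0⟩ := hT.2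
  exact ⟨f, hf, le_antisymm hf0 (hnonneg f hf)⟩

end IsFan

/-! ### The first time at which sides of the front vanish -/

/-- At the time `T` the front, which moves since the time `t₀`, loses sides for the first time. -/
structure IsEvent (c : Lattice → ℝ) (E : Finset Lattice) (σ π : Lattice → Lattice) (t₀ T : ℝ) :
    Prop where
  lt : t₀ < T
  before : ∀ t, t₀ ≤ t → t < T → ∀ f ∈ E, 0 < sideLength c σ π f t
  nonneg : ∀ f ∈ E, 0 ≤ sideLength c σ π f T
  exists_eq_zero : ∃ f ∈ E, sideLength c σ π f T = 0

/-- The vanishing sides are isolated and exceptional. -/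
def IsRegularEvent (c : Lattice → ℝ) (E : Finset Lattice) (σ π : Lattice → Lattice) (T : ℝ) :
    Prop :=
  ∀ f ∈ E, sideLength c σ π f T = 0 →
    latDet (π f) (σ f) = 1 ∧ 0 < sideLength c σ π (σ f) T

/-- The front degenerates to a segment of the direction `e`. -/
structure IsFlat (c : Lattice → ℝ) (E : Finset Lattice) (T : ℝ) (e : Lattice) : Prop where
  mem : e ∈ E
  neg_mem : -e ∈ E
  width : c e + c (-e) + 2 * T = 0

theorem IsFlat.neg {c : Lattice → ℝ} {E : Finset Lattice} {T : ℝ} {e : Lattice}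
    (h : IsFlat c E T e) : IsFlat c E T (-e) :=
  ⟨h.neg_mem, by simpa using h.mem, by rw [neg_neg]; linarith [h.width]⟩

/-- Cramer's rule in the unimodular basis `(e, g)`, with vanishing coordinate along `g`. -/
theorem eq_smul_of_det_eq_zero {e g : Lattice} (h : latDet e g = 1) {z : Plane}
    (hz : det (toPlane e) z = 0) : z = (-det (toPlane g) z) • toPlane e := by
  have h' : (e.1 : ℝ) * g.2 - e.2 * g.1 = 1 := by
    simp only [latDet] at h; exact_mod_cast h
  simp only [det, toPlane_fst, toPlane_snd] at hz ⊢
  ext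
  · simp; linear_combination (-z.1) * h' + g.1 * hz
  · simp; linear_combination (-z.2) * h' + g.2 * hz

namespace IsEvent

variable {c : Lattice → ℝ} {E : Finset Lattice} {σ π : Lattice → Lattice} {t₀ T : ℝ}
  (ev : IsEvent c E σ π t₀ T) (h : IsFan E σ π)
include ev h

/-- Before the event this is convexity of the front; at the event it passes to the limit, where
strictness is lost. -/
theorem le_det_corner_of_le {t : ℝ} (ht₀ : t₀ ≤ t) (htT : t ≤ T) {e f : Lattice} (he : e ∈ E)
    (hf : f ∈ E) : c e + t ≤ det (toPlane e) (corner c σ f t) := by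
  rcases htT.lt_or_eq with htT | rfl
  · exact (h.lt_det_corner c (ev.before t ht₀ htT) he).1 f hf
  have h1 : Tendsto (fun t => det (toPlane e) (corner c σ f t) - (c e + t)) (𝓝[<] t)
      (𝓝 (det (toPlane e) (corner c σ f t) - (c e + t))) := by
    refine Continuous.continuousAt ?_ |>.mono_left nhdsWithin_le_nhds
    exact ((continuous_det _).comp (continuous_corner c σ f)).sub (by fun_prop)
  have h2 := ge_of_tendsto (b := 0) h1 (by
    filter_upwards [Ioo_mem_nhdsLT ev.lt] with s hs
    linarith [(h.lt_det_corner c (ev.before s hs.1.le hs.2) he).1 f hf])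
  linarith

theorem le_det_corner {e f : Lattice} (he : e ∈ E) (hf : f ∈ E) :
    c e + T ≤ det (toPlane e) (corner c σ f T) :=
  ev.le_det_corner_of_le h ev.lt.le le_rfl he hf

-- The length is affine in time with slope `latDet (π f) (σ f) - 2`, and it goes from positive to
-- zero.
omit h in
theorem latDet_le_one {f : Lattice} (hf : f ∈ E) (h0 : sideLength c σ π f T = 0) :
    latDet (π f) (σ f) ≤ 1 := by
  have h1 := ev.before t₀ le_rfl ev.lt f hf
  have h2 : ((latDet (π f) (σ f) : ℤ) : ℝ) < (2 : ℤ) := by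
    have h3 := ev.lt
    rw [sideLength] at h0 h1
    push_cast
    by_contra h4
    push Not at h4
    nlinarith
  have := Int.cast_lt.1 h2
  omega

omit ev in
theorem corner_pred {f : Lattice} (hf : f ∈ E) (h0 : sideLength c σ π f T = 0) :
    corner c σ (π f) T = corner c σ f T := by
  have := h.corner_sub_corner_pred c hf T
  rw [h0, zero_smul, sub_eq_zero] at this
  exact this.symm

/-- The half-planes of `e` and `-e` squeeze the front into a strip of width zero. -/
theorem det_corner_of_isFlat {e : Lattice} (hfl : IsFlat c E T e) {f : Lattice} (hf : f ∈ E) :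
    det (toPlane e) (corner c σ f T) = c e + T := by
  have h1 := ev.le_det_corner h hfl.mem hf
  have h2 := ev.le_det_corner h hfl.neg_mem hf
  rw [toPlane_neg, det_neg_left] at h2
  linarith [hfl.width]

/-- The vertices of the front on one side of a segment come together. -/
theorem corner_eq_of_isFlat {e : Lattice} (hfl : IsFlat c E T e) {f : Lattice} (hf : f ∈ E)
    (hef : 0 < latDet e f) : corner c σ f T = corner c σ e T := by
  have hz : det (toPlane e) (corner c σ f T - corner c σ e T) = 0 := by
    rw [det_sub_right, ev.det_corner_of_isFlat h hfl hf, ev.det_corner_of_isFlat h hfl hfl.mem,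
      sub_self]
  have h1 := eq_smul_of_det_eq_zero (h.det_succ e hfl.mem) hz
  set z := corner c σ f T - corner c σ e T with hzdef
  -- The displacement `z` is a multiple of `e`. The half-plane of `σ e` bounds its coefficient from
  -- one side and the line of `f`, which crosses the direction `e`, from the other.
  have h2 : 0 ≤ det (toPlane (σ e)) z := by
    rw [hzdef, det_sub_right, h.det_succ_corner c hfl.mem]
    linarith [ev.le_det_corner h (h.succ_mem e hfl.mem) hf]
  have h3 : det (toPlane f) z ≤ 0 := by
    rw [hzdef, det_sub_right, h.det_corner c hf]
    linarith [ev.le_det_corner h hf hfl.mem]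
  have h4 : (latDet f e : ℝ) < 0 := by
    rw [latDet_swap] at hef
    exact_mod_cast (by linarith : latDet f e < 0)
  have h5 : det (toPlane f) z = -det (toPlane (σ e)) z * latDet f e := by
    conv_lhs => rw [h1]
    rw [det_smul_right, det_toPlane]
  have h6 : det (toPlane (σ e)) z = 0 := by
    rw [h5] at h3
    nlinarith
  rw [h6, neg_zero, zero_smul] at h1
  exact sub_eq_zero.1 h1

theorem corner_eq_or_of_isFlat {e : Lattice} (hfl : IsFlat c E T e) {f : Lattice} (hf : f ∈ E) :
    ((0 < latDet e f ∨ f = e) ∧ corner c σ f T = corner c σ e T) ∨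
    ((0 < latDet (-e) f ∨ f = -e) ∧ corner c σ f T = corner c σ (-e) T) := by
  rcases lt_trichotomy (latDet e f) 0 with h1 | h1 | h1
  · right
    rw [latDet_neg_left]
    exact ⟨.inl (by linarith), ev.corner_eq_of_isFlat h hfl.neg hf
      (by rw [latDet_neg_left]; linarith)⟩
  · rcases (h.isPrimitive hfl.mem).eq_or_eq_neg (h.isPrimitive hf) h1 with rfl | rfl
    · exact .inl ⟨.inr rfl, rfl⟩
    · exact .inr ⟨.inr rfl, rfl⟩
  · exact .inl ⟨.inl h1, ev.corner_eq_of_isFlat h hfl hf h1⟩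

/-- The lines of `π f`, `f` and `σ f` pass through one point. For a negative coefficient the
relation `π f + σ f = a • f` makes the three half-planes meet only there; for a zero coefficient the
neighbours are opposite and the strip between them has closed. -/
theorem point_or_flat_of_nonpos {f : Lattice} (hf : f ∈ E) (h0 : sideLength c σ π f T = 0)
    (ha : latDet (π f) (σ f) ≤ 0) :
    (∃ x, ∀ g ∈ E, corner c σ g T = x) ∨ ∃ e, IsFlat c E T e := by
  have hp := h.pred_mem f hf
  have hs := h.succ_mem f hf
  rcases ha.lt_or_eq with ha | ha
  · left
    refine ⟨corner c σ f T, fun g hg => ?_⟩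
    set z := corner c σ g T - corner c σ f T with hz
    have h1 : 0 ≤ det (toPlane f) z := by
      rw [hz, det_sub_right, h.det_corner c hf]
      linarith [ev.le_det_corner h hf hg]
    have h2 : 0 ≤ det (toPlane (σ f)) z := by
      rw [hz, det_sub_right, h.det_succ_corner c hf]
      linarith [ev.le_det_corner h hs hg]
    have h3 : 0 ≤ det (toPlane (π f)) z := by
      rw [hz, det_sub_right, ← IsEvent.corner_pred h hf h0, h.det_corner c hp]
      linarith [ev.le_det_corner h hp hg]
    have h4 : det (toPlane (π f)) z + det (toPlane (σ f)) z =
        latDet (π f) (σ f) * det (toPlane f) z := by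
      have h5 := h.pred_add_succ hf
      have hx : ((π f).1 : ℝ) + (σ f).1 = latDet (π f) (σ f) * f.1 := by
        exact_mod_cast congrArg Prod.fst h5
      have hy : ((π f).2 : ℝ) + (σ f).2 = latDet (π f) (σ f) * f.2 := by
        exact_mod_cast congrArg Prod.snd h5
      simp only [det, toPlane_fst, toPlane_snd]
      linear_combination z.2 * hx - z.1 * hy
    have haR : (latDet (π f) (σ f) : ℝ) < 0 := by exact_mod_cast ha
    have h5 : det (toPlane f) z = 0 := by
      by_contra hne
      have : 0 < det (toPlane f) z := lt_of_le_of_ne h1 (Ne.symm hne)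
      nlinarith
    have h6 : det (toPlane (σ f)) z = 0 := by
      rw [h5] at h4; linarith
    have h7 := eq_smul_of_det_eq_zero (h.det_succ f hf) h5
    rw [h6, neg_zero, zero_smul] at h7
    exact sub_eq_zero.1 h7
  · right
    have h1 : σ f = -π f := by
      rcases (h.isPrimitive hp).eq_or_eq_neg (h.isPrimitive hs) ha with h2 | h2
      · have h3 := h.det_succ f hf
        have h4 := h.det_pred hf
        rw [h2, latDet_swap] at h3
        linarith
      · exact h2
    refine ⟨π f, hp, h1 ▸ hs, ?_⟩
    rw [sideLength, ha, h1] at h0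
    push_cast at h0
    linarith

/-- What can happen when sides vanish. -/
theorem trichotomy :
    IsRegularEvent c E σ π T ∨ (∃ x, ∀ f ∈ E, corner c σ f T = x) ∨
      ∃ e, IsFlat c E T e ∧ corner c σ e T ≠ corner c σ (-e) T := by
  by_cases hreg : IsRegularEvent c E σ π T
  · exact .inl hreg
  right
  have key : (∃ x, ∀ g ∈ E, corner c σ g T = x) ∨ ∃ e, IsFlat c E T e := by
    rw [IsRegularEvent] at hreg
    push Not at hreg
    obtain ⟨f, hf, h0, h1⟩ := hreg
    rcases (ev.latDet_le_one hf h0).lt_or_eq with ha | ha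
    · exact ev.point_or_flat_of_nonpos h hf h0 (by omega)
    have hs := h.succ_mem f hf
    have h2 : sideLength c σ π (σ f) T = 0 := le_antisymm (h1 ha) (ev.nonneg _ hs)
    rcases (ev.latDet_le_one hs h2).lt_or_eq with hb | hb
    · exact ev.point_or_flat_of_nonpos h hs h2 (by omega)
    right
    -- Two adjacent vanishing sides, both of coefficient 1: adding `π f + σ f = f` and `f + σ (σ f)
    -- = σ f` gives `σ (σ f) = -π f`, so the sides around the pair are opposite.
    have h3 := h.pred_add_succ hf
    have h4 := h.pred_add_succ hs
    rw [ha, one_smul] at h3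
    rw [hb, one_smul, h.pred_succ f hf] at h4
    have h5 : σ (σ f) = -π f := by
      linear_combination h3 + h4
    refine ⟨π f, h.pred_mem f hf, h5 ▸ h.succ_mem _ hs, ?_⟩
    rw [sideLength, ha] at h0
    rw [sideLength, hb, h.pred_succ f hf, h5] at h2
    push_cast at h0 h2
    linarith
  rcases key with hx | ⟨e, hfl⟩
  · exact .inl hx
  -- A segment whose ends coincide counts as a point.
  by_cases hne : corner c σ e T = corner c σ (-e) T
  · left
    refine ⟨corner c σ e T, fun f hf => ?_⟩
    rcases ev.corner_eq_or_of_isFlat h hfl hf with h1 | h1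
    · exact h1.2
    · exact h1.2.trans hne.symm
  · exact .inr ⟨e, hfl, hne⟩

end IsEvent

/-! ### The front after a regular event -/

open Classical in
/-- The next side after the vanishing sides are removed. -/
noncomputable def skipSucc (c : Lattice → ℝ) (σ π : Lattice → Lattice) (T : ℝ) (e : Lattice) :
    Lattice :=
  if 0 < sideLength c σ π (σ e) T then σ e else σ (σ e)

open Classical in
/-- The previous side after the vanishing sides are removed. -/
noncomputable def skipPred (c : Lattice → ℝ) (σ π : Lattice → Lattice) (T : ℝ) (e : Lattice) :
    Lattice :=
  if 0 < sideLength c σ π (π e) T then π e else π (π e)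

open Classical in
/-- The sides which do not vanish. -/
noncomputable def survivors (c : Lattice → ℝ) (E : Finset Lattice) (σ π : Lattice → Lattice)
    (T : ℝ) : Finset Lattice :=
  E.filter fun f => 0 < sideLength c σ π f T

theorem mem_survivors {c : Lattice → ℝ} {E : Finset Lattice} {σ π : Lattice → Lattice} {T : ℝ}
    {f : Lattice} : f ∈ survivors c E σ π T ↔ f ∈ E ∧ 0 < sideLength c σ π f T := by
  simp [survivors]

namespace IsEvent

variable {c : Lattice → ℝ} {E : Finset Lattice} {σ π : Lattice → Lattice} {t₀ T : ℝ}
  (ev : IsEvent c E σ π t₀ T) (h : IsFan E σ π) (hreg : IsRegularEvent c E σ π T)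

include ev in
theorem eq_zero_or_pos {f : Lattice} (hf : f ∈ E) :
    sideLength c σ π f T = 0 ∨ 0 < sideLength c σ π f T := by
  rcases (ev.nonneg f hf).lt_or_eq with h1 | h1
  exacts [.inr h1, .inl h1.symm]

include ev h hreg

/-- Regularity speaks of successors only; if `π f` vanished too, its successor `f` would have
positive length. -/
theorem pred_pos {f : Lattice} (hf : f ∈ E) (h0 : sideLength c σ π f T = 0) :
    0 < sideLength c σ π (π f) T := by
  rcases ev.eq_zero_or_pos (h.pred_mem f hf) with h1 | h1
  · have := (hreg _ (h.pred_mem f hf) h1).2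
    rw [h.succ_pred f hf, h0] at this
    exact absurd this (lt_irrefl _)
  · exact h1

omit ev in
theorem eq_pred_add_succ {f : Lattice} (hf : f ∈ E) (h0 : sideLength c σ π f T = 0) :
    f = π f + σ f := by
  rw [h.pred_add_succ hf, (hreg f hf h0).1, one_smul]

omit ev h in
theorem support_eq {f : Lattice} (hf : f ∈ E) (h0 : sideLength c σ π f T = 0) :
    c f = c (π f) + c (σ f) + T := by
  rw [sideLength, (hreg f hf h0).1] at h0
  push_cast at h0
  linarith

/-- A blow-down: the vanishing `f` is the sum of its neighbours, and these form a unimodular basis.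
Vanishing sides are isolated, so skipping one side at a time is enough. -/
theorem isFan_survivors :
    IsFan (survivors c E σ π T) (skipSucc c σ π T) (skipPred c σ π T) where
  nonempty := by
    obtain ⟨f, hf, h0⟩ := ev.exists_eq_zero
    exact ⟨σ f, mem_survivors.2 ⟨h.succ_mem f hf, (hreg f hf h0).2⟩⟩
  succ_mem e he := by
    obtain ⟨he, -⟩ := mem_survivors.1 he
    rw [mem_survivors, skipSucc]
    have hs := h.succ_mem e he
    rcases ev.eq_zero_or_pos hs with h0 | h0
    · rw [if_neg (by rw [h0]; exact lt_irrefl _)]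
      exact ⟨h.succ_mem _ hs, (hreg _ hs h0).2⟩
    · rw [if_pos h0]
      exact ⟨hs, h0⟩
  pred_mem e he := by
    obtain ⟨he, -⟩ := mem_survivors.1 he
    rw [mem_survivors, skipPred]
    have hs := h.pred_mem e he
    rcases ev.eq_zero_or_pos hs with h0 | h0
    · rw [if_neg (by rw [h0]; exact lt_irrefl _)]
      exact ⟨h.pred_mem _ hs, ev.pred_pos h hreg hs h0⟩
    · rw [if_pos h0]
      exact ⟨hs, h0⟩
  pred_succ e he := by
    obtain ⟨he, hpos⟩ := mem_survivors.1 he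
    have hs := h.succ_mem e he
    rw [skipPred, skipSucc]
    by_cases h0 : 0 < sideLength c σ π (σ e) T
    · rw [if_pos h0, h.pred_succ e he, if_pos hpos]
    · rw [if_neg h0, h.pred_succ _ hs, if_neg h0, h.pred_succ e he]
  succ_pred e he := by
    obtain ⟨he, hpos⟩ := mem_survivors.1 he
    have hs := h.pred_mem e he
    rw [skipPred, skipSucc]
    by_cases h0 : 0 < sideLength c σ π (π e) T
    · rw [if_pos h0, h.succ_pred e he, if_pos hpos]
    · rw [if_neg h0, h.succ_pred _ hs, if_neg h0, h.succ_pred e he]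
  det_succ e he := by
    obtain ⟨he, hpos⟩ := mem_survivors.1 he
    have hs := h.succ_mem e he
    rw [skipSucc]
    rcases ev.eq_zero_or_pos hs with h0 | h0
    · rw [if_neg (by rw [h0]; exact lt_irrefl _)]
      have := (hreg _ hs h0).1
      rwa [h.pred_succ e he] at this
    · rw [if_pos h0]
      exact h.det_succ e he
  not_between e he g hg heg := by
    obtain ⟨he, hpos⟩ := mem_survivors.1 he
    obtain ⟨hg, hgpos⟩ := mem_survivors.1 hg
    have hs := h.succ_mem e he
    rw [skipSucc]
    rcases ev.eq_zero_or_pos hs with h0 | h0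
    · rw [if_neg (by rw [h0]; exact lt_irrefl _)]
      -- The sum `σ e = e + σ (σ e)` cuts the new cone into two old ones with no direction inside.
      -- So `g` would be parallel to `σ e`, but `σ e` has vanished and `-σ e` points the wrong way.
      by_contra hcon
      push Not at hcon
      have h1 := h.not_between e he g hg heg
      have h2 : latDet (σ e) g ≤ 0 := by
        by_contra h3
        exact absurd (h.not_between _ hs g hg (not_le.1 h3)) (not_le.2 hcon)
      have h3 : latDet g (σ e) = latDet g e + latDet g (σ (σ e)) := by
        conv_lhs => rw [IsEvent.eq_pred_add_succ h hreg hs h0, h.pred_succ e he]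
        exact latDet_add_right _ _ _
      have h4 : latDet (σ e) g = 0 := by
        rw [latDet_swap] at h2 ⊢
        linarith
      rcases (h.isPrimitive hs).eq_or_eq_neg (h.isPrimitive hg) h4 with h5 | h5
      · rw [h5, h0] at hgpos
        exact lt_irrefl _ hgpos
      · rw [h5, latDet_neg_right, h.det_succ e he] at heg
        linarith
    · rw [if_pos h0]
      exact h.not_between e he g hg heg

/-- At the event the lines of `e` and `σ (σ e)` cross at the point to which the side `σ e` has
shrunk, so the old and the new front have the same corners. -/
theorem corner_skipSucc {e : Lattice} (he : e ∈ E) :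
    corner c (skipSucc c σ π T) e T = corner c σ e T := by
  have hs := h.succ_mem e he
  rcases ev.eq_zero_or_pos hs with h0 | h0
  · have h1 := IsEvent.support_eq hreg hs h0
    have h2 := IsEvent.eq_pred_add_succ h hreg hs h0
    rw [h.pred_succ e he] at h1 h2
    have h3 : toPlane (σ e) = toPlane e + toPlane (σ (σ e)) := by
      rw [← toPlane_add, ← h2]
    rw [corner, corner, skipSucc, if_neg (by rw [h0]; exact lt_irrefl _), h1, h3]
    module
  · rw [corner, corner, skipSucc, if_pos h0]

theorem sideLength_survivors {f : Lattice} (hf : f ∈ survivors c E σ π T) :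
    sideLength c (skipSucc c σ π T) (skipPred c σ π T) f T = sideLength c σ π f T := by
  obtain ⟨hfE, hpos⟩ := mem_survivors.1 hf
  have hfan := ev.isFan_survivors h hreg
  have h1 := hfan.corner_sub_corner_pred c hf T
  have hp := h.pred_mem f hfE
  have h2 : corner c σ (skipPred c σ π T f) T = corner c σ (π f) T := by
    rcases ev.eq_zero_or_pos hp with h0 | h0
    · rw [skipPred, if_neg (by rw [h0]; exact lt_irrefl _), IsEvent.corner_pred h hp h0]
    · rw [skipPred, if_pos h0]
  have h3 := (mem_survivors.1 (hfan.pred_mem f hf)).1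
  rw [ev.corner_skipSucc h hreg hfE, ev.corner_skipSucc h hreg h3, h2,
    h.corner_sub_corner_pred c hfE] at h1
  exact (smul_left_injective ℝ (h.isPrimitive hfE).toPlane_ne_zero h1).symm

theorem sideLength_survivors_pos {f : Lattice} (hf : f ∈ survivors c E σ π T) :
    0 < sideLength c (skipSucc c σ π T) (skipPred c σ π T) f T := by
  rw [ev.sideLength_survivors h hreg hf]
  exact (mem_survivors.1 hf).2

/-- The removed sides are redundant later. -/
theorem le_det_of_survivors {t : ℝ} (ht : T ≤ t) {y : Plane}
    (hy : ∀ g ∈ survivors c E σ π T, c g + t ≤ det (toPlane g) y) {g : Lattice} (hg : g ∈ E) :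
    c g + t ≤ det (toPlane g) y := by
  rcases ev.eq_zero_or_pos hg with h0 | h0
  -- The inequalities of the two neighbours add up. Since `c g = c (π g) + c (σ g) + T`, their sum
  -- exceeds what is needed by `t - T`, which is nonnegative.
  · have h1 := hy (π g) (mem_survivors.2 ⟨h.pred_mem g hg, ev.pred_pos h hreg hg h0⟩)
    have h2 := hy (σ g) (mem_survivors.2 ⟨h.succ_mem g hg, (hreg g hg h0).2⟩)
    have h3 := IsEvent.support_eq hreg hg h0
    have h4 : det (toPlane g) y = det (toPlane (π g)) y + det (toPlane (σ g)) y := by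
      conv_lhs => rw [IsEvent.eq_pred_add_succ h hreg hg h0, toPlane_add]
      simp [det]; ring
    linarith
  · exact hy g (mem_survivors.2 ⟨hg, h0⟩)

-- The decreasing count of sides bounds the number of regular events.
omit h hreg in
theorem survivors_card_lt : (survivors c E σ π T).card < E.card := by
  obtain ⟨f, hf, h0⟩ := ev.exists_eq_zero
  refine Finset.card_lt_card ⟨fun g hg => (mem_survivors.1 hg).1, fun hsub => ?_⟩
  have := (mem_survivors.1 (hsub hf)).2
  rw [h0] at this
  exact lt_irrefl _ this

/-- Vertices of the front which come together at a regular event bound the same vanishing side. -/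
theorem corner_eq_corner {e f : Lattice} (he : e ∈ E) (hf : f ∈ E)
    (hef : corner c σ e T = corner c σ f T) :
    e = f ∨ (sideLength c σ π f T = 0 ∧ e = π f) ∨ (sideLength c σ π e T = 0 ∧ f = π e) := by
  have hfan := ev.isFan_survivors h hreg
  -- Each corner coincides with a corner of the new front, namely itself or its predecessor. The new
  -- front has positive sides, so its corners are distinct.
  have hrep : ∀ g ∈ E, ∃ r ∈ survivors c E σ π T, corner c (skipSucc c σ π T) r T = corner c σ g T ∧
      (r = g ∨ (sideLength c σ π g T = 0 ∧ r = π g)) := by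
    intro g hg
    rcases ev.eq_zero_or_pos hg with h0 | h0
    · refine ⟨π g, mem_survivors.2 ⟨h.pred_mem g hg, ev.pred_pos h hreg hg h0⟩, ?_, .inr ⟨h0, rfl⟩⟩
      rw [ev.corner_skipSucc h hreg (h.pred_mem g hg), IsEvent.corner_pred h hg h0]
    · exact ⟨g, mem_survivors.2 ⟨hg, h0⟩, ev.corner_skipSucc h hreg hg, .inl rfl⟩
  obtain ⟨r, hr, hr1, hr2⟩ := hrep e he
  obtain ⟨s, hs, hs1, hs2⟩ := hrep f hf
  have hrs : r = s := hfan.corner_injOn c (fun g hg => ev.sideLength_survivors_pos h hreg hg) hr hs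
    (by rw [hr1, hs1, hef])
  rcases hr2 with rfl | ⟨h1, rfl⟩ <;> rcases hs2 with rfl | ⟨h2, rfl⟩
  · exact .inl hrs
  · exact .inr (.inl ⟨h2, hrs⟩)
  · exact .inr (.inr ⟨h1, hrs.symm⟩)
  · left
    rw [← h.succ_pred e he, hrs, h.succ_pred f hf]

end IsEvent

/-! ### Stages of the process -/

theorem Particle.posAt_eq_add (p : Particle) (t t' : ℝ) :
    p.posAt t' = p.posAt t + (t' - t) • toPlane p.vel := by
  simp only [Particle.posAt]; module

theorem emit_smul {e : Lattice} (he : IsPrimitive e) {n : ℕ} (hn : 0 < n) (t : ℝ) (x : Plane) :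
    emit t x (n • e) = ⟨t, x, e, n⟩ := by
  have h1 : Int.gcd (n • e).1 (n • e).2 = n := by
    have : Int.gcd e.1 e.2 = 1 := he
    simp [Int.gcd_mul_left, this]
  have hn' : (n : ℤ) ≠ 0 := by exact_mod_cast hn.ne'
  rw [emit, h1]
  congr 1
  ext <;> simp [Int.mul_ediv_cancel_left _ hn']

theorem emit_of_isPrimitive {e : Lattice} (he : IsPrimitive e) (t : ℝ) (x : Plane) :
    emit t x e = ⟨t, x, e, 1⟩ := by
  simpa using emit_smul he one_pos t x

namespace Stage

theorem nextTime_eq {S : Stage} {T : ℝ} (h : IsLeast S.meetingTimes T) : S.nextTime = T :=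
  h.csInf_eq

theorem next_time {S : Stage} {T : ℝ} (h : IsLeast S.meetingTimes T) : S.next.time = T := by
  rw [next, if_pos ⟨T, h.1⟩]
  exact nextTime_eq h

theorem mem_next_alive {S : Stage} {T : ℝ} (h : IsLeast S.meetingTimes T) {p : Particle} :
    p ∈ S.next.alive ↔ (p ∈ S.alive ∧ p.posAt T ∉ S.collisionPoints) ∨
      ∃ x ∈ S.collisionPoints, S.momentumAt x ≠ 0 ∧ emit T x (S.momentumAt x) = p := by
  rw [next, if_pos ⟨T, h.1⟩, nextTime_eq h]
  simp [and_assoc]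

theorem mem_groupAt {S : Stage} {T : ℝ} (h : IsLeast S.meetingTimes T) {x : Plane} {p : Particle} :
    p ∈ S.groupAt x ↔ p ∈ S.alive ∧ p.posAt T = x := by
  simp [groupAt, nextTime_eq h]

theorem mem_collisionPoints {S : Stage} {T : ℝ} (h : IsLeast S.meetingTimes T) {x : Plane} :
    x ∈ S.collisionPoints ↔
      ∃ p ∈ S.alive, ∃ q ∈ S.alive, p ≠ q ∧ p.posAt T = x ∧ q.posAt T = x := by
  rw [collisionPoints, Finset.mem_filter, Finset.one_lt_card, Finset.mem_image, nextTime_eq h]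
  constructor
  · rintro ⟨-, p, hp, q, hq, hne⟩
    obtain ⟨hp, hpx⟩ := (mem_groupAt h).1 hp
    obtain ⟨hq, hqx⟩ := (mem_groupAt h).1 hq
    exact ⟨p, hp, q, hq, hne, hpx, hqx⟩
  · rintro ⟨p, hp, q, hq, hne, hpx, hqx⟩
    exact ⟨⟨p, hp, hpx⟩, p, (mem_groupAt h).2 ⟨hp, hpx⟩, q, (mem_groupAt h).2 ⟨hq, hqx⟩, hne⟩

/-- The recorded emission time identifies newborn particles; later it shows that a particle which
has disappeared never reappears. -/
theorem time_eq_of_mem_next {S : Stage} {p : Particle} (hp : p ∈ S.next.alive)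
    (hp' : p ∉ S.alive) : p.time = S.next.time := by
  rw [next] at hp ⊢
  split_ifs at hp ⊢ with h
  · simp only [Finset.mem_union, Finset.mem_filter, Finset.mem_image] at hp
    rcases hp with hp | ⟨x, -, rfl⟩
    · exact absurd hp.1 hp'
    · rfl
  · exact absurd hp hp'

/-- The particles move freely for some time, and then some of them meet. -/
structure IsFree (S : Stage) : Prop where
  nonempty : S.meetingTimes.Nonempty
  lt : S.time < S.next.time
  inj : ∀ p ∈ S.alive, ∀ q ∈ S.alive, ∀ t, S.time ≤ t → t < S.next.time →
    p.posAt t = q.posAt t → p = q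
  primitive : ∀ p ∈ S.alive, IsPrimitive p.vel
  time_le : ∀ p ∈ S.alive, p.time ≤ S.time

/-- All collisions are collisions of two particles whose velocities form a basis. -/
structure IsRegular (S : Stage) : Prop where
  cases : ∀ p ∈ S.alive,
    (p ∈ S.next.alive ∧ ∀ q ∈ S.alive, q.posAt S.next.time = p.posAt S.next.time → q = p) ∨
    ∃ p₁ ∈ S.alive, ∃ p₂ ∈ S.alive, ∃ r ∈ S.next.alive,
      p₁.posAt S.next.time = p.posAt S.next.time ∧ p₂.posAt S.next.time = p.posAt S.next.time ∧
      r.posAt S.next.time = p.posAt S.next.time ∧ latDet p₁.vel p₂.vel = 1 ∧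
      r.vel = p₁.vel + p₂.vel ∧
      ∀ q ∈ S.alive, q.posAt S.next.time = p.posAt S.next.time → q = p₁ ∨ q = p₂
  origin : ∀ r ∈ S.next.alive, ∃ p ∈ S.alive, p.posAt S.next.time = r.posAt S.next.time
  momentum : ∀ x ∈ S.collisionPoints, S.momentumAt x ≠ 0

/-- All particles annihilate at `x`. -/
structure IsVanishing (S : Stage) (x : Plane) : Prop where
  posAt : ∀ p ∈ S.alive, p.posAt S.next.time = x
  alive : S.next.alive = ∅
  collision : ∀ y, y ∈ S.collisionPoints ↔ y = x
  momentum : S.momentumAt x = 0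

/-- The particles form two groups at the ends of the segment from `A` to `A - l • e`, and two
particles of mass two start to move along the segment. -/
structure IsFlattening (S : Stage) (A : Plane) (e : Lattice) (l : ℝ) : Prop where
  pos : 0 < l
  primitive : IsPrimitive e
  posAt : ∀ p ∈ S.alive, p.posAt S.next.time = A ∨ p.posAt S.next.time = A - l • toPlane e
  left : ∃ p ∈ S.alive, p.posAt S.next.time = A ∧ latDet e p.vel ≠ 0
  right : ∃ p ∈ S.alive, p.posAt S.next.time = A - l • toPlane e ∧ latDet e p.vel ≠ 0
  alive : ∀ p, p ∈ S.next.alive ↔ p = ⟨S.next.time, A, -e, 2⟩ ∨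
    p = ⟨S.next.time, A - l • toPlane e, e, 2⟩
  momentum : ∀ x ∈ S.collisionPoints, S.momentumAt x ≠ 0

end Stage

/-- The particles of a stage are the vertices of a polygon which moves inwards. -/
structure IsFront (c : Lattice → ℝ) (E : Finset Lattice) (σ π : Lattice → Lattice)
    (pt : Lattice → Particle) (S : Stage) : Prop where
  fan : IsFan E σ π
  pos : ∀ f ∈ E, 0 < sideLength c σ π f S.time
  alive : ∀ p, p ∈ S.alive ↔ ∃ e ∈ E, pt e = p
  posAt : ∀ e ∈ E, ∀ t, (pt e).posAt t = corner c σ e t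
  vel : ∀ e ∈ E, (pt e).vel = σ e - e
  mass : ∀ e ∈ E, (pt e).mass = 1
  time_le : ∀ e ∈ E, (pt e).time ≤ S.time

/-- The lattice distance from `y` to the boundary of the initial polygon is `t`. -/
def HasDepth (c : Lattice → ℝ) (E₀ : Finset Lattice) (y : Plane) (t : ℝ) : Prop :=
  (∀ g ∈ E₀, c g + t ≤ det (toPlane g) y) ∧ ∃ g ∈ E₀, c g + t = det (toPlane g) y

theorem HasDepth.unique {c : Lattice → ℝ} {E₀ : Finset Lattice} {y : Plane} {t t' : ℝ}
    (h : HasDepth c E₀ y t) (h' : HasDepth c E₀ y t') : t = t' := by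
  obtain ⟨g, hg, hg1⟩ := h.2
  obtain ⟨g', hg', hg1'⟩ := h'.2
  have h1 := h.1 g' hg'
  have h2 := h'.1 g hg
  linarith

/-- After the time `τ` the sides in `E` are enough to bound the front. -/
def IsSufficient (c : Lattice → ℝ) (E₀ E : Finset Lattice) (τ : ℝ) : Prop :=
  E ⊆ E₀ ∧ ∀ t y, τ ≤ t → (∀ g ∈ E, c g + t ≤ det (toPlane g) y) →
    ∀ g ∈ E₀, c g + t ≤ det (toPlane g) y

theorem IsSufficient.survivors {c : Lattice → ℝ} {E₀ E : Finset Lattice} {σ π : Lattice → Lattice}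
    {τ T : ℝ} (hE : IsSufficient c E₀ E τ) (ev : IsEvent c E σ π τ T) (h : IsFan E σ π)
    (hreg : IsRegularEvent c E σ π T) : IsSufficient c E₀ (survivors c E σ π T) T :=
  ⟨fun _ hg => hE.1 (mem_survivors.1 hg).1, fun t y ht hy =>
    hE.2 t y (ev.lt.le.trans ht) fun _ hg => ev.le_det_of_survivors h hreg ht hy hg⟩

/-! ### Collisions of a front -/

namespace IsFront

variable {c : Lattice → ℝ} {E E₀ : Finset Lattice} {σ π : Lattice → Lattice}
  {pt : Lattice → Particle} {S : Stage} {T : ℝ} (F : IsFront c E σ π pt S)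
include F

theorem exists_isEvent : ∃ T, IsEvent c E σ π S.time T := by
  obtain ⟨T, h1, h2, h3, h4⟩ := F.fan.exists_event c F.pos
  exact ⟨T, h1, h2, h3, h4⟩

theorem pt_inj {e f : Lattice} (he : e ∈ E) (hf : f ∈ E) (hef : pt e = pt f) : e = f :=
  F.fan.corner_injOn c F.pos he hf (by rw [← F.posAt e he, ← F.posAt f hf, hef])

variable (ev : IsEvent c E σ π S.time T)
include ev

/-- The ends of a vanishing side meet, and as long as all sides are positive the corners are
distinct. So the next collision is exactly the event. -/
theorem isLeast : IsLeast S.meetingTimes T := by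
  constructor
  · obtain ⟨f, hf, h0⟩ := ev.exists_eq_zero
    have hp := F.fan.pred_mem f hf
    refine ⟨ev.lt, pt (π f), (F.alive _).2 ⟨_, hp, rfl⟩, pt f, (F.alive _).2 ⟨_, hf, rfl⟩, ?_, ?_⟩
    · intro heq
      have h1 := F.pt_inj hp hf heq
      have h2 := F.fan.det_pred hf
      rw [h1, latDet_self] at h2
      exact absurd h2 (by norm_num)
    · rw [F.posAt _ hp, F.posAt _ hf, IsEvent.corner_pred F.fan hf h0]
  · rintro t ⟨ht, p, hp, q, hq, hne, hpq⟩
    by_contra hlt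
    push Not at hlt
    obtain ⟨e, he, rfl⟩ := (F.alive _).1 hp
    obtain ⟨f, hf, rfl⟩ := (F.alive _).1 hq
    rw [F.posAt e he, F.posAt f hf] at hpq
    exact hne (congrArg pt (F.fan.corner_injOn c (ev.before t ht.le hlt) he hf hpq))

theorem isFree : S.IsFree where
  nonempty := ⟨T, (F.isLeast ev).1⟩
  lt := by rw [Stage.next_time (F.isLeast ev)]; exact ev.lt
  inj := by
    rw [Stage.next_time (F.isLeast ev)]
    intro p hp q hq t ht htT hpq
    obtain ⟨e, he, rfl⟩ := (F.alive _).1 hp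
    obtain ⟨f, hf, rfl⟩ := (F.alive _).1 hq
    rw [F.posAt e he, F.posAt f hf] at hpq
    exact congrArg pt (F.fan.corner_injOn c (ev.before t ht htT) he hf hpq)
  primitive p hp := by
    obtain ⟨e, he, rfl⟩ := (F.alive _).1 hp
    rw [F.vel e he]
    exact F.fan.isPrimitive_velocity he
  time_le p hp := by
    obtain ⟨e, he, rfl⟩ := (F.alive _).1 hp
    exact F.time_le e he

/-- A corner lies in all half-planes of the front, hence in those of the discarded sides by
sufficiency, and on the line of one of its own sides. -/
theorem hasDepth (hE : IsSufficient c E₀ E S.time) {p : Particle} (hp : p ∈ S.alive) {t : ℝ}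
    (ht : S.time ≤ t) (htT : t ≤ T) : HasDepth c E₀ (p.posAt t) t := by
  obtain ⟨e, he, rfl⟩ := (F.alive _).1 hp
  rw [F.posAt e he]
  exact ⟨hE.2 t _ ht fun g hg => ev.le_det_corner_of_le F.fan ht htT hg he, e, hE.1 he,
    (F.fan.det_corner c he t).symm⟩

theorem mem_collisionPoints {x : Plane} : x ∈ S.collisionPoints ↔
    ∃ e ∈ E, ∃ f ∈ E, e ≠ f ∧ corner c σ e T = x ∧ corner c σ f T = x := by
  rw [Stage.mem_collisionPoints (F.isLeast ev)]
  constructor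
  · rintro ⟨p, hp, q, hq, hne, hpx, hqx⟩
    obtain ⟨e, he, rfl⟩ := (F.alive _).1 hp
    obtain ⟨f, hf, rfl⟩ := (F.alive _).1 hq
    refine ⟨e, he, f, hf, fun h => hne (congrArg pt h), ?_, ?_⟩
    · rw [← F.posAt e he, hpx]
    · rw [← F.posAt f hf, hqx]
  · rintro ⟨e, he, f, hf, hne, hex, hfx⟩
    exact ⟨pt e, (F.alive _).2 ⟨e, he, rfl⟩, pt f, (F.alive _).2 ⟨f, hf, rfl⟩,
      fun h => hne (F.pt_inj he hf h), by rw [F.posAt e he, hex], by rw [F.posAt f hf, hfx]⟩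

open Classical in
theorem momentumAt_eq (x : Plane) :
    S.momentumAt x = ∑ e ∈ E.filter (fun e => corner c σ e T = x), (σ e - e) := by
  rw [Stage.momentumAt]
  symm
  refine Finset.sum_nbij pt ?_ ?_ ?_ ?_
  · intro e he
    obtain ⟨he, hex⟩ := Finset.mem_filter.1 he
    rw [Stage.mem_groupAt (F.isLeast ev)]
    exact ⟨(F.alive _).2 ⟨e, he, rfl⟩, by rw [F.posAt e he, hex]⟩
  · intro e he f hf hef
    exact F.pt_inj (Finset.mem_filter.1 he).1 (Finset.mem_filter.1 hf).1 hef
  · intro p hp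
    obtain ⟨hp, hpx⟩ := (Stage.mem_groupAt (F.isLeast ev)).1 hp
    obtain ⟨e, he, rfl⟩ := (F.alive _).1 hp
    exact ⟨e, Finset.mem_coe.2 (Finset.mem_filter.2 ⟨he, by rw [← F.posAt e he, hpx]⟩), rfl⟩
  · intro e he
    have he := (Finset.mem_filter.1 he).1
    rw [Particle.momentum, F.vel e he, F.mass e he, one_smul]

/-! ### Regular events: blow-downs -/

section Regular

variable (hreg : IsRegularEvent c E σ π T)
include hreg

theorem mem_collisionPoints_of_regular {x : Plane} : x ∈ S.collisionPoints ↔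
    ∃ f ∈ E, sideLength c σ π f T = 0 ∧ corner c σ f T = x := by
  rw [F.mem_collisionPoints ev]
  constructor
  · rintro ⟨e, he, f, hf, hne, hex, hfx⟩
    rcases ev.corner_eq_corner F.fan hreg he hf (hex.trans hfx.symm) with h | h | h
    · exact absurd h hne
    · exact ⟨f, hf, h.1, hfx⟩
    · exact ⟨e, he, h.1, hex⟩
  · rintro ⟨f, hf, h0, hfx⟩
    refine ⟨π f, F.fan.pred_mem f hf, f, hf, fun h1 => ?_, ?_, hfx⟩
    · have h2 := F.fan.det_pred hf
      rw [h1, latDet_self] at h2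
      exact absurd h2 (by norm_num)
    · rw [IsEvent.corner_pred F.fan hf h0, hfx]

theorem corner_eq_iff_of_regular {e f : Lattice} (he : e ∈ E) (hf : f ∈ E)
    (h0 : sideLength c σ π f T = 0) : corner c σ e T = corner c σ f T ↔ e = π f ∨ e = f := by
  constructor
  · intro h
    rcases ev.corner_eq_corner F.fan hreg he hf h with h1 | h1 | h1
    · exact .inr h1
    · exact .inl h1.2
    · have h2 := ev.pred_pos F.fan hreg hf h0
      have h3 := (hreg e he h1.1).2
      have h4 := ev.pred_pos F.fan hreg he h1.1
      rw [← h1.2, h0] at h4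
      exact absurd h4 (lt_irrefl _)
  · rintro (rfl | rfl)
    · exact IsEvent.corner_pred F.fan hf h0
    · rfl

theorem momentumAt_of_regular {f : Lattice} (hf : f ∈ E) (h0 : sideLength c σ π f T = 0) :
    S.momentumAt (corner c σ f T) = σ f - π f := by
  classical
  rw [F.momentumAt_eq ev]
  have hp := F.fan.pred_mem f hf
  have hne : π f ≠ f := by
    intro h1
    have h2 := F.fan.det_pred hf
    rw [h1, latDet_self] at h2
    exact absurd h2 (by norm_num)
  have : E.filter (fun e => corner c σ e T = corner c σ f T) = {π f, f} := by
    ext e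
    simp only [Finset.mem_filter, Finset.mem_insert, Finset.mem_singleton]
    constructor
    · rintro ⟨he, h⟩
      exact (F.corner_eq_iff_of_regular ev hreg he hf h0).1 h
    · intro h
      have he : e ∈ E := by rcases h with rfl | rfl <;> assumption
      exact ⟨he, (F.corner_eq_iff_of_regular ev hreg he hf h0).2 h⟩
  -- The two momenta are `f - π f` and `σ f - f`; they telescope.
  rw [this, Finset.sum_pair hne, F.fan.succ_pred f hf]
  abel

omit F ev in
theorem isPrimitive_succ_sub_pred {f : Lattice} (hf : f ∈ E) (h0 : sideLength c σ π f T = 0) :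
    IsPrimitive (σ f - π f) := by
  have h1 := (hreg f hf h0).1
  have h2 : latDet (σ f - π f) (-π f) = 1 := by
    simp only [latDet, Prod.fst_sub, Prod.snd_sub, Prod.fst_neg, Prod.snd_neg] at *
    linarith
  exact .of_latDet_eq_one h2

theorem notMem_collisionPoints {e : Lattice} (he : e ∈ E) :
    corner c σ e T ∉ S.collisionPoints ↔
      0 < sideLength c σ π e T ∧ 0 < sideLength c σ π (σ e) T := by
  have hs := F.fan.succ_mem e he
  rw [F.mem_collisionPoints_of_regular ev hreg]
  constructor
  · intro h
    constructor
    · rcases ev.eq_zero_or_pos he with h0 | h0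
      · exact absurd ⟨e, he, h0, rfl⟩ h
      · exact h0
    · rcases ev.eq_zero_or_pos hs with h0 | h0
      · refine absurd ⟨σ e, hs, h0, ?_⟩ h
        rw [← IsEvent.corner_pred F.fan hs h0, F.fan.pred_succ e he]
      · exact h0
  · rintro ⟨h1, h2⟩ ⟨f, hf, h0, hfx⟩
    rcases (F.corner_eq_iff_of_regular ev hreg he hf h0).1 hfx.symm with rfl | rfl
    · rw [F.fan.succ_pred f hf, h0] at h2
      exact lt_irrefl _ h2
    · rw [h0] at h1
      exact lt_irrefl _ h1

/-- A particle is labelled by the side preceding its corner. When `f` vanishes, the label `f`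
disappears and `π f` passes to the newborn particle, whose velocity `σ f - π f` is that of the new
corner. -/
theorem exists_next : ∃ pt', IsFront c (survivors c E σ π T) (skipSucc c σ π T)
    (skipPred c σ π T) pt' S.next := by
  classical
  have hL := F.isLeast ev
  have hT := Stage.next_time hL
  have hfan := ev.isFan_survivors F.fan hreg
  refine ⟨fun e => if 0 < sideLength c σ π (σ e) T then pt e else
    ⟨T, corner c σ e T, σ (σ e) - e, 1⟩, hfan, ?_, ?_, ?_, ?_, ?_, ?_⟩
  · rw [hT]
    exact fun f hf => ev.sideLength_survivors_pos F.fan hreg hf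
  · intro p
    rw [Stage.mem_next_alive hL]
    constructor
    · rintro (⟨hp, hpc⟩ | ⟨x, hx, hx0, rfl⟩)
      · obtain ⟨e, he, rfl⟩ := (F.alive _).1 hp
        rw [F.posAt e he, F.notMem_collisionPoints ev hreg he] at hpc
        exact ⟨e, mem_survivors.2 ⟨he, hpc.1⟩, by rw [if_pos hpc.2]⟩
      · obtain ⟨f, hf, h0, rfl⟩ := (F.mem_collisionPoints_of_regular ev hreg).1 hx
        refine ⟨π f, mem_survivors.2 ⟨F.fan.pred_mem f hf, ev.pred_pos F.fan hreg hf h0⟩, ?_⟩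
        rw [F.fan.succ_pred f hf, if_neg (by rw [h0]; exact lt_irrefl _),
          F.momentumAt_of_regular ev hreg hf h0,
          emit_of_isPrimitive (isPrimitive_succ_sub_pred hreg hf h0),
          IsEvent.corner_pred F.fan hf h0]
    · rintro ⟨e, he, rfl⟩
      obtain ⟨he, hpos⟩ := mem_survivors.1 he
      have hs := F.fan.succ_mem e he
      rcases ev.eq_zero_or_pos hs with h0 | h0
      · right
        have h1 := isPrimitive_succ_sub_pred hreg hs h0
        have h2 := F.momentumAt_of_regular ev hreg hs h0
        have h3 := IsEvent.corner_pred (T := T) (c := c) F.fan hs h0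
        rw [F.fan.pred_succ e he] at h1 h2 h3
        refine ⟨corner c σ (σ e) T,
          (F.mem_collisionPoints_of_regular ev hreg).2 ⟨_, hs, h0, rfl⟩, ?_, ?_⟩
        · rw [h2]; exact h1.ne_zero
        · rw [if_neg (by rw [h0]; exact lt_irrefl _), h2, emit_of_isPrimitive h1, h3]
      · left
        rw [if_pos h0, F.posAt e he, F.notMem_collisionPoints ev hreg he]
        exact ⟨(F.alive _).2 ⟨e, he, rfl⟩, hpos, h0⟩
  · intro e he t
    have h1 := ev.corner_skipSucc F.fan hreg (mem_survivors.1 he).1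
    rw [corner_eq_add c _ e T t, h1]
    obtain ⟨he, hpos⟩ := mem_survivors.1 he
    split_ifs with h0
    · rw [F.posAt e he, corner_eq_add c _ e T t, skipSucc, if_pos h0]
    · rw [skipSucc, if_neg h0, Particle.posAt]
  · intro e he
    rw [skipSucc]
    split_ifs
    · exact F.vel e (mem_survivors.1 he).1
    · rfl
  · intro e he
    split_ifs
    · exact F.mass e (mem_survivors.1 he).1
    · rfl
  · intro e he
    rw [hT]
    split_ifs
    · exact (F.time_le e (mem_survivors.1 he).1).trans ev.lt.le
    · exact le_rfl

/-- Only the two ends of a vanishing side can meet, since vanishing sides are isolated. -/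
theorem isRegular : S.IsRegular := by
  have hL := F.isLeast ev
  have hT := Stage.next_time hL
  have key : ∀ f ∈ E, sideLength c σ π f T = 0 → ∀ x, corner c σ f T = x →
    ∃ p₁ ∈ S.alive, ∃ p₂ ∈ S.alive, ∃ r ∈ S.next.alive,
      p₁.posAt T = x ∧ p₂.posAt T = x ∧ r.posAt T = x ∧ latDet p₁.vel p₂.vel = 1 ∧
      r.vel = p₁.vel + p₂.vel ∧ ∀ q ∈ S.alive, q.posAt T = x → q = p₁ ∨ q = p₂ := by
    rintro f hf h0 x rfl
    have hp := F.fan.pred_mem f hf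
    have h1 := isPrimitive_succ_sub_pred hreg hf h0
    refine ⟨pt (π f), (F.alive _).2 ⟨_, hp, rfl⟩, pt f, (F.alive _).2 ⟨_, hf, rfl⟩,
      ⟨T, corner c σ f T, σ f - π f, 1⟩, ?_, ?_, F.posAt f hf T, by simp [Particle.posAt], ?_, ?_,
      ?_⟩
    · rw [Stage.mem_next_alive hL]
      right
      refine ⟨corner c σ f T, (F.mem_collisionPoints_of_regular ev hreg).2 ⟨f, hf, h0, rfl⟩, ?_⟩
      rw [F.momentumAt_of_regular ev hreg hf h0]
      exact ⟨h1.ne_zero, emit_of_isPrimitive h1 _ _⟩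
    · rw [F.posAt _ hp, IsEvent.corner_pred F.fan hf h0]
    · rw [F.vel _ hp, F.vel _ hf, F.fan.succ_pred f hf]
      -- Expanding `latDet (f - π f) (σ f - f)` leaves three determinants of directions, each equal
      -- to 1, with signs giving `1 - 1 + 1`.
      have h2 := (hreg f hf h0).1
      have h3 := F.fan.det_succ f hf
      have h4 := F.fan.det_pred hf
      simp only [latDet, Prod.fst_sub, Prod.snd_sub] at *
      linarith
    · rw [F.vel _ hp, F.vel _ hf, F.fan.succ_pred f hf]
      change σ f - π f = _
      abel
    · intro q hq hqx
      obtain ⟨e, he, rfl⟩ := (F.alive _).1 hq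
      rw [F.posAt e he, F.corner_eq_iff_of_regular ev hreg he hf h0] at hqx
      rcases hqx with rfl | rfl
      exacts [.inl rfl, .inr rfl]
  constructor
  · rw [hT]
    intro p hp
    obtain ⟨e, he, rfl⟩ := (F.alive _).1 hp
    by_cases hc : corner c σ e T ∈ S.collisionPoints
    · right
      obtain ⟨f, hf, h0, hfx⟩ := (F.mem_collisionPoints_of_regular ev hreg).1 hc
      exact key f hf h0 _ (hfx.trans (F.posAt e he T).symm)
    · left
      refine ⟨(Stage.mem_next_alive hL).2 (.inl ⟨hp, by rwa [F.posAt e he]⟩), ?_⟩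
      intro q hq hqe
      by_contra hne
      refine hc ((Stage.mem_collisionPoints hL).2 ⟨q, hq, _, hp, hne, ?_, F.posAt e he T⟩)
      rw [hqe, F.posAt e he]
  · intro r hr
    rw [hT]
    rcases (Stage.mem_next_alive hL).1 hr with ⟨hr, -⟩ | ⟨x, hx, -, rfl⟩
    · exact ⟨r, hr, rfl⟩
    · obtain ⟨p, hp, -, -, -, hpx, -⟩ := (Stage.mem_collisionPoints hL).1 hx
      exact ⟨p, hp, hpx.trans (by simp [emit, Particle.posAt])⟩
  · intro x hx
    obtain ⟨f, hf, h0, rfl⟩ := (F.mem_collisionPoints_of_regular ev hreg).1 hx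
    rw [F.momentumAt_of_regular ev hreg hf h0]
    exact (isPrimitive_succ_sub_pred hreg hf h0).ne_zero

end Regular

/-- All particles meet, and the sum of `σ e - e` over the whole fan is zero because `σ` permutes the
fan. -/
theorem isVanishing {x : Plane} (hx : ∀ f ∈ E, corner c σ f T = x) : S.IsVanishing x := by
  classical
  have hL := F.isLeast ev
  have hc : ∀ y, y ∈ S.collisionPoints ↔ y = x := by
    intro y
    rw [F.mem_collisionPoints ev]
    constructor
    · rintro ⟨e, he, -, -, -, hex, -⟩
      rw [← hex, hx e he]
    · rintro rfl
      obtain ⟨e, he⟩ := F.fan.nonempty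
      refine ⟨e, he, σ e, F.fan.succ_mem e he, fun h => ?_, hx e he, hx _ (F.fan.succ_mem e he)⟩
      have := F.fan.det_succ e he
      rw [← h, latDet_self] at this
      exact absurd this (by norm_num)
  have hm : S.momentumAt x = 0 := by
    rw [F.momentumAt_eq ev, Finset.filter_true_of_mem hx, Finset.sum_sub_distrib, sub_eq_zero]
    exact F.fan.sum_comp_succ (fun f => f)
  refine ⟨?_, ?_, hc, hm⟩
  · rw [Stage.next_time hL]
    intro p hp
    obtain ⟨e, he, rfl⟩ := (F.alive _).1 hp
    rw [F.posAt e he, hx e he]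
  · refine Finset.eq_empty_of_forall_notMem fun p hp => ?_
    rcases (Stage.mem_next_alive hL).1 hp with ⟨hp, hpc⟩ | ⟨y, hy, hy0, -⟩
    · obtain ⟨e, he, rfl⟩ := (F.alive _).1 hp
      rw [F.posAt e he, hx e he, hc] at hpc
      exact hpc rfl
    · rw [(hc y).1 hy] at hy0
      exact hy0 hm

/-! ### Collapse to a segment -/

section Flat

variable {e : Lattice} (hfl : IsFlat c E T e) (hne : corner c σ e T ≠ corner c σ (-e) T)
include hfl hne

theorem corner_eq_iff_of_isFlat {f : Lattice} (hf : f ∈ E) :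
    corner c σ f T = corner c σ e T ↔ 0 < latDet e f ∨ f = e := by
  constructor
  · intro h
    rcases ev.corner_eq_or_of_isFlat F.fan hfl hf with h1 | h1
    · exact h1.1
    · exact absurd (h.symm.trans h1.2) hne
  · rintro (h | rfl)
    · exact ev.corner_eq_of_isFlat F.fan hfl hf h
    · rfl

/-- The particles at this end are labelled by `e` and by the directions strictly to its left. Along
this chain from `e` to `-e` the momenta telescope to `-e - e`. -/
theorem momentumAt_of_isFlat : S.momentumAt (corner c σ e T) = 2 • (-e) := by
  classical
  rw [F.momentumAt_eq ev]
  have he := hfl.mem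
  have hE := F.fan
  set U := E.filter (fun f => 0 < latDet e f) with hU
  have heU : e ∉ U := by simp [hU, latDet_self]
  have hneU : -e ∉ U := by simp [hU, latDet_neg_right, latDet_self]
  have h1 : E.filter (fun f => corner c σ f T = corner c σ e T) = insert e U := by
    ext f
    simp only [Finset.mem_filter, Finset.mem_insert, hU]
    constructor
    · rintro ⟨hf, h⟩
      rcases (F.corner_eq_iff_of_isFlat ev hfl hne hf).1 h with h | h
      exacts [.inr ⟨hf, h⟩, .inl h]
    · rintro (rfl | ⟨hf, h⟩)
      · exact ⟨he, rfl⟩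
      · exact ⟨hf, (F.corner_eq_iff_of_isFlat ev hfl hne hf).2 (.inl h)⟩
  -- The successor maps the half-open half-fan containing `e` onto the one containing `-e`. It
  -- cannot jump over `-e`, nor the predecessor over `e`, since no direction lies strictly between
  -- consecutive ones.
  have h2 : ∑ f ∈ insert e U, σ f = ∑ f ∈ insert (-e) U, f := by
    refine Finset.sum_bij' (fun f _ => σ f) (fun f _ => π f) ?_ ?_ ?_ ?_ (fun _ _ => rfl)
    · intro f hf
      rcases Finset.mem_insert.1 hf with rfl | hf
      · refine Finset.mem_insert_of_mem (Finset.mem_filter.2 ⟨hE.succ_mem f he, ?_⟩)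
        rw [hE.det_succ f he]; exact one_pos
      obtain ⟨hf, hef⟩ := Finset.mem_filter.1 hf
      have hs := hE.succ_mem f hf
      rcases lt_trichotomy (latDet e (σ f)) 0 with h | h | h
      · have h3 := hE.not_between f hf (-e) hfl.neg_mem
          (by rw [latDet_neg_right, latDet_swap]; linarith)
        rw [latDet_neg_left] at h3
        linarith
      · rcases (hE.isPrimitive he).eq_or_eq_neg (hE.isPrimitive hs) h with h3 | h3
        · have h4 := hE.det_succ f hf
          rw [h3, latDet_swap] at h4
          linarith
        · rw [h3]; exact Finset.mem_insert_self _ _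
      · exact Finset.mem_insert_of_mem (Finset.mem_filter.2 ⟨hs, h⟩)
    · intro f hf
      have hfE : f ∈ E := by
        rcases Finset.mem_insert.1 hf with rfl | hf
        exacts [hfl.neg_mem, (Finset.mem_filter.1 hf).1]
      have hp := hE.pred_mem f hfE
      have h4 := hE.det_pred hfE
      have h5 : 0 ≤ latDet e (π f) := by
        rcases Finset.mem_insert.1 hf with rfl | hf
        · rw [latDet_neg_right, latDet_swap] at h4
          linarith
        · by_contra h6
          push Not at h6
          have h7 := hE.not_between _ hp e he (by rw [latDet_swap]; linarith)
          rw [hE.succ_pred f hfE] at h7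
          linarith [(Finset.mem_filter.1 hf).2]
      rcases h5.lt_or_eq with h6 | h6
      · exact Finset.mem_insert_of_mem (Finset.mem_filter.2 ⟨hp, h6⟩)
      · rcases (hE.isPrimitive he).eq_or_eq_neg (hE.isPrimitive hp) h6.symm with h7 | h7
        · rw [h7]; exact Finset.mem_insert_self _ _
        · rw [h7, latDet_neg_left] at h4
          rcases Finset.mem_insert.1 hf with rfl | hf
          · rw [latDet_neg_right, latDet_self] at h4
            norm_num at h4
          · linarith [(Finset.mem_filter.1 hf).2]
    · intro f hf
      rcases Finset.mem_insert.1 hf with rfl | hf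
      exacts [hE.pred_succ _ he, hE.pred_succ _ (Finset.mem_filter.1 hf).1]
    · intro f hf
      rcases Finset.mem_insert.1 hf with rfl | hf
      exacts [hE.succ_pred _ hfl.neg_mem, hE.succ_pred _ (Finset.mem_filter.1 hf).1]
  rw [h1, Finset.sum_sub_distrib, h2, Finset.sum_insert heU, Finset.sum_insert hneU, two_smul]
  abel

omit hne in
theorem mem_collisionPoints_of_isFlat {x : Plane} :
    x ∈ S.collisionPoints ↔ x = corner c σ e T ∨ x = corner c σ (-e) T := by
  rw [F.mem_collisionPoints ev]
  have key : ∀ g, IsFlat c E T g → ∃ e' ∈ E, ∃ f ∈ E, e' ≠ f ∧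
      corner c σ e' T = corner c σ g T ∧ corner c σ f T = corner c σ g T := by
    intro g hg
    have h1 := F.fan.det_succ g hg.mem
    refine ⟨g, hg.mem, σ g, F.fan.succ_mem g hg.mem, fun h => ?_, rfl,
      ev.corner_eq_of_isFlat F.fan hg (F.fan.succ_mem g hg.mem) (by rw [h1]; exact one_pos)⟩
    rw [← h, latDet_self] at h1
    exact absurd h1 (by norm_num)
  constructor
  · rintro ⟨f, hf, -, -, -, hfx, -⟩
    rw [← hfx]
    rcases ev.corner_eq_or_of_isFlat F.fan hfl hf with h1 | h1
    exacts [.inl h1.2, .inr h1.2]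
  · rintro (rfl | rfl)
    exacts [key e hfl, key _ hfl.neg]

/-- The segment is the side `e` itself: its first corner has come to the end of `-e`, and `l` is its
remaining length. -/
theorem exists_corner_sub : ∃ l : ℝ, 0 < l ∧
    corner c σ (-e) T = corner c σ e T - l • toPlane e := by
  have he := hfl.mem
  have h1 := F.fan.corner_sub_corner_pred c he T
  have hp := F.fan.pred_mem e he
  have h2 : corner c σ (π e) T = corner c σ (-e) T := by
    refine ev.corner_eq_of_isFlat F.fan hfl.neg hp ?_
    have := F.fan.det_pred he
    rw [latDet_neg_left, latDet_swap]
    linarith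
  rw [h2] at h1
  refine ⟨sideLength c σ π e T, ?_, by rw [← h1]; abel⟩
  rcases ev.eq_zero_or_pos he with h0 | h0
  · rw [h0, zero_smul, sub_eq_zero] at h1
    exact absurd h1 hne
  · exact h0

theorem exists_isFlattening (hE : IsSufficient c E₀ E S.time) :
    ∃ A l, S.IsFlattening A e l ∧
      ∀ s, 0 ≤ s → s ≤ l → HasDepth c E₀ (A - s • toPlane e) S.next.time := by
  have hL := F.isLeast ev
  have hT := Stage.next_time hL
  obtain ⟨l, hl, hB⟩ := F.exists_corner_sub ev hfl hne
  have he := hfl.mem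
  have hm1 := F.momentumAt_of_isFlat ev hfl hne
  have hm2 := F.momentumAt_of_isFlat ev hfl.neg (by rw [neg_neg]; exact hne.symm)
  have hpr := F.fan.isPrimitive he
  have hpr' := F.fan.isPrimitive hfl.neg_mem
  have h2e : ∀ g : Lattice, IsPrimitive g → 2 • g ≠ 0 := fun g hg h =>
    hg.ne_zero ((smul_eq_zero.1 h).resolve_left (by norm_num))
  rw [neg_neg] at hm2
  refine ⟨corner c σ e T, l, ⟨hl, hpr, ?_, ?_, ?_, ?_, ?_⟩, ?_⟩ <;> (try rw [hT]) <;>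
    (try rw [← hB])
  · intro p hp
    obtain ⟨f, hf, rfl⟩ := (F.alive _).1 hp
    rw [F.posAt f hf]
    rcases ev.corner_eq_or_of_isFlat F.fan hfl hf with h1 | h1
    exacts [.inl h1.2, .inr h1.2]
  -- An arriving particle transverse to `e`; its ray will show that the end of the segment is a
  -- vertex of the curve.
  · refine ⟨pt e, (F.alive _).2 ⟨e, he, rfl⟩, F.posAt e he T, ?_⟩
    rw [F.vel e he, latDet_sub_right, F.fan.det_succ e he, latDet_self]
    norm_num
  · refine ⟨pt (-e), (F.alive _).2 ⟨-e, hfl.neg_mem, rfl⟩, F.posAt _ hfl.neg_mem T, ?_⟩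
    have := F.fan.det_succ _ hfl.neg_mem
    rw [latDet_neg_left] at this
    rw [F.vel _ hfl.neg_mem, latDet_sub_right, latDet_neg_right, latDet_self]
    omega
  · intro p
    rw [Stage.mem_next_alive hL]
    constructor
    · rintro (⟨hp, hpc⟩ | ⟨x, hx, -, rfl⟩)
      · obtain ⟨f, hf, rfl⟩ := (F.alive _).1 hp
        rw [F.posAt f hf, F.mem_collisionPoints_of_isFlat ev hfl] at hpc
        exfalso
        rcases ev.corner_eq_or_of_isFlat F.fan hfl hf with h1 | h1
        exacts [hpc (.inl h1.2), hpc (.inr h1.2)]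
      · rcases (F.mem_collisionPoints_of_isFlat ev hfl).1 hx with rfl | rfl
        · left; rw [hm1, emit_smul hpr' two_pos]
        · right; rw [hm2, emit_smul hpr two_pos]
    · rintro (rfl | rfl)
      · right
        refine ⟨_, (F.mem_collisionPoints_of_isFlat ev hfl).2 (.inl rfl), ?_, ?_⟩
        · rw [hm1]; exact h2e _ hpr'
        · rw [hm1, emit_smul hpr' two_pos]
      · right
        refine ⟨_, (F.mem_collisionPoints_of_isFlat ev hfl).2 (.inr rfl), ?_, ?_⟩
        · rw [hm2]; exact h2e _ hpr
        · rw [hm2, emit_smul hpr two_pos]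
  · intro x hx
    rcases (F.mem_collisionPoints_of_isFlat ev hfl).1 hx with rfl | rfl
    · rw [hm1]; exact h2e _ hpr'
    · rw [hm2]; exact h2e _ hpr
  · intro s hs0 hsl
    have hdep : ∀ f ∈ E, HasDepth c E₀ (corner c σ f T) T := fun f hf => by
      have := F.hasDepth ev hE ((F.alive _).2 ⟨f, hf, rfl⟩) ev.lt.le le_rfl
      rwa [F.posAt f hf] at this
    refine ⟨fun g hg => ?_, e, hE.1 he, ?_⟩
    · have h1 := (hdep e he).1 g hg
      have h2 := (hdep _ hfl.neg_mem).1 g hg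
      rw [hB] at h2
      rw [det_sub_right, det_smul_right] at h2 ⊢
      -- The bound is affine in `s` and holds at both ends of the segment, hence in between; the
      -- sign decides which end is used.
      rcases le_total 0 (det (toPlane g) (toPlane e)) with h3 | h3
      · nlinarith
      · nlinarith
    · rw [det_sub_right, det_smul_right, det_self, F.fan.det_corner c he]
      ring

end Flat

end IsFront

/-! ### The initial front -/

theorem IsPrimDir.unique {u w : Lattice} {x : Plane} (hu : IsPrimDir u x) (hw : IsPrimDir w x) :
    u = w := by
  obtain ⟨hu, a, ha, rfl⟩ := hu
  obtain ⟨hw, b, hb, hab⟩ := hw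
  exact (hu.eq_of_smul_eq hw ha hb.le hab).symm

theorem primDir_eq {u : Lattice} {x : Plane} (hu : IsPrimDir u x) : primDir x = u := by
  have h : ∃ u, IsPrimDir u x := ⟨u, hu⟩
  rw [primDir, dif_pos h]
  exact h.choose_spec.unique hu

theorem IsPrimDir.neg {u : Lattice} {x : Plane} (hu : IsPrimDir u x) : IsPrimDir (-u) (-x) := by
  obtain ⟨hu, a, ha, rfl⟩ := hu
  exact ⟨hu.neg, a, ha, by rw [toPlane_neg, smul_neg]⟩

namespace ConvexPolygon

variable (P : ConvexPolygon)

theorem natCast_ne_zero_of_lt {m : ℕ} (h0 : 0 < m) (h3 : m < 3) : (m : ZMod P.n) ≠ 0 := by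
  rw [Ne, ZMod.natCast_eq_zero_iff]
  intro h
  have := Nat.le_of_dvd h0 h
  have := P.three_le
  omega

theorem add_one_ne (i : ZMod P.n) : i + 1 ≠ i := by
  have := P.natCast_ne_zero_of_lt one_pos (by norm_num)
  simpa using this

theorem add_one_add_one_ne (i : ZMod P.n) : i + 1 + 1 ≠ i := by
  have := P.natCast_ne_zero_of_lt two_pos (by norm_num)
  rw [add_assoc, one_add_one_eq_two]
  simpa using this

/-- The direction of the side from `vertex i` to `vertex (i + 1)`. -/
noncomputable def sideDir (i : ZMod P.n) : Lattice := primDir (P.vertex (i + 1) - P.vertex i)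

open Classical in
/-- The directions of all sides. -/
noncomputable def sideDirs : Finset Lattice := Finset.univ.image P.sideDir

/-- The side of a given direction. -/
noncomputable def sideIndex (e : Lattice) : ZMod P.n := Function.invFun P.sideDir e

/-- The support numbers of the polygon. -/
noncomputable def support (e : Lattice) : ℝ := det (toPlane e) (P.vertex (P.sideIndex e))

/-- The direction of the next side. -/
noncomputable def nextDir (e : Lattice) : Lattice := P.sideDir (P.sideIndex e + 1)

/-- The direction of the previous side. -/
noncomputable def prevDir (e : Lattice) : Lattice := P.sideDir (P.sideIndex e - 1)

variable {P} (hP : P.IsDelzant)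
include hP

theorem isPrimDir_sideDir (i : ZMod P.n) :
    IsPrimDir (P.sideDir i) (P.vertex (i + 1) - P.vertex i) := by
  obtain ⟨u, -, hu, -⟩ := hP i
  rw [sideDir, primDir_eq hu]
  exact hu

theorem isPrimDir_neg_sideDir (i : ZMod P.n) :
    IsPrimDir (-P.sideDir (i - 1)) (P.vertex (i - 1) - P.vertex i) := by
  have := (isPrimDir_sideDir hP (i - 1)).neg
  rwa [sub_add_cancel, neg_sub] at this

/-- The Delzant condition gives a unit, and strict convexity with counterclockwise order fixes its
sign. -/
theorem latDet_sideDir (i : ZMod P.n) : latDet (P.sideDir i) (P.sideDir (i + 1)) = 1 := by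
  obtain ⟨u, w, hu, hw, hdet⟩ := hP (i + 1)
  have h1 := isPrimDir_neg_sideDir hP (i + 1)
  rw [(isPrimDir_sideDir hP (i + 1)).unique hu]
  rw [add_sub_cancel_right] at h1 hw
  have hi : P.sideDir i = -w := by rw [← h1.unique hw, neg_neg]
  have hc := P.convex (i + 1) i (P.add_one_ne i).symm (P.add_one_add_one_ne i).symm
  obtain ⟨-, a, ha, hxa⟩ := hu
  obtain ⟨-, b, hb, hxb⟩ := hw
  have h2 : det (a • toPlane u) (b • toPlane w) = a * b * latDet u w := by
    rw [← det_toPlane]; simp [det]; ring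
  rw [hxa, hxb, h2] at hc
  have h3 : (0 : ℝ) < latDet u w := by
    by_contra h
    have := mul_nonneg (mul_pos ha hb).le (neg_nonneg.2 (not_lt.1 h))
    linarith
  have h4 : 0 < latDet u w := by exact_mod_cast h3
  rw [hi, latDet_neg_left, latDet_swap, neg_neg]
  rcases Int.isUnit_iff.1 hdet with h5 | h5 <;> omega

theorem det_sideDir_succ (i : ZMod P.n) :
    det (toPlane (P.sideDir i)) (P.vertex (i + 1)) = det (toPlane (P.sideDir i)) (P.vertex i) := by
  obtain ⟨-, a, -, hx⟩ := isPrimDir_sideDir hP i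
  rw [← sub_eq_zero, ← det_sub_right, hx, det_smul_right, det_self, mul_zero]

theorem lt_det_sideDir {i j : ZMod P.n} (h1 : j ≠ i) (h2 : j ≠ i + 1) :
    det (toPlane (P.sideDir i)) (P.vertex i) < det (toPlane (P.sideDir i)) (P.vertex j) := by
  obtain ⟨-, a, ha, hx⟩ := isPrimDir_sideDir hP i
  have hc := P.convex i j h1 h2
  have h3 : det (a • toPlane (P.sideDir i)) (P.vertex j - P.vertex i) =
      a * det (toPlane (P.sideDir i)) (P.vertex j - P.vertex i) := by
    simp [det]; ring
  rw [hx, h3, det_sub_right] at hc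
  have := pos_of_mul_pos_right hc ha.le
  linarith

theorem le_det_sideDir (i j : ZMod P.n) :
    det (toPlane (P.sideDir i)) (P.vertex i) ≤ det (toPlane (P.sideDir i)) (P.vertex j) := by
  by_cases h1 : j = i
  · rw [h1]
  by_cases h2 : j = i + 1
  · rw [h2, det_sideDir_succ hP]
  exact (lt_det_sideDir hP h1 h2).le

/-- A linear functional is minimal on the polygon along at most one side. This allows sides to be
labelled by their directions. -/
theorem sideDir_injective : Function.Injective P.sideDir := by
  intro i j hij
  by_contra hne
  have h1 := le_det_sideDir hP i j
  have h2 := le_det_sideDir hP j i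
  have hj : j = i + 1 := by
    by_contra h
    have := lt_det_sideDir hP (Ne.symm hne) h
    rw [hij] at this
    linarith
  have := latDet_sideDir hP i
  rw [← hj, ← hij, latDet_self] at this
  exact absurd this (by norm_num)

theorem sideIndex_sideDir (i : ZMod P.n) : P.sideIndex (P.sideDir i) = i :=
  Function.leftInverse_invFun (sideDir_injective hP) i

omit hP in
theorem mem_sideDirs {e : Lattice} : e ∈ P.sideDirs ↔ ∃ i, P.sideDir i = e := by
  simp [sideDirs]

theorem nextDir_sideDir (i : ZMod P.n) : P.nextDir (P.sideDir i) = P.sideDir (i + 1) := by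
  rw [nextDir, sideIndex_sideDir hP]

theorem prevDir_sideDir (i : ZMod P.n) : P.prevDir (P.sideDir i) = P.sideDir (i - 1) := by
  rw [prevDir, sideIndex_sideDir hP]

theorem isFan_sideDirs : IsFan P.sideDirs P.nextDir P.prevDir where
  nonempty := ⟨_, mem_sideDirs.2 ⟨0, rfl⟩⟩
  succ_mem _ _ := mem_sideDirs.2 ⟨_, rfl⟩
  pred_mem _ _ := mem_sideDirs.2 ⟨_, rfl⟩
  pred_succ e he := by
    obtain ⟨i, rfl⟩ := mem_sideDirs.1 he
    rw [nextDir_sideDir hP, prevDir_sideDir hP, add_sub_cancel_right]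
  succ_pred e he := by
    obtain ⟨i, rfl⟩ := mem_sideDirs.1 he
    rw [prevDir_sideDir hP, nextDir_sideDir hP, sub_add_cancel]
  det_succ e he := by
    obtain ⟨i, rfl⟩ := mem_sideDirs.1 he
    rw [nextDir_sideDir hP, latDet_sideDir hP]
  not_between e he h hh hpos := by
    obtain ⟨i, rfl⟩ := mem_sideDirs.1 he
    obtain ⟨k, rfl⟩ := mem_sideDirs.1 hh
    rw [nextDir_sideDir hP]
    by_contra hcon
    push Not at hcon
    have h1 := latDet_sideDir hP i
    have h2 := le_det_sideDir hP k (i + 1)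
    have h3 := le_det_sideDir hP i k
    have h4 := le_det_sideDir hP (i + 1) k
    rw [← det_sideDir_succ hP] at h3
    set z := P.vertex (i + 1) with hz
    set y := P.vertex k with hy
    -- Cramer's rule writes `sideDir k` in the basis of the sides `i` and `i + 1`, with positive
    -- coefficients. The functional of side `k` would then be strictly smaller at their common
    -- vertex than on side `k` itself.
    have h5 : det (toPlane (P.sideDir k)) (z - y) =
        latDet (P.sideDir k) (P.sideDir (i + 1)) * det (toPlane (P.sideDir i)) (z - y) +
        latDet (P.sideDir i) (P.sideDir k) * det (toPlane (P.sideDir (i + 1))) (z - y) := by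
      have h1' : ((P.sideDir i).1 : ℝ) * (P.sideDir (i + 1)).2 -
          (P.sideDir i).2 * (P.sideDir (i + 1)).1 = 1 := by
        simp only [latDet] at h1; exact_mod_cast h1
      simp only [det, latDet, toPlane_fst, toPlane_snd, Prod.fst_sub, Prod.snd_sub]
      push_cast
      linear_combination (-(((P.sideDir k).1 : ℝ) * (z.2 - y.2) -
        (P.sideDir k).2 * (z.1 - y.1))) * h1'
    simp only [det_sub_right] at h5
    have hposR : (0 : ℝ) < latDet (P.sideDir i) (P.sideDir k) := by exact_mod_cast hpos
    have hconR : (0 : ℝ) < latDet (P.sideDir k) (P.sideDir (i + 1)) := by exact_mod_cast hcon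
    have hki : k ≠ i + 1 := by
      rintro rfl
      rw [latDet_self] at hcon
      exact lt_irrefl _ hcon
    have hki' : k ≠ i := by
      rintro rfl
      rw [latDet_self] at hpos
      exact lt_irrefl _ hpos
    have h6 := lt_det_sideDir hP hki' hki
    rw [← det_sideDir_succ hP] at h6
    have h7 := mul_pos hconR (sub_pos.2 h6)
    have h8 := mul_nonneg hposR.le (sub_nonneg.2 h4)
    linarith

theorem corner_support (i : ZMod P.n) :
    corner P.support P.nextDir (P.sideDir i) 0 = P.vertex (i + 1) := by
  have h1 := latDet_sideDir hP i
  have h1' : ((P.sideDir i).1 : ℝ) * (P.sideDir (i + 1)).2 -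
      (P.sideDir i).2 * (P.sideDir (i + 1)).1 = 1 := by
    simp only [latDet] at h1; exact_mod_cast h1
  rw [corner, nextDir_sideDir hP, support, support, sideIndex_sideDir hP, sideIndex_sideDir hP,
    ← det_sideDir_succ hP i]
  ext
  · simp [det]; linear_combination (P.vertex (i + 1)).1 * h1'
  · simp [det]; linear_combination (P.vertex (i + 1)).2 * h1'

/-- The corner after side `i` is vertex `i + 1`, whence the shift of the index in the labelling of
particles. -/
theorem isFront_zero : IsFront P.support P.sideDirs P.nextDir P.prevDir
    (fun e => P.initialParticle (P.sideIndex e + 1)) (P.stage 0) where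
  fan := isFan_sideDirs hP
  pos f hf := by
    obtain ⟨i, rfl⟩ := mem_sideDirs.1 hf
    have h1 := (isFan_sideDirs hP).corner_sub_corner_pred P.support hf 0
    obtain ⟨hu, a, ha, hx⟩ := isPrimDir_sideDir hP i
    rw [prevDir_sideDir hP, corner_support hP, corner_support hP, sub_add_cancel, hx] at h1
    have := smul_left_injective ℝ hu.toPlane_ne_zero h1
    exact lt_of_lt_of_eq ha this
  alive p := by
    simp only [stage, Finset.mem_image, Finset.mem_univ, true_and]
    constructor
    · rintro ⟨i, rfl⟩
      refine ⟨P.sideDir (i - 1), mem_sideDirs.2 ⟨_, rfl⟩, ?_⟩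
      rw [sideIndex_sideDir hP, sub_add_cancel]
    · rintro ⟨e, -, rfl⟩
      exact ⟨_, rfl⟩
  posAt e he t := by
    obtain ⟨i, rfl⟩ := mem_sideDirs.1 he
    have h1 := primDir_eq (isPrimDir_neg_sideDir hP (i + 1))
    rw [corner_eq_add _ _ _ 0, corner_support hP, nextDir_sideDir hP, sideIndex_sideDir hP]
    rw [Particle.posAt, initialParticle, h1, add_sub_cancel_right, sideDir, sub_eq_add_neg]
    rfl
  vel e he := by
    obtain ⟨i, rfl⟩ := mem_sideDirs.1 he
    have h1 := primDir_eq (isPrimDir_neg_sideDir hP (i + 1))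
    rw [nextDir_sideDir hP, sideIndex_sideDir hP, initialParticle, h1, add_sub_cancel_right,
      sub_eq_add_neg]
    rfl
  mass _ _ := rfl
  time_le _ _ := le_rfl

omit hP in
theorem exists_vertex_eq_of_mem_stage_zero {p : Particle} (hp : p ∈ (P.stage 0).alive) :
    p.posAt 0 ∈ Set.range P.vertex := by
  simp only [stage, Finset.mem_image, Finset.mem_univ, true_and] at hp
  obtain ⟨i, rfl⟩ := hp
  exact ⟨i, by simp [Particle.posAt, initialParticle]⟩

end ConvexPolygon

/-! ### The history of the process -/

/-- Three consecutive directions are distinct by their determinants. Having three particles excludes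
that a point of total collapse looks like a line. -/
theorem IsFront.exists_three {c : Lattice → ℝ} {E : Finset Lattice} {σ π : Lattice → Lattice}
    {pt : Lattice → Particle} {S : Stage} (F : IsFront c E σ π pt S) :
    ∃ p ∈ S.alive, ∃ q ∈ S.alive, ∃ r ∈ S.alive, p ≠ q ∧ p ≠ r ∧ q ≠ r := by
  obtain ⟨e, he⟩ := F.fan.nonempty
  have h1 := F.fan.succ_mem e he
  have h2 := F.fan.succ_mem _ h1
  have h3 := F.fan.det_succ e he
  have h4 := F.fan.det_succ _ h1
  refine ⟨pt e, (F.alive _).2 ⟨e, he, rfl⟩, pt (σ e), (F.alive _).2 ⟨_, h1, rfl⟩, pt (σ (σ e)),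
    (F.alive _).2 ⟨_, h2, rfl⟩, fun h => ?_, fun h => ?_, fun h => ?_⟩
  · rw [← F.pt_inj he h1 h, latDet_self] at h3
    exact absurd h3 (by norm_num)
  · rw [← F.pt_inj he h2 h, latDet_swap] at h4
    linarith
  · rw [← F.pt_inj h1 h2 h, latDet_self] at h4
    exact absurd h4 (by norm_num)

/-! ### The last flight: two particles of mass two on a segment -/

namespace Stage.IsFlattening

variable {S : Stage} {A : Plane} {e : Lattice} {l : ℝ} (h : S.IsFlattening A e l)
include h

/-- The particles approach each other with relative velocity `2e` and start at distance `l`. -/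
theorem posAt_eq_iff {t : ℝ} :
    (⟨S.next.time, A, -e, 2⟩ : Particle).posAt t =
      (⟨S.next.time, A - l • toPlane e, e, 2⟩ : Particle).posAt t ↔ t = S.next.time + l / 2 := by
  have h1 : (⟨S.next.time, A - l • toPlane e, e, 2⟩ : Particle).posAt t -
      (⟨S.next.time, A, -e, 2⟩ : Particle).posAt t =
      (2 * (t - S.next.time) - l) • toPlane e := by
    simp only [Particle.posAt, toPlane_neg]
    module
  rw [eq_comm, ← sub_eq_zero, h1, smul_eq_zero, or_iff_left h.primitive.toPlane_ne_zero]
  constructor <;> intro h2 <;> linarith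

theorem particle_ne : (⟨S.next.time, A, -e, 2⟩ : Particle) ≠
    ⟨S.next.time, A - l • toPlane e, e, 2⟩ := by
  intro h1
  have h2 := h.posAt_eq_iff (t := S.next.time)
  rw [h1] at h2
  have := h2.1 rfl
  linarith [h.pos]

omit h in
theorem posAt_mid : (⟨S.next.time, A, -e, 2⟩ : Particle).posAt (S.next.time + l / 2) =
    A - (l / 2) • toPlane e := by
  simp only [Particle.posAt, toPlane_neg]
  module

theorem isLeast_next : IsLeast S.next.meetingTimes (S.next.time + l / 2) := by
  constructor
  · exact ⟨by linarith [h.pos], _, (h.alive _).2 (.inl rfl), _, (h.alive _).2 (.inr rfl),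
      h.particle_ne, h.posAt_eq_iff.2 rfl⟩
  · rintro t ⟨-, p, hp, q, hq, hne, hpq⟩
    rcases (h.alive _).1 hp with rfl | rfl <;> rcases (h.alive _).1 hq with rfl | rfl
    · exact absurd rfl hne
    · exact (h.posAt_eq_iff.1 hpq).ge
    · exact (h.posAt_eq_iff.1 hpq.symm).ge
    · exact absurd rfl hne

theorem isFree_next : S.next.IsFree where
  nonempty := ⟨_, h.isLeast_next.1⟩
  lt := by
    rw [Stage.next_time h.isLeast_next]
    linarith [h.pos]
  inj := by
    rw [Stage.next_time h.isLeast_next]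
    intro p hp q hq t _ htT hpq
    rcases (h.alive _).1 hp with rfl | rfl <;> rcases (h.alive _).1 hq with rfl | rfl
    · rfl
    · exact absurd (h.posAt_eq_iff.1 hpq) htT.ne
    · exact absurd (h.posAt_eq_iff.1 hpq.symm) htT.ne
    · rfl
  primitive p hp := by
    rcases (h.alive _).1 hp with rfl | rfl
    exacts [h.primitive.neg, h.primitive]
  time_le p hp := by
    rcases (h.alive _).1 hp with rfl | rfl <;> exact le_rfl

theorem isVanishing_next : S.next.IsVanishing (A - (l / 2) • toPlane e) := by
  classical
  have hL := h.isLeast_next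
  have h2 := h.posAt_eq_iff.2 rfl
  rw [posAt_mid] at h2
  have hpos : ∀ p ∈ S.next.alive,
      p.posAt (S.next.time + l / 2) = A - (l / 2) • toPlane e := by
    intro p hp
    rcases (h.alive _).1 hp with rfl | rfl
    exacts [posAt_mid, h2.symm]
  have hc : ∀ y, y ∈ S.next.collisionPoints ↔ y = A - (l / 2) • toPlane e := by
    intro y
    rw [Stage.mem_collisionPoints hL]
    constructor
    · rintro ⟨p, hp, -, -, -, hpy, -⟩
      rw [← hpy, hpos p hp]
    · rintro rfl
      exact ⟨_, (h.alive _).2 (.inl rfl), _, (h.alive _).2 (.inr rfl), h.particle_ne,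
        posAt_mid, h2.symm⟩
  have hm : S.next.momentumAt (A - (l / 2) • toPlane e) = 0 := by
    have : S.next.groupAt (A - (l / 2) • toPlane e) =
        {⟨S.next.time, A, -e, 2⟩, ⟨S.next.time, A - l • toPlane e, e, 2⟩} := by
      ext p
      rw [Stage.mem_groupAt hL, Finset.mem_insert, Finset.mem_singleton, ← h.alive]
      exact ⟨fun hp => hp.1, fun hp => ⟨hp, hpos p hp⟩⟩
    rw [Stage.momentumAt, this, Finset.sum_pair h.particle_ne]
    simp [Particle.momentum]
  refine ⟨by rwa [Stage.next_time hL], ?_, hc, hm⟩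
  refine Finset.eq_empty_of_forall_notMem fun p hp => ?_
  rcases (Stage.mem_next_alive hL).1 hp with ⟨hp, hpc⟩ | ⟨y, hy, hy0, -⟩
  · rw [hpos p hp, hc] at hpc
    exact hpc rfl
  · rw [(hc y).1 hy] at hy0
    exact hy0 hm

end Stage.IsFlattening

namespace ConvexPolygon

variable {P : ConvexPolygon}

/-- Up to the stage `K` the particles are the vertices of a polygon, and its vanishing sides are
isolated. -/
structure History (P : ConvexPolygon) (D : Plane → ℝ → Prop) (K : ℕ) : Prop where
  unique : ∀ y t t', D y t → D y t' → t = t'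
  free : ∀ k ≤ K, (P.stage k).IsFree
  mass : ∀ k ≤ K, ∀ p ∈ (P.stage k).alive, p.mass = 1
  depth : ∀ k ≤ K, ∀ p ∈ (P.stage k).alive, ∀ t, (P.stage k).time ≤ t →
    t ≤ (P.stage (k + 1)).time → D (p.posAt t) t
  regular : ∀ k < K, (P.stage k).IsRegular
  three : ∃ p ∈ (P.stage K).alive, ∃ q ∈ (P.stage K).alive, ∃ r ∈ (P.stage K).alive,
    p ≠ q ∧ p ≠ r ∧ q ≠ r

theorem exists_history (hP : P.IsDelzant) : ∃ D K, History P D K ∧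
    ((∃ x, (P.stage K).IsVanishing x) ∨
      ∃ A e l, (P.stage K).IsFlattening A e l ∧
        ∀ s, 0 ≤ s → s ≤ l → D (A - s • toPlane e) (P.stage (K + 1)).time) := by
  -- The invariant: the stage is a front with enough sides to measure depth, and every earlier event
  -- has removed at least one side.
  set R : ℕ → Prop := fun k => ∃ E σ π pt, IsFront P.support E σ π pt (P.stage k) ∧
    IsSufficient P.support P.sideDirs E (P.stage k).time ∧ E.card + k ≤ P.sideDirs.card ∧
    ∀ j < k, (P.stage j).IsRegular with hR
  have h0 : R 0 := ⟨_, _, _, _, isFront_zero hP,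
    ⟨subset_rfl, fun _ _ _ hy => hy⟩, le_rfl, fun j hj => absurd hj (Nat.not_lt_zero j)⟩
  have hex : ∃ k, ¬ R (k + 1) := by
    refine ⟨P.sideDirs.card, ?_⟩
    rintro ⟨E, _, _, _, F, -, hcard, -⟩
    omega
  classical
  -- The first stage whose event is not regular: the side count forces the invariant to fail at some
  -- stage, while it holds up to `K`.
  set K := Nat.find hex with hK
  have hnot : ¬ R (K + 1) := Nat.find_spec hex
  have hle : ∀ k ≤ K, R k := by
    intro k hk
    rcases k with _ | k
    · exact h0
    · by_contra h
      exact Nat.find_min hex (Nat.lt_of_succ_le hk) h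
  refine ⟨HasDepth P.support P.sideDirs, K, ⟨fun y t t' => HasDepth.unique, ?_, ?_, ?_, ?_, ?_⟩, ?_⟩
  · intro k hk
    obtain ⟨E, σ, π, pt, F, -⟩ := hle k hk
    obtain ⟨T, ev⟩ := F.exists_isEvent
    exact F.isFree ev
  · intro k hk p hp
    obtain ⟨E, σ, π, pt, F, -⟩ := hle k hk
    obtain ⟨e, he, rfl⟩ := (F.alive p).1 hp
    exact F.mass e he
  · intro k hk p hp t ht htT
    obtain ⟨E, σ, π, pt, F, hE, -⟩ := hle k hk
    obtain ⟨T, ev⟩ := F.exists_isEvent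
    rw [stage, Stage.next_time (F.isLeast ev)] at htT
    exact F.hasDepth ev hE hp ht htT
  · obtain ⟨_, _, _, _, _, _, _, h⟩ := hle K le_rfl
    exact h
  · obtain ⟨_, _, _, _, F, -⟩ := hle K le_rfl
    exact F.exists_three
  · obtain ⟨E, σ, π, pt, F, hE, hcard, hj⟩ := hle K le_rfl
    obtain ⟨T, ev⟩ := F.exists_isEvent
    have hL := F.isLeast ev
    rcases ev.trichotomy F.fan with hreg | ⟨x, hx⟩ | ⟨e, hfl, hne⟩
    · exfalso
      apply hnot
      obtain ⟨pt', F'⟩ := F.exists_next ev hreg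
      refine ⟨_, _, _, _, F', ?_, ?_, ?_⟩
      · rw [stage, Stage.next_time hL]
        exact hE.survivors ev F.fan hreg
      · have := ev.survivors_card_lt
        omega
      · intro j hjK
        rcases Nat.lt_succ_iff_lt_or_eq.1 hjK with h | h
        · exact hj j h
        · rw [h]
          exact F.isRegular ev hreg
    · exact .inl ⟨x, F.isVanishing ev hx⟩
    · obtain ⟨A, l, h1, h2⟩ := F.exists_isFlattening ev hfl hne hE
      exact .inr ⟨A, e, l, h1, h2⟩

end ConvexPolygon

/-! ### Local structure of the curve -/

theorem Stage.next_eq_self {S : Stage} (h : S.alive = ∅) : S.next = S := by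
  have : ¬ S.meetingTimes.Nonempty := by
    rintro ⟨t, -, p, hp, -⟩
    rw [h] at hp
    exact absurd hp (Finset.notMem_empty p)
  rw [Stage.next, if_neg this]

/-- Near one of its points a segment coincides with a union of rays. -/
theorem eventually_mem_segment_iff (x : Plane) {v : Plane} (hv : v ≠ 0) {α β : ℝ} (hα : α ≤ 0)
    (hβ : 0 ≤ β) (hαβ : α < β) :
    ∀ᶠ y in 𝓝 x, (∃ s, α ≤ s ∧ s ≤ β ∧ y = x + s • v) ↔
      ∃ s : ℝ, 0 ≤ s ∧ ((0 < β ∧ y = x + s • v) ∨ (α < 0 ∧ y = x + s • (-v))) := by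
  have hv' : 0 < ‖v‖ := norm_pos_iff.2 hv
  have hnear : ∀ ε : ℝ, 0 < ε → ∀ᶠ y in 𝓝 x, ∀ s : ℝ, 0 ≤ s →
      (y = x + s • v ∨ y = x + s • (-v)) → s ≤ ε := by
    intro ε hε
    filter_upwards [Metric.ball_mem_nhds x (mul_pos hε hv')] with y hy s hs h
    rw [Metric.mem_ball, dist_eq_norm] at hy
    have h1 : ‖y - x‖ = s * ‖v‖ := by
      rcases h with rfl | rfl
      · rw [add_sub_cancel_left, norm_smul, Real.norm_of_nonneg hs]
      · rw [add_sub_cancel_left, norm_smul, Real.norm_of_nonneg hs, norm_neg]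
    rw [h1] at hy
    exact (lt_of_mul_lt_mul_right hy hv'.le).le
  have hb : ∀ᶠ y in 𝓝 x, 0 < β → ∀ s : ℝ, 0 ≤ s → y = x + s • v → s ≤ β := by
    rcases hβ.lt_or_eq with h | h
    · filter_upwards [hnear β h] with y hy _ s hs hys using hy s hs (.inl hys)
    · exact Eventually.of_forall fun y h' => absurd h' (by rw [← h]; exact lt_irrefl _)
  have ha : ∀ᶠ y in 𝓝 x, α < 0 → ∀ s : ℝ, 0 ≤ s → y = x + s • (-v) → s ≤ -α := by
    rcases hα.lt_or_eq with h | h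
    · filter_upwards [hnear (-α) (neg_pos.2 h)] with y hy _ s hs hys using hy s hs (.inr hys)
    · exact Eventually.of_forall fun y h' => absurd h' (by rw [h]; exact lt_irrefl _)
  filter_upwards [ha, hb] with y ha hb
  constructor
  · rintro ⟨s, h1, h2, rfl⟩
    rcases lt_trichotomy s 0 with h | rfl | h
    · exact ⟨-s, by linarith, .inr ⟨by linarith, by simp⟩⟩
    · refine ⟨0, le_rfl, ?_⟩
      rcases hβ.lt_or_eq with h | h
      · exact .inl ⟨h, rfl⟩
      · exact .inr ⟨by linarith, by simp⟩
    · exact ⟨s, h.le, .inl ⟨by linarith, rfl⟩⟩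
  · rintro ⟨s, hs, ⟨h1, h2⟩ | ⟨h1, h2⟩⟩
    · exact ⟨s, by linarith, hb h1 s hs h2, h2⟩
    · have := ha h1 s hs h2
      exact ⟨-s, by linarith, by linarith, by rw [h2]; simp⟩

namespace ConvexPolygon

variable {P : ConvexPolygon} {N : ℕ}

/-- The process ends at the stage `N`, and no point is visited at two different times. -/
structure IsTame (P : ConvexPolygon) (N : ℕ) : Prop where
  free : ∀ k < N, (P.stage k).IsFree
  alive : (P.stage N).alive = ∅
  unique : ∀ x t t', P.IsVisitedAt x t → P.IsVisitedAt x t' → t = t'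

theorem time_lt (free : ∀ k < N, (P.stage k).IsFree) {i j : ℕ} (hij : i < j) (hj : j ≤ N) :
    (P.stage i).time < (P.stage j).time := by
  induction j, hij using Nat.le_induction with
  | base => exact (free i hj).lt
  | succ j _ ih => exact (ih (Nat.le_of_succ_le hj)).trans (free j hj).lt

theorem time_le (free : ∀ k < N, (P.stage k).IsFree) {i j : ℕ} (hij : i ≤ j) (hj : j ≤ N) :
    (P.stage i).time ≤ (P.stage j).time := by
  rcases hij.lt_or_eq with h | rfl
  exacts [(time_lt free h hj).le, le_rfl]

theorem stage_eq_of_le (alive : (P.stage N).alive = ∅) {k : ℕ} (hk : N ≤ k) :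
    P.stage k = P.stage N := by
  induction k, hk using Nat.le_induction with
  | base => rfl
  | succ k _ ih => rw [stage, ih, Stage.next_eq_self alive]

theorem lt_of_mem_alive (alive : (P.stage N).alive = ∅) {k : ℕ} {p : Particle}
    (hp : p ∈ (P.stage k).alive) : k < N := by
  by_contra h
  rw [stage_eq_of_le alive (not_lt.1 h), alive] at hp
  exact absurd hp (Finset.notMem_empty p)

/-- Descend through the stages until one begins no later than `t`, at the latest at the birth of the
particle; then ascend to the interval between collisions that contains `t`. -/
theorem exists_stage_of_mem_lifetime (alive : (P.stage N).alive = ∅) {p : Particle}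
    (hp : p ∈ P.particles) {t : ℝ} (ht : t ∈ P.lifetime p) :
    ∃ k < N, p ∈ (P.stage k).alive ∧ (P.stage k).time ≤ t ∧ t ≤ (P.stage (k + 1)).time := by
  classical
  obtain ⟨j, hj⟩ := hp
  have hdown : ∀ j, p ∈ (P.stage j).alive → ∃ i, p ∈ (P.stage i).alive ∧ (P.stage i).time ≤ t := by
    intro j
    induction j with
    | zero =>
      intro hj
      refine ⟨0, hj, ?_⟩
      have h1 : p.time = 0 := by
        simp only [stage, Finset.mem_image] at hj
        obtain ⟨i, -, rfl⟩ := hj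
        rfl
      have h2 := ht.1
      rwa [h1] at h2
    | succ j ih =>
      intro hj
      by_cases hj' : p ∈ (P.stage j).alive
      · exact ih hj'
      · refine ⟨j + 1, hj, ?_⟩
        rw [stage, ← Stage.time_eq_of_mem_next hj hj']
        exact ht.1
  have hup : ∀ m i, N - i ≤ m → p ∈ (P.stage i).alive → (P.stage i).time ≤ t →
      ∃ k < N, p ∈ (P.stage k).alive ∧ (P.stage k).time ≤ t ∧ t ≤ (P.stage (k + 1)).time := by
    intro m
    induction m with
    | zero =>
      intro i hi hpi _
      have := lt_of_mem_alive alive hpi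
      omega
    | succ m ih =>
      intro i hi hpi hti
      have hiN := lt_of_mem_alive alive hpi
      by_cases hn : t ≤ (P.stage (i + 1)).time
      · exact ⟨i, hiN, hpi, hti, hn⟩
      by_cases hpi' : p ∈ (P.stage (i + 1)).alive
      · exact ih (i + 1) (by omega) hpi' (not_le.1 hn).le
      · exact absurd (ht.2 i hpi hpi') hn
  obtain ⟨i, hi, hti⟩ := hdown j hj
  exact hup _ i le_rfl hi hti

/-- A particle removed before stage `k` would have to be emitted again, with an emission time later
than the one it carries. -/
theorem mem_lifetime (free : ∀ k < N, (P.stage k).IsFree) (alive : (P.stage N).alive = ∅)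
    {p : Particle} {k : ℕ} (hp : p ∈ (P.stage k).alive) {t : ℝ} (h1 : (P.stage k).time ≤ t)
    (h2 : t ≤ (P.stage (k + 1)).time) : t ∈ P.lifetime p := by
  have hk := lt_of_mem_alive alive hp
  refine ⟨((free k hk).time_le p hp).trans h1, fun j hj hj' => ?_⟩
  have hjN := lt_of_mem_alive alive hj
  rcases le_or_gt k j with hkj | hkj
  · exact h2.trans (time_le free (by omega) hjN)
  · exfalso
    have key : ∀ i, j + 1 ≤ i → i ≤ k → p ∉ (P.stage i).alive := by
      intro i hji
      induction i, hji using Nat.le_induction with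
      | base => exact fun _ => hj'
      | succ i hji ih =>
        intro hik hpi
        have h3 := Stage.time_eq_of_mem_next hpi (ih (by omega))
        have h4 := (free j hjN).time_le p hj
        have h5 : (P.stage j).time < (P.stage (i + 1)).time := time_lt free (by omega) (by omega)
        rw [stage] at h5
        linarith
    exact key k hkj le_rfl hp

theorem isVisitedAt_iff (free : ∀ k < N, (P.stage k).IsFree) (alive : (P.stage N).alive = ∅)
    {x : Plane} {t : ℝ} : P.IsVisitedAt x t ↔ ∃ k < N, ∃ p ∈ (P.stage k).alive,
      (P.stage k).time ≤ t ∧ t ≤ (P.stage (k + 1)).time ∧ p.posAt t = x := by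
  constructor
  · rintro ⟨p, hp, ht, hx⟩
    obtain ⟨k, hk, hpk, h1, h2⟩ := exists_stage_of_mem_lifetime alive hp ht
    exact ⟨k, hk, p, hpk, h1, h2, hx⟩
  · rintro ⟨k, -, p, hp, h1, h2, hx⟩
    exact ⟨p, ⟨k, hp⟩, mem_lifetime free alive hp h1 h2, hx⟩

theorem mem_curve_iff {x : Plane} : x ∈ P.curve ↔ ∃ t, P.IsVisitedAt x t := by
  simp only [curve, trajectory, Set.mem_iUnion, Set.mem_image, IsVisitedAt]
  constructor
  · rintro ⟨p, hp, t, ht, hx⟩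
    exact ⟨t, p, hp, ht, hx⟩
  · rintro ⟨t, p, hp, ht, hx⟩
    exact ⟨p, hp, t, ht, hx⟩

/-- The particle `p`, which exists after the stage `k`, traces a ray of direction `u` which comes
out of `x`, where it is at the time `t`. -/
def IsRay (P : ConvexPolygon) (x : Plane) (t : ℝ) (k : ℕ) (p : Particle) (u : Lattice) : Prop :=
  p ∈ (P.stage k).alive ∧ p.posAt t = x ∧
    (((P.stage k).time ≤ t ∧ t < (P.stage (k + 1)).time ∧ u = p.vel) ∨
      ((P.stage k).time < t ∧ t ≤ (P.stage (k + 1)).time ∧ u = -p.vel))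

/-- The directions of the rays which come out of `x`. -/
def rays (P : ConvexPolygon) (x : Plane) (t : ℝ) : Set Lattice := {u | ∃ k p, P.IsRay x t k p u}

/-! ### The curve near a visited point -/

namespace IsTame

variable (hN : P.IsTame N) {x : Plane} {t : ℝ} (hx : P.IsVisitedAt x t)
include hN

theorem primitive {p : Particle} {k : ℕ} (hp : p ∈ (P.stage k).alive) : IsPrimitive p.vel :=
  (hN.free k (lt_of_mem_alive hN.alive hp)).primitive p hp

theorem isVisitedAt {p : Particle} {k : ℕ} (hp : p ∈ (P.stage k).alive)
    (h1 : (P.stage k).time ≤ t) (h2 : t ≤ (P.stage (k + 1)).time) :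
    P.IsVisitedAt (p.posAt t) t :=
  ⟨p, ⟨k, hp⟩, mem_lifetime hN.free hN.alive hp h1 h2, rfl⟩

theorem primitive_of_mem_rays {u : Lattice} (hu : u ∈ P.rays x t) : IsPrimitive u := by
  obtain ⟨k, p, hp, -, ⟨-, -, rfl⟩ | ⟨-, -, rfl⟩⟩ := hu
  exacts [hN.primitive hp, (hN.primitive hp).neg]

include hx

/-- The curve is a finite union of compact segments, one for each particle and stage. Those through
`x` pass it at time `t` by uniqueness and look like rays; the others miss a neighbourhood of `x`. -/
theorem eventually_mem_curve_iff : ∀ᶠ y in 𝓝 x,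
    y ∈ P.curve ↔ ∃ u ∈ P.rays x t, ∃ s : ℝ, 0 ≤ s ∧ y = x + s • toPlane u := by
  have hpiece : ∀ k ∈ Finset.range N, ∀ p ∈ (P.stage k).alive, ∀ᶠ y in 𝓝 x,
      (∃ t', (P.stage k).time ≤ t' ∧ t' ≤ (P.stage (k + 1)).time ∧ p.posAt t' = y) ↔
      ∃ u, P.IsRay x t k p u ∧ ∃ s : ℝ, 0 ≤ s ∧ y = x + s • toPlane u := by
    intro k hk p hp
    by_cases hon : ∃ t', (P.stage k).time ≤ t' ∧ t' ≤ (P.stage (k + 1)).time ∧ p.posAt t' = x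
    · obtain ⟨t', h1, h2, rfl⟩ := hon
      obtain rfl := hN.unique _ _ _ (hN.isVisitedAt hp h1 h2) hx
      have hlt : (P.stage k).time < (P.stage (k + 1)).time :=
        (hN.free k (Finset.mem_range.1 hk)).lt
      filter_upwards [eventually_mem_segment_iff (p.posAt t') (hN.primitive hp).toPlane_ne_zero
        (sub_nonpos.2 h1) (sub_nonneg.2 h2) (sub_lt_sub_right hlt t')] with y hy
      have hl : (∃ r, (P.stage k).time ≤ r ∧ r ≤ (P.stage (k + 1)).time ∧ p.posAt r = y) ↔
          ∃ s, (P.stage k).time - t' ≤ s ∧ s ≤ (P.stage (k + 1)).time - t' ∧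
            y = p.posAt t' + s • toPlane p.vel := by
        constructor
        · rintro ⟨r, h3, h4, rfl⟩
          exact ⟨r - t', by linarith, by linarith, p.posAt_eq_add t' r⟩
        · rintro ⟨s, h3, h4, rfl⟩
          refine ⟨t' + s, by linarith, by linarith, ?_⟩
          rw [p.posAt_eq_add t', add_sub_cancel_left]
      rw [hl, hy]
      constructor
      · rintro ⟨s, hs, ⟨h3, h4⟩ | ⟨h3, h4⟩⟩
        · exact ⟨p.vel, ⟨hp, rfl, .inl ⟨h1, by linarith, rfl⟩⟩, s, hs, h4⟩
        · refine ⟨-p.vel, ⟨hp, rfl, .inr ⟨by linarith, h2, rfl⟩⟩, s, hs, ?_⟩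
          rw [h4, toPlane_neg]
      · rintro ⟨u, ⟨-, -, ⟨h3, h4, rfl⟩ | ⟨h3, h4, rfl⟩⟩, s, hs, h5⟩
        · exact ⟨s, hs, .inl ⟨by linarith, h5⟩⟩
        · exact ⟨s, hs, .inr ⟨by linarith, by rw [h5, toPlane_neg]⟩⟩
    · have hcl : IsClosed (p.posAt '' Set.Icc (P.stage k).time (P.stage (k + 1)).time) := by
        refine (isCompact_Icc.image ?_).isClosed
        unfold Particle.posAt
        fun_prop
      have hmem : x ∈ (p.posAt '' Set.Icc (P.stage k).time (P.stage (k + 1)).time)ᶜ := by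
        rintro ⟨t', ht', h3⟩
        exact hon ⟨t', ht'.1, ht'.2, h3⟩
      filter_upwards [hcl.isOpen_compl.mem_nhds hmem] with y hy
      constructor
      · rintro ⟨t', h1, h2, h3⟩
        exact absurd ⟨t', ⟨h1, h2⟩, h3⟩ hy
      · rintro ⟨u, ⟨-, h3, h | h⟩, -⟩
        · exact absurd ⟨t, h.1, h.2.1.le, h3⟩ hon
        · exact absurd ⟨t, h.1.le, h.2.1, h3⟩ hon
  have hall : ∀ᶠ y in 𝓝 x, ∀ k ∈ Finset.range N, ∀ p ∈ (P.stage k).alive,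
      ((∃ t', (P.stage k).time ≤ t' ∧ t' ≤ (P.stage (k + 1)).time ∧ p.posAt t' = y) ↔
      ∃ u, P.IsRay x t k p u ∧ ∃ s : ℝ, 0 ≤ s ∧ y = x + s • toPlane u) := by
    rw [eventually_all_finset]
    intro k hk
    rw [eventually_all_finset]
    exact hpiece k hk
  filter_upwards [hall] with y hy
  rw [mem_curve_iff]
  constructor
  · rintro ⟨t', ht'⟩
    obtain ⟨k, hk, p, hp, h1, h2, h3⟩ := (isVisitedAt_iff hN.free hN.alive).1 ht'
    obtain ⟨u, hu, s, hs, h4⟩ := (hy k (Finset.mem_range.2 hk) p hp).1 ⟨t', h1, h2, h3⟩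
    exact ⟨u, ⟨k, p, hu⟩, s, hs, h4⟩
  · rintro ⟨u, ⟨k, p, hu⟩, s, hs, h4⟩
    have hk := lt_of_mem_alive hN.alive hu.1
    obtain ⟨t', h1, h2, h3⟩ := (hy k (Finset.mem_range.2 hk) p hu.1).2 ⟨u, hu, s, hs, h4⟩
    exact ⟨t', h3 ▸ hN.isVisitedAt hu.1 h1 h2⟩

omit hN hx in
theorem tendsto_ray (x v : Plane) : Tendsto (fun s : ℝ => x + s • v) (𝓝[>] 0) (𝓝 x) := by
  have : ContinuousAt (fun s : ℝ => x + s • v) 0 := by fun_prop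
  have h := this.tendsto
  simp only [zero_smul, add_zero] at h
  exact h.mono_left nhdsWithin_le_nhds

theorem directions_eq : P.directions x = P.rays x t := by
  ext u
  constructor
  · rintro ⟨hu, hev⟩
    have h1 := (tendsto_ray x (toPlane u)).eventually (hN.eventually_mem_curve_iff hx)
    obtain ⟨s, ⟨hs1, hs2⟩, hs3⟩ := ((hev.and h1).and self_mem_nhdsWithin).exists
    obtain ⟨w, hw, s', hs', heq⟩ := hs2.1 hs1
    have := hu.eq_of_smul_eq (hN.primitive_of_mem_rays hw) hs3 hs' (add_left_cancel heq)
    rwa [← this]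
  · intro hu
    refine ⟨hN.primitive_of_mem_rays hu, ?_⟩
    filter_upwards [(tendsto_ray x (toPlane u)).eventually (hN.eventually_mem_curve_iff hx),
      self_mem_nhdsWithin] with s hs hs0
    exact hs.2 ⟨u, hu, s, le_of_lt hs0, rfl⟩

/-- Near a point that is not a vertex the curve is a line, so all rays are parallel to it. Two
transverse rays therefore detect a vertex. -/
theorem latDet_eq_zero_of_not_isVertex (hv : ¬ P.IsVertex x) {u w : Lattice}
    (hu : u ∈ P.rays x t) (hw : w ∈ P.rays x t) : latDet u w = 0 := by
  rw [IsVertex, not_and, not_not] at hv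
  obtain ⟨d, hd, hev⟩ := hv (mem_curve_iff.2 ⟨t, hx⟩)
  have key : ∀ u ∈ P.rays x t, ∃ a : ℝ, toPlane u = a • d := by
    intro u hu
    rw [← hN.directions_eq hx] at hu
    obtain ⟨s, ⟨hs1, hs2⟩, hs3⟩ := ((hu.2.and ((tendsto_ray x (toPlane u)).eventually hev)).and
      self_mem_nhdsWithin).exists
    obtain ⟨a, ha⟩ := hs2.1 hs1
    refine ⟨s⁻¹ * a, ?_⟩
    rw [mul_smul, ← add_left_cancel ha, inv_smul_smul₀ (ne_of_gt hs3)]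
  obtain ⟨a, ha⟩ := key u hu
  obtain ⟨b, hb⟩ := key w hw
  have : (latDet u w : ℝ) = 0 := by
    rw [← det_toPlane, ha, hb]
    simp [det]; ring
  exact_mod_cast this

theorem not_isVertex {u : Lattice} (hu : P.rays x t = {u, -u}) : ¬ P.IsVertex x := by
  rintro ⟨-, h⟩
  have hpr : IsPrimitive u := hN.primitive_of_mem_rays (x := x) (t := t) (by rw [hu]; simp)
  refine h ⟨toPlane u, hpr.toPlane_ne_zero, ?_⟩
  filter_upwards [hN.eventually_mem_curve_iff hx] with y hy
  rw [hy, hu]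
  constructor
  · rintro ⟨w, rfl | rfl, s, -, h1⟩
    · exact ⟨s, h1⟩
    · exact ⟨-s, by rw [h1, toPlane_neg]; simp⟩
  · rintro ⟨s, h1⟩
    rcases le_total 0 s with hs | hs
    · exact ⟨u, by simp, s, hs, h1⟩
    · exact ⟨-u, by simp, -s, by linarith, by rw [h1, toPlane_neg]; simp⟩

omit hN hx in
theorem weightAt_eq {p : Particle} (hp : p ∈ P.particles) (hpx : x ∈ P.trajectory p)
    (h : ∀ q ∈ P.particles, x ∈ P.trajectory q → q = p) : P.weightAt x = p.mass := by
  have : {q | q ∈ P.particles ∧ x ∈ P.trajectory q} = {p} := by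
    ext q
    constructor
    · exact fun hq => h q hq.1 hq.2
    · rintro rfl
      exact ⟨hp, hpx⟩
  rw [weightAt, this, finsum_mem_singleton]

theorem weightAt_eq_of_unique {p : Particle} {k : ℕ} (hp : p ∈ (P.stage k).alive)
    (h1 : (P.stage k).time ≤ t) (h2 : t ≤ (P.stage (k + 1)).time) (hpx : p.posAt t = x)
    (h : ∀ j < N, ∀ q ∈ (P.stage j).alive, (P.stage j).time ≤ t → t ≤ (P.stage (j + 1)).time →
      q.posAt t = x → q = p) : P.weightAt x = p.mass := by
  refine weightAt_eq ⟨k, hp⟩ ⟨t, mem_lifetime hN.free hN.alive hp h1 h2, hpx⟩ ?_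
  rintro q hq ⟨t', ht', hqx⟩
  obtain rfl := hN.unique _ _ _ ⟨q, hq, ht', hqx⟩ hx
  obtain ⟨j, hj, hqj, h3, h4⟩ := exists_stage_of_mem_lifetime hN.alive hq ht'
  exact h j hj q hqj h3 h4 hqx

omit hx

theorem eq_of_mem_Ioo {k j : ℕ} (hk : k < N) (hj : j < N) (h1 : (P.stage k).time < t)
    (h2 : t < (P.stage (k + 1)).time) (h3 : (P.stage j).time ≤ t)
    (h4 : t ≤ (P.stage (j + 1)).time) : j = k := by
  rcases lt_trichotomy j k with h | h | h
  · have := time_le hN.free (Nat.succ_le_of_lt h) hk.le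
    rw [Nat.succ_eq_add_one] at this
    linarith
  · exact h
  · have := time_le hN.free (Nat.succ_le_of_lt h) hj.le
    rw [Nat.succ_eq_add_one] at this
    linarith

theorem eq_or_eq_of_eq {k j : ℕ} (hk : k < N) (hj : j < N) (h1 : t = (P.stage (k + 1)).time)
    (h3 : (P.stage j).time ≤ t) (h4 : t ≤ (P.stage (j + 1)).time) : j = k ∨ j = k + 1 := by
  rw [h1] at h3 h4
  rcases lt_trichotomy j k with h | h | h
  · have := time_lt hN.free (Nat.succ_lt_succ h) hk
    rw [Nat.succ_eq_add_one, Nat.succ_eq_add_one] at this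
    linarith
  · exact .inl h
  · rcases (Nat.succ_le_of_lt h).lt_or_eq with h5 | h5
    · have := time_lt hN.free h5 hj.le
      rw [Nat.succ_eq_add_one] at this
      linarith
    · exact .inr h5.symm

/-- A point visited between two collisions. -/
theorem weightAt_of_mem_Ioo {p : Particle} {k : ℕ} (hp : p ∈ (P.stage k).alive)
    (h1 : (P.stage k).time < t) (h2 : t < (P.stage (k + 1)).time) :
    P.weightAt (p.posAt t) = p.mass := by
  have hk := lt_of_mem_alive hN.alive hp
  refine hN.weightAt_eq_of_unique (hN.isVisitedAt hp h1.le h2.le) hp h1.le h2.le rfl ?_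
  intro j hj q hq h3 h4 h5
  obtain rfl := hN.eq_of_mem_Ioo hk hj h1 h2 h3 h4
  exact (hN.free j hj).inj q hq p hp t h1.le h2 h5

theorem not_isVertex_of_mem_Ioo {p : Particle} {k : ℕ} (hp : p ∈ (P.stage k).alive)
    (h1 : (P.stage k).time < t) (h2 : t < (P.stage (k + 1)).time) :
    ¬ P.IsVertex (p.posAt t) := by
  have hk := lt_of_mem_alive hN.alive hp
  refine hN.not_isVertex (u := p.vel) (hN.isVisitedAt hp h1.le h2.le) ?_
  ext u
  constructor
  · rintro ⟨j, q, hq, hqx, h3⟩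
    have hj := lt_of_mem_alive hN.alive hq
    obtain rfl : j = k := by
      rcases h3 with h3 | h3
      · exact hN.eq_of_mem_Ioo hk hj h1 h2 h3.1 h3.2.1.le
      · exact hN.eq_of_mem_Ioo hk hj h1 h2 h3.1.le h3.2.1
    obtain rfl := (hN.free j hj).inj q hq p hp t h1.le h2 hqx
    rcases h3 with h3 | h3
    · exact .inl h3.2.2
    · exact .inr h3.2.2
  · rintro (rfl | rfl)
    · exact ⟨k, p, hp, rfl, .inl ⟨h1.le, h2, rfl⟩⟩
    · exact ⟨k, p, hp, rfl, .inr ⟨h1, h2.le, rfl⟩⟩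

/-- Nearby points of the ray are visited slightly after or before `t`, strictly between collisions,
where a single particle passes. -/
theorem hasWeight_of_isRay {k : ℕ} {p : Particle} {u : Lattice} (hu : P.IsRay x t k p u) :
    P.HasWeight x u p.mass := by
  obtain ⟨hp, rfl, ⟨h1, h2, rfl⟩ | ⟨h1, h2, rfl⟩⟩ := hu
  · filter_upwards [Ioo_mem_nhdsGT (sub_pos.2 h2)] with s hs
    have := hN.weightAt_of_mem_Ioo (t := t + s) hp (by linarith [hs.1]) (by linarith [hs.2])
    rwa [p.posAt_eq_add t, add_sub_cancel_left] at this
  · filter_upwards [Ioo_mem_nhdsGT (sub_pos.2 h1)] with s hs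
    have := hN.weightAt_of_mem_Ioo (t := t - s) hp (by linarith [hs.2]) (by linarith [hs.1])
    rw [p.posAt_eq_add t, sub_sub_cancel_left, neg_smul, ← smul_neg, ← toPlane_neg] at this
    exact this

end IsTame

/-! ### Edges -/

theorem add_smul_mem_openSegment (x w : Plane) {α β γ : ℝ} (h1 : α < γ) (h2 : γ < β) :
    x + γ • w ∈ openSegment ℝ (x + α • w) (x + β • w) := by
  have h3 : 0 < β - α := by linarith
  refine ⟨(β - γ) / (β - α), (γ - α) / (β - α), div_pos (by linarith) h3,
    div_pos (by linarith) h3, ?_, ?_⟩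
  · field_simp; ring
  · have e1 : (β - γ) / (β - α) + (γ - α) / (β - α) = 1 := by field_simp; ring
    have e2 : (β - γ) / (β - α) * α + (γ - α) / (β - α) * β = γ := by field_simp; ring
    calc _ = ((β - γ) / (β - α) + (γ - α) / (β - α)) • x +
        ((β - γ) / (β - α) * α + (γ - α) / (β - α) * β) • w := by module
      _ = x + γ • w := by rw [e1, e2, one_smul]

theorem exists_of_mem_openSegment {x a b : Plane} (hx : x ∈ openSegment ℝ a b) :
    ∃ α β : ℝ, α < 0 ∧ 0 < β ∧ a = x + α • (b - a) ∧ b = x + β • (b - a) := by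
  obtain ⟨s, r, hs, hr, hsr, rfl⟩ := hx
  refine ⟨-r, s, by linarith, hs, ?_, ?_⟩
  · have : a = (s + r) • a := by rw [hsr, one_smul]
    nth_rewrite 1 [this]; module
  · have : b = (s + r) • b := by rw [hsr, one_smul]
    nth_rewrite 1 [this]; module

theorem IsEdge.symm {a b : Plane} (h : P.IsEdge a b) : P.IsEdge b a :=
  ⟨h.1.symm, h.2.2.1, h.2.1, fun x hx => h.2.2.2 x (by rwa [openSegment_symm])⟩

/-- On a common line an end of one edge is a vertex, so it cannot be an inner point of the other. -/
theorem IsEdge.param_eq {x w : Plane} {α β α' β' : ℝ} (hα : α < 0) (hβ : 0 < β) (hα' : α' < 0)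
    (hβ' : 0 < β') (h : P.IsEdge (x + α • w) (x + β • w))
    (h' : P.IsEdge (x + α' • w) (x + β' • w)) : α = α' ∧ β = β' := by
  have key : ∀ {α β γ : ℝ}, P.IsEdge (x + α • w) (x + β • w) → P.IsVertex (x + γ • w) →
      α < γ → β ≤ γ := by
    intro α β γ h hv h1
    by_contra h2
    exact (h.2.2.2 _ (add_smul_mem_openSegment x w h1 (not_le.1 h2))).2 hv
  refine ⟨le_antisymm ?_ ?_, le_antisymm ?_ ?_⟩
  · by_contra h1
    linarith [key h' h.2.1 (not_le.1 h1)]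
  · by_contra h1
    linarith [key h h'.2.1 (not_le.1 h1)]
  · exact key h h'.2.2.1 (by linarith)
  · exact key h' h.2.2.1 (by linarith)

theorem IsEdge.exists_smul_eq {x a b d : Plane} (h : P.IsEdge a b) (hx : x ∈ openSegment ℝ a b)
    (hd : ∀ᶠ y in 𝓝 x, (y ∈ P.curve ↔ ∃ s : ℝ, y = x + s • d)) : ∃ r : ℝ, b - a = r • d := by
  obtain ⟨α, β, hα, hβ, ha, hb⟩ := exists_of_mem_openSegment hx
  have h1 := (IsTame.tendsto_ray x (b - a)).eventually hd
  obtain ⟨s, hs1, hs0, hsβ⟩ := (h1.and (Ioo_mem_nhdsGT hβ)).exists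
  have h2 : x + s • (b - a) ∈ openSegment ℝ a b := by
    have := add_smul_mem_openSegment x (b - a) (hα.trans hs0) hsβ
    rwa [← ha, ← hb] at this
  obtain ⟨r, hr⟩ := hs1.1 (h.2.2.2 _ h2).1
  refine ⟨s⁻¹ * r, ?_⟩
  rw [mul_smul, ← add_left_cancel hr, inv_smul_smul₀ hs0.ne']

/-- Two edges with a common inner point coincide. -/
theorem IsEdge.eq_of_mem {x a b a' b' : Plane} (h : P.IsEdge a b) (h' : P.IsEdge a' b')
    (hx : x ∈ openSegment ℝ a b) (hx' : x ∈ openSegment ℝ a' b') : s(a', b') = s(a, b) := by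
  have hc := h.2.2.2 x hx
  rw [IsVertex, not_and, not_not] at hc
  obtain ⟨d, -, hd⟩ := hc.2 hc.1
  obtain ⟨r, hr⟩ := h.exists_smul_eq hx hd
  obtain ⟨r', hr'⟩ := h'.exists_smul_eq hx' hd
  obtain ⟨α, β, hα, hβ, ha, hb⟩ := exists_of_mem_openSegment hx
  obtain ⟨α', β', hα', hβ', ha', hb'⟩ := exists_of_mem_openSegment hx'
  have hr0 : r' ≠ 0 := by
    rintro rfl
    rw [zero_smul, sub_eq_zero] at hr'
    exact h'.1 hr'.symm
  have hr1 : r ≠ 0 := by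
    rintro rfl
    rw [zero_smul, sub_eq_zero] at hr
    exact h.1 hr.symm
  rw [hr, smul_smul] at ha hb
  rw [hr', smul_smul] at ha' hb'
  -- Rescaling to the common direction `d` may reverse an edge; the sign of the factor tells which
  -- end comes first.
  have order : ∀ {α β r : ℝ}, α < 0 → 0 < β → r ≠ 0 →
      (α * r < 0 ∧ 0 < β * r) ∨ (β * r < 0 ∧ 0 < α * r) := by
    intro α β r h1 h2 h3
    rcases h3.lt_or_gt with h | h
    · exact .inr ⟨mul_neg_of_pos_of_neg h2 h, mul_pos_of_neg_of_neg h1 h⟩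
    · exact .inl ⟨mul_neg_of_neg_of_pos h1 h, mul_pos h2 h⟩
  rw [Sym2.eq_iff]
  have hE := h
  have hE' := h'
  rw [ha, hb] at hE
  rw [ha', hb'] at hE'
  rcases order hα hβ hr1 with o | o <;> rcases order hα' hβ' hr0 with o' | o'
  · obtain ⟨e1, e2⟩ := hE.param_eq o.1 o.2 o'.1 o'.2 hE'
    exact .inl ⟨by rw [ha, ha', e1], by rw [hb, hb', e2]⟩
  · obtain ⟨e1, e2⟩ := hE.param_eq o.1 o.2 o'.1 o'.2 hE'.symm
    exact .inr ⟨by rw [ha', hb, e2], by rw [hb', ha, e1]⟩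
  · obtain ⟨e1, e2⟩ := hE.symm.param_eq o.1 o.2 o'.1 o'.2 hE'
    exact .inr ⟨by rw [ha', hb, e1], by rw [hb', ha, e2]⟩
  · obtain ⟨e1, e2⟩ := hE.symm.param_eq o.1 o.2 o'.1 o'.2 hE'.symm
    exact .inl ⟨by rw [ha, ha', e2], by rw [hb, hb', e1]⟩

end ConvexPolygon

namespace ConvexPolygon

variable {P : ConvexPolygon} {N K : ℕ} {D : Plane → ℝ → Prop}

/-! ### Smooth vertices -/

/-- The rotation by a right angle. -/
def rotate (u : Lattice) : Lattice := (-u.2, u.1)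

/-- The vertices of a triangle with a vertex at the origin and the first two sides obtained from
`a` and `b` by the rotation by a right angle. -/
def triangleVertex (a b : Lattice) : ZMod 3 → Plane :=
  (![0, toPlane (rotate a), toPlane (rotate (a + b))] : Fin 3 → Plane)

/-- The directions dual to the sides of the triangle. -/
def triangleDir (a b : Lattice) : ZMod 3 → Lattice := (![a, b, -(a + b)] : Fin 3 → Lattice)

theorem zmod_three_cases (i : ZMod 3) : i = 0 ∨ i = 1 ∨ i = 2 := by
  decide +revert

theorem triangleVertex_sub (a b : Lattice) (i : ZMod 3) :
    triangleVertex a b (i + 1) - triangleVertex a b i = toPlane (rotate (triangleDir a b i)) := by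
  rcases zmod_three_cases i with rfl | rfl | rfl
  · change toPlane (rotate a) - 0 = toPlane (rotate a)
    rw [sub_zero]
  · change toPlane (rotate (a + b)) - toPlane (rotate a) = toPlane (rotate b)
    ext <;> simp [rotate]
  · change 0 - toPlane (rotate (a + b)) = toPlane (rotate (-(a + b)))
    ext <;> simp [rotate]

theorem latDet_triangleDir {a b : Lattice} (h : latDet a b = 1) (i : ZMod 3) :
    latDet (triangleDir a b i) (triangleDir a b (i + 1)) = 1 := by
  simp only [latDet] at h
  rcases zmod_three_cases i with rfl | rfl | rfl
  · exact h
  · change latDet b (-(a + b)) = 1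
    simp only [latDet, Prod.fst_neg, Prod.snd_neg, Prod.fst_add, Prod.snd_add]
    linarith
  · change latDet (-(a + b)) a = 1
    simp only [latDet, Prod.fst_neg, Prod.snd_neg, Prod.fst_add, Prod.snd_add]
    linarith

/-- The triangle dual to a smooth vertex. -/
def triangle (a b : Lattice) (h : latDet a b = 1) : ConvexPolygon where
  n := 3
  three_le := le_rfl
  vertex := triangleVertex a b
  convex i j h1 h2 := by
    -- In `ZMod 3` only one index remains besides `i` and `i + 1`.
    have hj : j = i + 1 + 1 := by
      clear h
      decide +revert
    have e1 := triangleVertex_sub a b i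
    have e2 := triangleVertex_sub a b (i + 1)
    have h3 : (latDet (triangleDir a b i) (triangleDir a b (i + 1)) : ℝ) = 1 := by
      exact_mod_cast latDet_triangleDir h i
    have h4 : triangleVertex a b j - triangleVertex a b i =
        toPlane (rotate (triangleDir a b (i + 1))) + toPlane (rotate (triangleDir a b i)) := by
      rw [← e1, ← e2, hj]; abel
    rw [e1, h4]
    simp only [latDet] at h3
    push_cast at h3
    simp [det, rotate]
    linarith

theorem triangle_twiceArea (a b : Lattice) (h : latDet a b = 1) :
    (triangle a b h).twiceArea = 1 := by
  have h' : (a.1 : ℝ) * b.2 - a.2 * b.1 = 1 := by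
    simp only [latDet] at h; exact_mod_cast h
  have hsum : ∑ i : ZMod 3, det (triangleVertex a b i) (triangleVertex a b (i + 1)) = 1 := by
    rw [show (Finset.univ : Finset (ZMod 3)) = {0, 1, 2} by decide,
      Finset.sum_insert (by decide), Finset.sum_pair (by decide), ← add_assoc]
    change det 0 (toPlane (rotate a)) + det (toPlane (rotate a)) (toPlane (rotate (a + b))) +
      det (toPlane (rotate (a + b))) 0 = 1
    simp [det, rotate]
    linarith
  exact hsum

theorem triangle_isDualPolygon {x : Plane} {a b : Lattice} (h : latDet a b = 1)
    (hdir : P.directions x = {a, b, -(a + b)}) (hw : ∀ u ∈ P.directions x, P.HasWeight x u 1) :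
    P.IsDualPolygon x (triangle a b h) := by
  have hab : a ≠ b := by
    rintro rfl
    rw [latDet_self] at h
    exact absurd h (by norm_num)
  have hac : a ≠ -(a + b) := by
    intro h1
    have h2 : latDet a (-(a + b)) = 0 := by rw [← h1, latDet_self]
    rw [latDet_neg_right, latDet_add_right, latDet_self, h] at h2
    exact absurd h2 (by norm_num)
  have hbc : b ≠ -(a + b) := by
    intro h1
    have h2 : latDet b (-(a + b)) = 0 := by rw [← h1, latDet_self]
    rw [latDet_neg_right, latDet_add_right, latDet_self, latDet_swap, h] at h2
    exact absurd h2 (by norm_num)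
  have hmem : ∀ i, triangleDir a b i ∈ P.directions x := by
    rw [hdir]
    intro i
    rcases zmod_three_cases i with rfl | rfl | rfl
    exacts [.inl rfl, .inr (.inl rfl), .inr (.inr rfl)]
  constructor
  · intro (i : ZMod 3)
    rcases zmod_three_cases i with rfl | rfl | rfl
    exacts [⟨0, toPlane_zero.symm⟩, ⟨_, rfl⟩, ⟨_, rfl⟩]
  · refine ⟨triangleDir a b, fun _ => 1, ?_, ?_, ?_⟩
    · intro (i : ZMod 3) (j : ZMod 3) hij
      rcases zmod_three_cases i with rfl | rfl | rfl <;>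
        rcases zmod_three_cases j with rfl | rfl | rfl <;>
        first
        | rfl
        | exact absurd hij hab
        | exact absurd hij hab.symm
        | exact absurd hij hac
        | exact absurd hij hac.symm
        | exact absurd hij hbc
        | exact absurd hij hbc.symm
    · refine Set.Subset.antisymm (Set.range_subset_iff.2 hmem) ?_
      rw [hdir]
      rintro u (rfl | rfl | rfl)
      exacts [⟨(0 : ZMod 3), rfl⟩, ⟨(1 : ZMod 3), rfl⟩, ⟨(2 : ZMod 3), rfl⟩]
    · intro (i : ZMod 3)
      refine ⟨hw _ (hmem i), ?_⟩
      rw [Nat.cast_one, one_smul]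
      exact triangleVertex_sub a b i

/-- Three rays of weight one in the directions `a`, `b`, `-(a + b)`, rotated by a right angle, close
up to a triangle of doubled area `latDet a b`. -/
theorem IsTame.isSmoothVertex (hN : P.IsTame N) {x : Plane} {t : ℝ} (hx : P.IsVisitedAt x t)
    {a b : Lattice} (h : latDet a b = 1) (hrays : P.rays x t = {a, b, -(a + b)})
    (hmass : ∀ k p u, P.IsRay x t k p u → p.mass = 1) :
    P.IsVertex x ∧ P.valency x = 3 ∧ P.IsSmoothVertex x := by
  have hdir := hN.directions_eq hx
  have hvert : P.IsVertex x := by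
    by_contra hv
    have := hN.latDet_eq_zero_of_not_isVertex hx hv (u := a) (w := b) (by rw [hrays]; simp)
      (by rw [hrays]; simp)
    rw [h] at this
    exact absurd this (by norm_num)
  have hdual : P.IsDualPolygon x (triangle a b h) := by
    refine triangle_isDualPolygon h (hdir.trans hrays) fun u hu => ?_
    rw [hdir] at hu
    obtain ⟨k, p, hu⟩ := hu
    have := hN.hasWeight_of_isRay hu
    rwa [hmass k p u hu] at this
  refine ⟨hvert, ?_, hvert, _, hdual, triangle_twiceArea a b h⟩
  obtain ⟨-, u, -, hinj, hrange, -⟩ := hdual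
  rw [valency, ← hrange, ← Set.image_univ, Set.ncard_image_of_injective _ hinj, Set.ncard_univ]
  change Nat.card (Fin 3) = 3
  simp

/-! ### The points visited before the front degenerates -/

/-- Between collisions a single particle of mass one passes. At a collision time either a particle
goes on undisturbed or two merge at a smooth vertex. At time 0 only the vertices of the polygon are
visited. -/
theorem History.regular_point (H : History P D K) (hN : P.IsTame N) (hKN : K < N) {x : Plane}
    {t : ℝ} (hx : P.IsVisitedAt x t) (ht : t < (P.stage (K + 1)).time) :
    (¬ P.IsVertex x → P.weightAt x = 1) ∧
    (P.IsVertex x → x ∉ Set.range P.vertex → P.valency x = 3 ∧ P.IsSmoothVertex x) := by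
  -- The moment of a regular collision, seen from a particle arriving at `x`; the particles of both
  -- adjacent stages matter.
  have hjoint : ∀ j < K, ∀ p ∈ (P.stage j).alive, p.posAt (P.stage (j + 1)).time = x →
      t = (P.stage (j + 1)).time →
      (¬ P.IsVertex x → P.weightAt x = 1) ∧
      (P.IsVertex x → x ∉ Set.range P.vertex → P.valency x = 3 ∧ P.IsSmoothVertex x) := by
    rintro j hj p hp rfl rfl
    have hjN : j < N := hj.trans hKN
    have hlt : (P.stage j).time < (P.stage (j + 1)).time := (hN.free j hjN).lt
    have hlt' : (P.stage (j + 1)).time < (P.stage (j + 1 + 1)).time :=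
      (hN.free (j + 1) (by omega)).lt
    have hinj := (hN.free (j + 1) (by omega)).inj
    rcases (H.regular j hj).cases p hp with ⟨hp', huniq⟩ | ⟨p₁, hp₁, p₂, hp₂, r, hr, e1, e2, e3, hdet,
      hvel, huniq⟩
    · have hall : ∀ i < N, ∀ q ∈ (P.stage i).alive, (P.stage i).time ≤ (P.stage (j + 1)).time →
          (P.stage (j + 1)).time ≤ (P.stage (i + 1)).time →
          q.posAt (P.stage (j + 1)).time = p.posAt (P.stage (j + 1)).time → q = p := by
        intro i hi q hq h3 h4 h5
        rcases hN.eq_or_eq_of_eq hjN hi rfl h3 h4 with rfl | rfl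
        · exact huniq q hq h5
        · exact hinj q hq p hp' _ le_rfl hlt' h5
      have hw := hN.weightAt_eq_of_unique hx hp hlt.le le_rfl rfl hall
      rw [H.mass j hj.le p hp] at hw
      refine ⟨fun _ => hw, fun hv => absurd hv ?_⟩
      refine hN.not_isVertex hx (u := p.vel) ?_
      ext u
      constructor
      · rintro ⟨i, q, hq, hqx, h3⟩
        have hi := lt_of_mem_alive hN.alive hq
        rcases h3 with h3 | h3
        · obtain rfl := hall i hi q hq h3.1 h3.2.1.le hqx
          exact .inl h3.2.2
        · obtain rfl := hall i hi q hq h3.1.le h3.2.1 hqx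
          exact .inr h3.2.2
      · rintro (rfl | rfl)
        · exact ⟨j + 1, p, hp', rfl, .inl ⟨le_rfl, hlt', rfl⟩⟩
        · exact ⟨j, p, hp, rfl, .inr ⟨hlt, le_rfl, rfl⟩⟩
    -- Incoming particles leave rays pointing backwards, along `-p₁.vel` and `-p₂.vel`; the product
    -- leaves along `p₁.vel + p₂.vel`. The three directions sum to zero.
    · have hrays : P.rays (p.posAt (P.stage (j + 1)).time) (P.stage (j + 1)).time =
          {-p₁.vel, -p₂.vel, -(-p₁.vel + -p₂.vel)} := by
        have hsum : -(-p₁.vel + -p₂.vel) = r.vel := by rw [hvel]; abel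
        rw [hsum]
        ext u
        simp only [Set.mem_insert_iff, Set.mem_singleton_iff]
        constructor
        · rintro ⟨i, q, hq, hqx, h3⟩
          have hi := lt_of_mem_alive hN.alive hq
          have hij : i = j ∨ i = j + 1 := by
            rcases h3 with h3 | h3
            · exact hN.eq_or_eq_of_eq hjN hi rfl h3.1 h3.2.1.le
            · exact hN.eq_or_eq_of_eq hjN hi rfl h3.1.le h3.2.1
          rcases hij with rfl | rfl
          · rcases h3 with h3 | h3
            · exact absurd h3.2.1 (lt_irrefl _)
            · rcases huniq q hq hqx with rfl | rfl
              exacts [.inl h3.2.2, .inr (.inl h3.2.2)]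
          · rcases h3 with h3 | h3
            · obtain rfl := hinj q hq r hr _ le_rfl hlt' (hqx.trans e3.symm)
              exact .inr (.inr h3.2.2)
            · exact absurd h3.1 (lt_irrefl _)
        · rintro (rfl | rfl | rfl)
          · exact ⟨j, p₁, hp₁, e1, .inr ⟨hlt, le_rfl, rfl⟩⟩
          · exact ⟨j, p₂, hp₂, e2, .inr ⟨hlt, le_rfl, rfl⟩⟩
          · exact ⟨j + 1, r, hr, e3, .inl ⟨le_rfl, hlt', rfl⟩⟩
      have hs := hN.isSmoothVertex hx (a := -p₁.vel) (b := -p₂.vel)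
        (by rw [latDet_neg_left, latDet_neg_right, neg_neg, hdet]) hrays ?_
      · exact ⟨fun hv => absurd hs.1 hv, fun _ _ => hs.2⟩
      · rintro i q u ⟨hq, -, h3⟩
        have hi := lt_of_mem_alive hN.alive hq
        have hij : i = j ∨ i = j + 1 := by
          rcases h3 with h3 | h3
          · exact hN.eq_or_eq_of_eq hjN hi rfl h3.1 h3.2.1.le
          · exact hN.eq_or_eq_of_eq hjN hi rfl h3.1.le h3.2.1
        exact H.mass i (by omega) q hq
  obtain ⟨k, hk, p, hp, h1, h2, hpx⟩ := (isVisitedAt_iff hN.free hN.alive).1 hx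
  have hkK : k ≤ K := by
    by_contra h
    have := time_le hN.free (show K + 1 ≤ k by omega) hk.le
    linarith
  rcases h1.lt_or_eq with h1 | h1
  · rcases h2.lt_or_eq with h2 | h2
    · rw [← hpx]
      refine ⟨fun _ => ?_, fun hv => absurd hv (hN.not_isVertex_of_mem_Ioo hp h1 h2)⟩
      rw [hN.weightAt_of_mem_Ioo hp h1 h2, H.mass k hkK p hp]
    · have hkK' : k < K := lt_of_le_of_ne hkK fun h => by
        rw [h] at h2
        linarith
      exact hjoint k hkK' p hp (h2 ▸ hpx) h2
  · rcases k with _ | j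
    · have h0 : t = 0 := h1.symm
      have hlt : (P.stage 0).time < (P.stage (0 + 1)).time := (hN.free 0 hk).lt
      subst h0
      constructor
      · intro _
        rw [hN.weightAt_eq_of_unique hx hp h1.le h2 hpx, H.mass 0 hkK p hp]
        intro i hi q hq h3 h4 h5
        obtain rfl : i = 0 := by
          by_contra h
          have := time_lt hN.free (Nat.pos_of_ne_zero h) hi.le
          linarith
        exact (hN.free 0 hi).inj q hq p hp 0 h1.le (h1 ▸ hlt) (h5.trans hpx.symm)
      · intro _ h
        exact absurd (hpx ▸ exists_vertex_eq_of_mem_stage_zero hp) h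
    -- A particle at the start of a stage stands where some particle of the previous stage ended,
    -- which reduces to `hjoint`.
    · obtain ⟨q, hq, hqp⟩ := (H.regular j hkK).origin p hp
      change q.posAt (P.stage (j + 1)).time = p.posAt (P.stage (j + 1)).time at hqp
      refine hjoint j hkK q hq ?_ h1.symm
      rw [hqp, h1, hpx]

/-! ### The final collisions -/

theorem IsTerminalPoint.exists_lt (alive : (P.stage N).alive = ∅) {x : Plane}
    (h : P.IsTerminalPoint x) :
    ∃ k < N, x ∈ (P.stage k).collisionPoints ∧ (P.stage k).momentumAt x = 0 := by
  obtain ⟨k, ⟨t, -, p, hp, -⟩, h1, h2⟩ := h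
  exact ⟨k, lt_of_mem_alive alive hp, h1, h2⟩

/-! ### Collapse to a point -/

section Vanishing

variable {x₀ : Plane} (H : History P D K) (hV : (P.stage K).IsVanishing x₀)
include H hV

theorem History.isTame_of_isVanishing : P.IsTame (K + 1) := by
  have free : ∀ k < K + 1, (P.stage k).IsFree := fun k hk => H.free k (Nat.lt_succ_iff.1 hk)
  have alive : (P.stage (K + 1)).alive = ∅ := hV.alive
  refine ⟨free, alive, ?_⟩
  intro x t t' ht ht'
  obtain ⟨k, hk, p, hp, h1, h2, h3⟩ := (isVisitedAt_iff free alive).1 ht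
  obtain ⟨k', hk', p', hp', h1', h2', h3'⟩ := (isVisitedAt_iff free alive).1 ht'
  have e1 := H.depth k (Nat.lt_succ_iff.1 hk) p hp t h1 h2
  have e2 := H.depth k' (Nat.lt_succ_iff.1 hk') p' hp' t' h1' h2'
  rw [h3] at e1
  rw [h3'] at e2
  exact H.unique x t t' e1 e2

theorem History.isTerminalPoint_iff_of_isVanishing (x : Plane) : P.IsTerminalPoint x ↔ x = x₀ := by
  constructor
  · intro h
    obtain ⟨k, hk, h1, h2⟩ := h.exists_lt (N := K + 1) hV.alive
    rcases Nat.lt_succ_iff_lt_or_eq.1 hk with hk | rfl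
    · exact absurd h2 ((H.regular k hk).momentum x h1)
    · exact (hV.collision x).1 h1
  · rintro rfl
    exact ⟨K, (H.free K le_rfl).nonempty, (hV.collision _).2 rfl, hV.momentum⟩

theorem History.isVisitedAt_of_isVanishing :
    P.IsVisitedAt x₀ (P.stage (K + 1)).time := by
  obtain ⟨p, hp, -⟩ := H.three
  have : P.IsVisitedAt (p.posAt (P.stage (K + 1)).time) (P.stage (K + 1)).time :=
    (H.isTame_of_isVanishing hV).isVisitedAt hp (H.free K le_rfl).lt.le
    (le_refl (P.stage (K + 1)).time)
  rwa [show p.posAt (P.stage (K + 1)).time = x₀ from hV.posAt p hp] at this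

/-- Particles with equal velocities that end at the same point coincide, so on a line any two
distinct ones would have opposite velocities; three particles cannot be pairwise opposite. -/
theorem History.isVertex_of_isVanishing : P.IsVertex x₀ := by
  by_contra hv
  have hN := H.isTame_of_isVanishing hV
  have hx := H.isVisitedAt_of_isVanishing hV
  have hray : ∀ p ∈ (P.stage K).alive, -p.vel ∈ P.rays x₀ (P.stage (K + 1)).time := fun p hp =>
    ⟨K, p, hp, hV.posAt p hp, .inr ⟨(H.free K le_rfl).lt, le_rfl, rfl⟩⟩
  have hinj : ∀ p ∈ (P.stage K).alive, ∀ q ∈ (P.stage K).alive, p.vel = q.vel → p = q := by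
    intro p hp q hq hpq
    refine (H.free K le_rfl).inj p hp q hq (P.stage K).time le_rfl (H.free K le_rfl).lt ?_
    rw [p.posAt_eq_add (P.stage K).next.time, q.posAt_eq_add (P.stage K).next.time, hpq,
      hV.posAt p hp, hV.posAt q hq]
  have hneg : ∀ p ∈ (P.stage K).alive, ∀ q ∈ (P.stage K).alive, p ≠ q → q.vel = -p.vel := by
    intro p hp q hq hpq
    have h1 := hN.latDet_eq_zero_of_not_isVertex hx hv (hray p hp) (hray q hq)
    rw [latDet_neg_left, latDet_neg_right, neg_neg] at h1
    rcases (hN.primitive hp).eq_or_eq_neg (hN.primitive hq) h1 with h2 | h2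
    · exact absurd (hinj p hp q hq h2.symm) hpq
    · exact h2
  obtain ⟨p, hp, q, hq, r, hr, h1, h2, h3⟩ := H.three
  exact h3 (hinj q hq r hr ((hneg p hp q hq h1).trans (hneg p hp r hr h2).symm))

theorem History.lt_or_eq_of_isVanishing {x : Plane} {t : ℝ} (hx : P.IsVisitedAt x t) :
    t < (P.stage (K + 1)).time ∨ x = x₀ := by
  have hN := H.isTame_of_isVanishing hV
  obtain ⟨k, hk, p, hp, h1, h2, h3⟩ := (isVisitedAt_iff hN.free hN.alive).1 hx
  rcases (h2.trans (time_le hN.free (Nat.succ_le_of_lt hk) le_rfl)).lt_or_eq with h | h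
  · exact .inl h
  · right
    have hkK : k = K := by
      by_contra hne
      have : (P.stage (k + 1)).time < (P.stage (K + 1)).time :=
        time_lt hN.free (by omega) le_rfl
      linarith
    subst hkK
    rw [← h3, h]
    exact hV.posAt p hp

end Vanishing

/-! ### Collapse to a segment and the last edge -/

section Flattening

variable {A : Plane} {e : Lattice} {l : ℝ} (H : History P D K)
  (hF : (P.stage K).IsFlattening A e l)
  (hD : ∀ s, 0 ≤ s → s ≤ l → D (A - s • toPlane e) (P.stage (K + 1)).time)

include hF in
theorem smul_eq_of_sub_eq {s s' : ℝ} (h : A - s • toPlane e = A - s' • toPlane e) : s = s' :=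
  smul_left_injective ℝ hF.primitive.toPlane_ne_zero (sub_right_injective h)

include hF in
theorem alive_of_isFlattening : (P.stage (K + 2)).alive = ∅ := hF.isVanishing_next.alive

include hF in
theorem time_of_isFlattening :
    (P.stage (K + 2)).time = (P.stage (K + 1)).time + l / 2 :=
  Stage.next_time hF.isLeast_next

include H hF

theorem History.free_of_isFlattening : ∀ k < K + 2, (P.stage k).IsFree := by
  intro k hk
  rcases Nat.lt_succ_iff_lt_or_eq.1 hk with h | rfl
  · exact H.free k (Nat.lt_succ_iff.1 h)
  · exact hF.isFree_next

/-- The points visited after the front degenerates to a segment. -/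
theorem History.exists_of_isFlattening {x : Plane} {t : ℝ} (hx : P.IsVisitedAt x t) :
    (t < (P.stage (K + 1)).time ∧ D x t) ∨
      ∃ s, 0 ≤ s ∧ s ≤ l ∧ x = A - s • toPlane e ∧
        t = (P.stage (K + 1)).time + min s (l - s) := by
  have free := H.free_of_isFlattening hF
  have alive := alive_of_isFlattening hF
  have hl := hF.pos
  obtain ⟨k, hk, p, hp, h1, h2, h3⟩ := (isVisitedAt_iff free alive).1 hx
  rcases Nat.lt_succ_iff_lt_or_eq.1 hk with hkK | rfl
  · have hkK := Nat.lt_succ_iff.1 hkK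
    rcases (h2.trans (time_le free (Nat.succ_le_succ hkK) (Nat.le_succ _))).lt_or_eq with h | h
    · left
      have := H.depth k hkK p hp t h1 h2
      rw [h3] at this
      exact ⟨h, this⟩
    · right
      obtain rfl : k = K := by
        by_contra hne
        have : (P.stage (k + 1)).time < (P.stage (K + 1)).time :=
          time_lt free (by omega) (Nat.le_succ _)
        rw [Nat.succ_eq_add_one] at h
        linarith
      have h4 := hF.posAt p hp
      change p.posAt (P.stage (k + 1)).time = A ∨ p.posAt (P.stage (k + 1)).time = _ at h4
      rw [← h, h3] at h4
      rcases h4 with h4 | h4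
      · refine ⟨0, le_rfl, hl.le, by rw [h4]; simp, ?_⟩
        rw [h, sub_zero, min_eq_left hl.le, add_zero]
      · refine ⟨l, hl.le, le_rfl, h4, ?_⟩
        rw [h, sub_self, min_eq_right hl.le, add_zero]
  · right
    rw [time_of_isFlattening hF] at h2
    rcases (hF.alive p).1 hp with rfl | rfl
    · refine ⟨t - (P.stage (K + 1)).time, by linarith, by linarith, ?_, ?_⟩
      · rw [← h3]
        simp only [Particle.posAt, toPlane_neg, stage]
        module
      · rw [min_eq_left (by linarith)]; ring
    · refine ⟨l - (t - (P.stage (K + 1)).time), by linarith, by linarith, ?_, ?_⟩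
      · rw [← h3]
        simp only [Particle.posAt, stage]
        module
      · rw [min_eq_right (by linarith)]; ring

/-- A point of the segment is reached by the particle coming from its nearer end. -/
theorem History.isVisitedAt_of_isFlattening {s : ℝ} (h0 : 0 ≤ s) (h1 : s ≤ l) :
    P.IsVisitedAt (A - s • toPlane e) ((P.stage (K + 1)).time + min s (l - s)) := by
  rw [isVisitedAt_iff (H.free_of_isFlattening hF) (alive_of_isFlattening hF)]
  refine ⟨K + 1, by omega, ?_⟩
  rw [time_of_isFlattening hF]
  rcases le_total s (l - s) with h | h
  · refine ⟨_, (hF.alive _).2 (.inl rfl), ?_, ?_, ?_⟩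
    · rw [min_eq_left h]; linarith
    · rw [min_eq_left h]; linarith
    · rw [min_eq_left h]
      simp only [Particle.posAt, toPlane_neg, stage]
      module
  · refine ⟨_, (hF.alive _).2 (.inr rfl), ?_, ?_, ?_⟩
    · rw [min_eq_right h]; linarith
    · rw [min_eq_right h]; linarith
    · rw [min_eq_right h]
      simp only [Particle.posAt, stage]
      module

include hD in
-- Points visited before the collapse have smaller depth than the points of the segment, so they lie
-- off it; on the segment the time is determined by the position.
theorem History.isTame_of_isFlattening : P.IsTame (K + 2) := by
  refine ⟨H.free_of_isFlattening hF, alive_of_isFlattening hF, ?_⟩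
  intro x t t' ht ht'
  rcases H.exists_of_isFlattening hF ht with ⟨h1, h2⟩ | ⟨s, h1, h2, rfl, rfl⟩ <;>
    rcases H.exists_of_isFlattening hF ht' with ⟨h1', h2'⟩ | ⟨s', h1', h2', h3', rfl⟩
  · exact H.unique _ _ _ h2 h2'
  · rw [h3'] at h2
    exact absurd (H.unique _ _ _ h2 (hD s' h1' h2')) h1.ne
  · exact absurd (H.unique _ _ _ h2' (hD s h1 h2)) h1'.ne
  · rw [smul_eq_of_sub_eq hF h3']

theorem History.isTerminalPoint_iff_of_isFlattening (x : Plane) :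
    P.IsTerminalPoint x ↔ x = A - (l / 2) • toPlane e := by
  have hV := hF.isVanishing_next
  constructor
  · intro h
    obtain ⟨k, hk, h1, h2⟩ := h.exists_lt (alive_of_isFlattening hF)
    rcases Nat.lt_succ_iff_lt_or_eq.1 hk with hk | rfl
    · rcases Nat.lt_succ_iff_lt_or_eq.1 hk with hk | rfl
      · exact absurd h2 ((H.regular k hk).momentum x h1)
      · exact absurd h2 (hF.momentum x h1)
    · exact (hV.collision x).1 h1
  · rintro rfl
    exact ⟨K + 1, hF.isFree_next.nonempty, (hV.collision _).2 rfl, hV.momentum⟩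

omit H in
theorem exists_of_mem_openSegment_of_isFlattening {x : Plane}
    (hx : x ∈ openSegment ℝ A (A - l • toPlane e)) :
    ∃ s, 0 < s ∧ s < l ∧ x = A - s • toPlane e := by
  obtain ⟨a, b, ha, hb, hab, rfl⟩ := hx
  have hl := hF.pos
  refine ⟨b * l, mul_pos hb hl, by nlinarith, ?_⟩
  have : A = (a + b) • A := by rw [hab, one_smul]
  nth_rewrite 3 [this]
  module

omit H hF in
theorem mem_openSegment_of_lt {s : ℝ} (h0 : 0 < s) (h1 : s < l) :
    A - s • toPlane e ∈ openSegment ℝ A (A - l • toPlane e) := by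
  have := add_smul_mem_openSegment A (-toPlane e) h0 h1
  simpa [sub_eq_add_neg] using this

include hD

theorem History.isVertex_left : P.IsVertex A := by
  by_contra hv
  have hN := H.isTame_of_isFlattening hF hD
  have hlt := hF.isFree_next.lt
  obtain ⟨p, hp, hpA, hdet⟩ := hF.left
  have hx : P.IsVisitedAt A (P.stage (K + 1)).time := by
    have : P.IsVisitedAt (p.posAt (P.stage (K + 1)).time) (P.stage (K + 1)).time :=
      hN.isVisitedAt hp (H.free K le_rfl).lt.le (le_refl (P.stage (K + 1)).time)
    rwa [show p.posAt (P.stage (K + 1)).time = A from hpA] at this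
  have h1 := hN.latDet_eq_zero_of_not_isVertex hx hv (u := -e) (w := -p.vel)
    ⟨K + 1, _, (hF.alive _).2 (.inl rfl), by simp [Particle.posAt, stage],
      .inl ⟨le_rfl, hlt, rfl⟩⟩
    ⟨K, p, hp, hpA, .inr ⟨(H.free K le_rfl).lt, le_rfl, rfl⟩⟩
  rw [latDet_neg_left, latDet_neg_right, neg_neg] at h1
  exact hdet h1

theorem History.isVertex_right : P.IsVertex (A - l • toPlane e) := by
  by_contra hv
  have hN := H.isTame_of_isFlattening hF hD
  have hlt := hF.isFree_next.lt
  obtain ⟨p, hp, hpA, hdet⟩ := hF.right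
  have hx : P.IsVisitedAt (A - l • toPlane e) (P.stage (K + 1)).time := by
    have : P.IsVisitedAt (p.posAt (P.stage (K + 1)).time) (P.stage (K + 1)).time :=
      hN.isVisitedAt hp (H.free K le_rfl).lt.le (le_refl (P.stage (K + 1)).time)
    rwa [show p.posAt (P.stage (K + 1)).time = A - l • toPlane e from hpA] at this
  have h1 := hN.latDet_eq_zero_of_not_isVertex hx hv (u := e) (w := -p.vel)
    ⟨K + 1, _, (hF.alive _).2 (.inr rfl), by simp [Particle.posAt, stage],
      .inl ⟨le_rfl, hlt, rfl⟩⟩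
    ⟨K, p, hp, hpA, .inr ⟨(H.free K le_rfl).lt, le_rfl, rfl⟩⟩
  rw [latDet_neg_right, neg_eq_zero] at h1
  exact hdet h1

theorem History.not_isVertex_and_weightAt {s : ℝ} (h0 : 0 < s) (h1 : s < l) (hne : s ≠ l / 2) :
    ¬ P.IsVertex (A - s • toPlane e) ∧ P.weightAt (A - s • toPlane e) = 2 := by
  have hN := H.isTame_of_isFlattening hF hD
  have ht := time_of_isFlattening hF
  rcases hne.lt_or_gt with h | h
  · have hp : _ ∈ (P.stage (K + 1)).alive := (hF.alive _).2 (.inl rfl)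
    have e1 : (P.stage (K + 1)).time < (P.stage (K + 1)).time + s := by linarith
    have e2 : (P.stage (K + 1)).time + s < (P.stage (K + 1 + 1)).time := by
      rw [ht]; linarith
    have e3 : (⟨(P.stage K).next.time, A, -e, 2⟩ : Particle).posAt
        ((P.stage (K + 1)).time + s) = A - s • toPlane e := by
      simp only [Particle.posAt, toPlane_neg, stage]
      module
    rw [← e3]
    exact ⟨hN.not_isVertex_of_mem_Ioo hp e1 e2, hN.weightAt_of_mem_Ioo hp e1 e2⟩
  · have hp : _ ∈ (P.stage (K + 1)).alive := (hF.alive _).2 (.inr rfl)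
    have e1 : (P.stage (K + 1)).time < (P.stage (K + 1)).time + (l - s) := by linarith
    have e2 : (P.stage (K + 1)).time + (l - s) < (P.stage (K + 1 + 1)).time := by
      rw [ht]; linarith
    have e3 : (⟨(P.stage K).next.time, A - l • toPlane e, e, 2⟩ : Particle).posAt
        ((P.stage (K + 1)).time + (l - s)) = A - s • toPlane e := by
      simp only [Particle.posAt, stage]
      module
    rw [← e3]
    exact ⟨hN.not_isVertex_of_mem_Ioo hp e1 e2, hN.weightAt_of_mem_Ioo hp e1 e2⟩

/-- The two annihilating particles leave opposite rays, so the curve is a straight line there. -/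
theorem History.not_isVertex_mid : ¬ P.IsVertex (A - (l / 2) • toPlane e) := by
  have hN := H.isTame_of_isFlattening hF hD
  have ht := time_of_isFlattening hF
  have hl := hF.pos
  have hx := H.isVisitedAt_of_isFlattening hF (s := l / 2) (by linarith) (by linarith)
  rw [min_eq_left (by linarith), ← ht] at hx
  have hK : K + 1 < K + 2 := by omega
  have hlt : (P.stage (K + 1)).time < (P.stage (K + 2)).time := by rw [ht]; linarith
  have hpos : ∀ p ∈ (P.stage (K + 1)).alive,
      p.posAt (P.stage (K + 2)).time = A - (l / 2) • toPlane e := hF.isVanishing_next.posAt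
  refine hN.not_isVertex hx (u := e) ?_
  ext u
  constructor
  · rintro ⟨k, p, hp, hpx, h⟩
    have hk := lt_of_mem_alive hN.alive hp
    have h2 : (P.stage (K + 2)).time ≤ (P.stage (k + 1)).time := by
      rcases h with h | h
      exacts [h.2.1.le, h.2.1]
    obtain rfl : k = K + 1 := by
      by_contra hne
      have : (P.stage (k + 1)).time < (P.stage (K + 2)).time :=
        time_lt hN.free (by omega) le_rfl
      linarith
    rcases h with h | h
    · exact absurd h.2.1 (lt_irrefl _)
    · rcases (hF.alive p).1 hp with rfl | rfl
      · left; rw [h.2.2, neg_neg]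
      · right; exact h.2.2
  · rintro (rfl | rfl)
    · have hp := (hF.alive _).2 (.inl rfl)
      exact ⟨K + 1, _, hp, hpos _ hp, .inr ⟨hlt, le_rfl, (neg_neg _).symm⟩⟩
    · have hp := (hF.alive _).2 (.inr rfl)
      exact ⟨K + 1, _, hp, hpos _ hp, .inr ⟨hlt, le_rfl, rfl⟩⟩

theorem History.isEdge_last : P.IsEdge A (A - l • toPlane e) := by
  refine ⟨?_, H.isVertex_left hF hD, H.isVertex_right hF hD, ?_⟩
  · intro h
    have : (0 : ℝ) = l := smul_eq_of_sub_eq hF (by rw [zero_smul, sub_zero]; exact h)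
    exact hF.pos.ne this
  · intro x hx
    obtain ⟨s, h0, h1, rfl⟩ := exists_of_mem_openSegment_of_isFlattening hF hx
    refine ⟨mem_curve_iff.2 ⟨_, H.isVisitedAt_of_isFlattening hF h0.le h1.le⟩, ?_⟩
    by_cases h : s = l / 2
    · rw [h]; exact H.not_isVertex_mid hF hD
    · exact (H.not_isVertex_and_weightAt hF hD h0 h1 h).1

theorem History.hasMultiplicity_last : P.HasMultiplicity A (A - l • toPlane e) 2 := by
  -- Both particles end at the midpoint, so it is the one point at which the weight may differ from
  -- 2.
  refine (Set.finite_singleton (A - (l / 2) • toPlane e)).subset ?_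
  rintro x ⟨hx, hw⟩
  obtain ⟨s, h0, h1, rfl⟩ := exists_of_mem_openSegment_of_isFlattening hF hx
  by_cases h : s = l / 2
  · rw [h]; rfl
  · exact absurd (H.not_isVertex_and_weightAt hF hD h0 h1 h).2 hw

/-- The inner points of the other edges are visited before the front degenerates. -/
theorem History.lt_of_isEdge {a b : Plane} (hab : P.IsEdge a b)
    (hne : s(a, b) ≠ s(A, A - l • toPlane e)) {x : Plane} (hx : x ∈ openSegment ℝ a b) {t : ℝ}
    (ht : P.IsVisitedAt x t) : t < (P.stage (K + 1)).time := by
  rcases H.exists_of_isFlattening hF ht with h | ⟨s, h0, h1, rfl, -⟩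
  · exact h.1
  exfalso
  have hv := (hab.2.2.2 _ hx).2
  -- A later point lies on the last segment: if inside, the two edges share an inner point and
  -- coincide; if at an end, a vertex lies inside an edge.
  rcases h0.lt_or_eq with h0 | rfl
  · rcases h1.lt_or_eq with h1 | rfl
    · exact hne ((H.isEdge_last hF hD).eq_of_mem hab (mem_openSegment_of_lt h0 h1) hx)
    · exact hv (H.isVertex_right hF hD)
  · rw [zero_smul, sub_zero] at hv
    exact hv (H.isVertex_left hF hD)

theorem History.isLastEdge : P.IsLastEdge A (A - l • toPlane e) := by
  refine ⟨H.isEdge_last hF hD, ?_⟩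
  intro a b hab hne x hx y hy t t' ht ht'
  have h1 := H.lt_of_isEdge hF hD hab hne hy ht'
  obtain ⟨s, h0, hs, rfl⟩ := exists_of_mem_openSegment_of_isFlattening hF hx
  have h2 := (H.isTame_of_isFlattening hF hD).unique _ _ _ ht
    (H.isVisitedAt_of_isFlattening hF h0.le hs.le)
  have h3 : 0 ≤ min s (l - s) := le_min h0.le (by linarith)
  linarith

end Flattening

end ConvexPolygon

end Caustic

/-! ### Assembly of the two kinds of collapse -/

theorem mainTheorem10 (P : Caustic.ConvexPolygon) (hP : P.IsDelzant) :
    (∃ k, (P.stage k).alive = ∅) ∧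
    ∃ p : Caustic.Plane, (∀ x, P.IsTerminalPoint x ↔ x = p) ∧
      (P.IsVertex p →
        (∀ a b, P.IsEdge a b → P.HasMultiplicity a b 1) ∧
        (∀ x, P.IsVertex x → x ∉ Set.range P.vertex → x ≠ p →
          P.valency x = 3 ∧ P.IsSmoothVertex x)) ∧
      (¬ P.IsVertex p →
        ∃ a b, P.IsLastEdge a b ∧ p = midpoint ℝ a b ∧ P.HasMultiplicity a b 2 ∧
          (∀ a' b', P.IsEdge a' b' → s(a', b') ≠ s(a, b) → P.HasMultiplicity a' b' 1) ∧
          (∀ x, P.IsVertex x → x ∉ Set.range P.vertex → x ≠ a → x ≠ b →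
            P.valency x = 3 ∧ P.IsSmoothVertex x)) := by
  open Caustic ConvexPolygon in
  -- Collapse to a point makes the terminal point a vertex and collapse to a segment makes it a
  -- non-vertex, so in each case one of the two implications is vacuous.
  obtain ⟨D, K, H, ⟨x₀, hV⟩ | ⟨A, e, l, hF, hD⟩⟩ := exists_history hP
  · have hN := H.isTame_of_isVanishing hV
    refine ⟨⟨K + 1, hV.alive⟩, x₀, H.isTerminalPoint_iff_of_isVanishing hV, fun _ => ⟨?_, ?_⟩,
      fun h => absurd (H.isVertex_of_isVanishing hV) h⟩
    · intro a b hab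
      refine Set.Finite.subset Set.finite_empty ?_
      rintro x ⟨hx, hw⟩
      obtain ⟨hxc, hxv⟩ := hab.2.2.2 x hx
      obtain ⟨t, ht⟩ := mem_curve_iff.1 hxc
      rcases H.lt_or_eq_of_isVanishing hV ht with h | rfl
      · exact hw ((H.regular_point hN (Nat.lt_succ_self K) ht h).1 hxv)
      · exact hxv (H.isVertex_of_isVanishing hV)
    · intro x hxv hxr hne
      obtain ⟨t, ht⟩ := mem_curve_iff.1 hxv.1
      rcases H.lt_or_eq_of_isVanishing hV ht with h | h
      · exact (H.regular_point hN (Nat.lt_succ_self K) ht h).2 hxv hxr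
      · exact absurd h hne
  · have hN := H.isTame_of_isFlattening hF hD
    refine ⟨⟨K + 2, alive_of_isFlattening hF⟩, A - (l / 2) • toPlane e,
      H.isTerminalPoint_iff_of_isFlattening hF, fun h => absurd h (H.not_isVertex_mid hF hD),
      fun _ => ⟨A, A - l • toPlane e, H.isLastEdge hF hD, ?_, H.hasMultiplicity_last hF hD,
        ?_, ?_⟩⟩
    · rw [midpoint_eq_smul_add, invOf_eq_inv]
      module
    · intro a b hab hne
      refine Set.Finite.subset Set.finite_empty ?_
      rintro x ⟨hx, hw⟩
      obtain ⟨hxc, hxv⟩ := hab.2.2.2 x hx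
      obtain ⟨t, ht⟩ := mem_curve_iff.1 hxc
      exact hw ((H.regular_point hN (by omega) ht (H.lt_of_isEdge hF hD hab hne hx ht)).1 hxv)
    · intro x hxv hxr hxA hxB
      obtain ⟨t, ht⟩ := mem_curve_iff.1 hxv.1
      rcases H.exists_of_isFlattening hF ht with h | ⟨s, h0, h1, rfl, -⟩
      · exact (H.regular_point hN (by omega) ht h.1).2 hxv hxr
      · exfalso
        -- A vertex on the segment other than its ends would be an inner point of the last edge.
        have h0' : 0 < s := h0.lt_of_ne fun h => hxA (by rw [← h, zero_smul, sub_zero])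
        have h1' : s < l := h1.lt_of_ne fun h => hxB (by rw [h])
        exact ((H.isEdge_last hF hD).2.2.2 _ (mem_openSegment_of_lt h0' h1')).2 hxv
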